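/- **Notation.** Let $\mu>0$, $\kappa=\sqrt{\mu/3}$, and let $\mathcal K^0_\mu(x)=\frac1\kappa J_0(\frac x\kappa)$ for $x\ge 0$, where $J_0(x)=\frac1\pi\int_0^\pi\cos(x\sin\theta)\,d\theta$ is the Bessel function. Write $(k*_xg)(x)=\int_0^x k(x-x')g(x')\,dx'$ and $\mathbb R^+=[0,\infty)$; all functions are real valued. For $a\in\mathbb R$ let $L^2_a(\mathbb R^+)$ be the space of measurable $v$ with $|v|_{L^2_a}^2=\int_0^\infty e^{-2ax}|v(x)|^2dx<\infty$, and let $H^1_a(\mathbb R^+)$ be the space of $v\in L^2_a$ whose weak derivative $\partial_xv$ is in $L^2_a$, with norm $|v|_{H^1_a}=|v|_{L^2_a}+|\partial_xv|_{L^2_a}$ (such a $v$ has a representative that is continuous on $[0,\infty)$, whose value at $0$ is denoted $v(0)$). Let $$\mathbb X^1_a=C(\mathbb R^+_t;H^1_a)\cap C^1(\mathbb R^+_t;L^2_a),\qquad \mathbb Y^1_a=L^1_{\rm loc}(\mathbb R^+_t;H^1_a)\cap W^{1,1}_{\rm loc}(\mathbb R^+_t;L^2_a),$$ where "loc" means on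 every compact interval $[0,T]$. Consider the nonlocal initial boundary value problem on $\mathbb R^+_t\times\mathbb R^+_x$ $$(\ast)\qquad \partial_tu+\mathcal K^0_\mu*_x\partial_xu=f,\qquad u_{|x=0}=\underline u,\qquad u_{|t=0}=u^{\rm in}.$$ **Theorem.** Let $\mu>0$. (1) Let $a>0$. Then $\mathcal K^0_\mu\in L^2_a(\mathbb R^+)$, and there is a constant $c_a>0$ (depending only on $a$ and $\mu$) such that the following holds. Let $f\in\mathbb Y^1_a$, $u^{\rm in}\in H^1_a(\mathbb R^+_x)$ and $\underline u\in W^{1,1}_{\rm loc}(\mathbb R^+_t)$ (taken continuous) satisfy the two compatibility conditions $$\underline u(0)=u^{\rm in}(0),\qquad \partial_t\underline u(t)=f(t,0)\quad\text{for almost every }t>0 .$$ Then $(\ast)$ has a unique solution $u\in\mathbb X^1_a$, and for all $t\ge0$ $$|u(t,\cdot)|_{H^1_a}\le e^{-c_at}|u^{\rm in}|_{H^1_a}+\int_0^te^{-c_a(t-t')}\Big[|f(t',\cdot)|_{H^1_a}+|\mathcal K^0_\mu|_{L^2_a}\,|\underline u(t')|\Big]dt'.$$ (2) (No weight, zero boundary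 data.) Let $f\in\mathbb Y^1_0$ and $u^{\rm in}\in H^1_0(\mathbb R^+)$ (the case $a=0$ of the spaces above) with $u^{\rm in}(0)=0$ and $f(t,0)=0$ for almost every $t>0$. Then there is a unique $u\in C(\mathbb R^+_t;H^1_0(\mathbb R^+))$ which, for every $b>0$, belongs to $\mathbb X^1_b$ and solves $(\ast)$ with $\underline u=0$; and for all $t\ge0$ $$|u(t,\cdot)|_{H^1_0}\le |u^{\rm in}|_{H^1_0}+\int_0^t|f(t',\cdot)|_{H^1_0}\,dt'.$$ -/

import Mathlib

open Set MeasureTheory Filter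
open scoped ContDiff

noncomputable section

namespace NonlocalTransport

/-- The Bessel function of the first kind of integer order `n` (Bessel's integral). -/
def besselJ (n : ℕ) (t : ℝ) : ℝ :=
  (1 / Real.pi) * ∫ θ in (0 : ℝ)..Real.pi, Real.cos (n * θ - t * Real.sin θ)

/-- The dispersive length `κ = √(μ/3)`. -/
def kappa (μ : ℝ) : ℝ := Real.sqrt (μ / 3)

/-- The Bessel kernel `𝒦⁰_μ(x) = κ⁻¹ J₀(x/κ)`. -/
def besselKernel (μ : ℝ) (x : ℝ) : ℝ := (1 / kappa μ) * besselJ 0 (x / kappa μ)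

/-- The causal convolution `(k * g)(x) = ∫₀ˣ k(x - y) g(y) dy`. -/
def causalConv (k g : ℝ → ℝ) (x : ℝ) : ℝ := ∫ y in (0 : ℝ)..x, k (x - y) * g y

/-- The measure `e^{-2ax} dx` on the half-line `(0, ∞)`. -/
def weightedMeasure (a : ℝ) : Measure ℝ :=
  (volume.restrict (Ioi 0)).withDensity (fun x => ENNReal.ofReal (Real.exp (-2 * a * x)))

/-- The weighted space `L²_a(ℝ⁺)`. -/
abbrev L2a (a : ℝ) : Type := Lp ℝ 2 (weightedMeasure a)

/-- `w` is the weak (distributional) derivative of `v` on the open half-line `(0, ∞)`. -/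
def HasWeakDeriv {E : Type*} [NormedAddCommGroup E] [NormedSpace ℝ E] (v w : ℝ → E) : Prop :=
  ∀ φ : ℝ → ℝ, ContDiff ℝ ∞ φ → HasCompactSupport φ → tsupport φ ⊆ Ioi 0 →
    ∫ s in Ioi (0 : ℝ), deriv φ s • v s = - ∫ s in Ioi (0 : ℝ), φ s • w s

/-- `w` is the weak derivative of `v`, and both are integrable on every `[0, T]`:
this says `v ∈ W^{1,1}_loc(ℝ⁺; E)` with derivative `w`. -/
structure IsW11Loc {E : Type*} [NormedAddCommGroup E] [NormedSpace ℝ E] (v w : ℝ → E) :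
    Prop where
  locInt : LocallyIntegrableOn v (Ici 0) volume
  locInt_deriv : LocallyIntegrableOn w (Ici 0) volume
  weakDeriv : HasWeakDeriv v w

/-- The (class of) function `v` on `(0, ∞)` has a representative that is continuous on `[0, ∞)`
and takes the value `c` at `0`. -/
def HasBoundaryValue (v : ℝ → ℝ) (c : ℝ) : Prop :=
  ∃ g : ℝ → ℝ, ContinuousOn g (Ici 0) ∧ v =ᵐ[volume.restrict (Ioi 0)] g ∧ g 0 = c

theorem ae_restrict_of_ae_weighted {a : ℝ} {p : ℝ → Prop}
    (h : ∀ᵐ x ∂(weightedMeasure a), p x) : ∀ᵐ x ∂(volume.restrict (Ioi (0 : ℝ))), p x := by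
  refine (withDensity_absolutelyContinuous' ?_ ?_).ae_le h
  · fun_prop
  · exact Eventually.of_forall fun x => by simp [Real.exp_pos]

theorem integrable_mul_L2a {a : ℝ} (v : L2a a) {φ : ℝ → ℝ} (hφ : Continuous φ)
    (hc : HasCompactSupport φ) :
    Integrable (fun x => φ x * v x) (volume.restrict (Ioi (0 : ℝ))) := by
  have hv : MemLp v 2 (weightedMeasure a) := Lp.memLp v
  have : IsLocallyFiniteMeasure (weightedMeasure a) := by
    have h : Continuous fun x : ℝ => Real.exp (-2 * a * x) := by fun_prop
    exact IsLocallyFiniteMeasure.withDensity_ofReal h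
  have hψ : MemLp (fun x => φ x * Real.exp (2 * a * x)) 2 (weightedMeasure a) :=
    Continuous.memLp_of_hasCompactSupport (by fun_prop) hc.mul_right
  have hi := hψ.integrable_mul hv
  unfold weightedMeasure at hi
  rw [integrable_withDensity_iff_integrable_smul' (by fun_prop)
    (Eventually.of_forall fun x => ENNReal.ofReal_lt_top)] at hi
  refine hi.congr (Eventually.of_forall fun x => ?_)
  have h1 : Real.exp (-2 * a * x) * Real.exp (2 * a * x) = 1 := by
    rw [← Real.exp_add]; simp
  have key (e e' p w : ℝ) (h : e * e' = 1) : e * ((p * e') * w) = p * w := by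
    linear_combination (p * w) * h
  simp only [smul_eq_mul, ENNReal.toReal_ofReal (Real.exp_pos _).le]
  exact key _ _ _ _ h1

/-- The weighted Sobolev space `H¹_a(ℝ⁺)`: pairs `(v, ∂ₓv)` of elements of `L²_a(ℝ⁺)` in which
the second is the weak derivative of the first, with the norm `|v|_{L²_a} + |∂ₓv|_{L²_a}`. -/
def H1a (a : ℝ) : Submodule ℝ (WithLp 1 (L2a a × L2a a)) where
  carrier := {p | HasWeakDeriv (p.fst : ℝ → ℝ) (p.snd : ℝ → ℝ)}
  zero_mem' := by
    intro φ _ _ _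
    have e (ψ : ℝ → ℝ) (z : L2a a) (hz : z = 0) : ∫ s in Ioi (0 : ℝ), ψ s • z s = 0 := by
      refine integral_eq_zero_of_ae ?_
      subst hz
      filter_upwards [ae_restrict_of_ae_weighted (Lp.coeFn_zero ℝ 2 (weightedMeasure a))]
        with x hx
      rw [hx, Pi.zero_apply, smul_zero]
    rw [e (deriv φ) (WithLp.fst 0) rfl, e φ (WithLp.snd 0) rfl, neg_zero]
  add_mem' := by
    intro p q hp hq φ h1 h2 h3
    have key (ψ : ℝ → ℝ) (hψ : Continuous ψ) (hc : HasCompactSupport ψ) (v w : L2a a) :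
        ∫ s in Ioi (0 : ℝ), ψ s • (v + w) s =
          (∫ s in Ioi (0 : ℝ), ψ s • v s) + ∫ s in Ioi (0 : ℝ), ψ s • w s := by
      refine Eq.trans ?_
        (integral_add (integrable_mul_L2a v hψ hc) (integrable_mul_L2a w hψ hc))
      refine integral_congr_ae ?_
      filter_upwards [ae_restrict_of_ae_weighted (Lp.coeFn_add v w)] with x hx
      rw [hx, Pi.add_apply, smul_add]
    have := hp φ h1 h2 h3
    have := hq φ h1 h2 h3
    simp only [WithLp.add_fst, WithLp.add_snd]
    rw [key _ (h1.continuous_deriv (by simp)) h2.deriv, key _ h1.continuous h2]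
    linarith
  smul_mem' := by
    intro c p hp φ h1 h2 h3
    have key (ψ : ℝ → ℝ) (v : L2a a) :
        ∫ s in Ioi (0 : ℝ), ψ s • (c • v) s = c * ∫ s in Ioi (0 : ℝ), ψ s • v s := by
      rw [← integral_const_mul]
      refine integral_congr_ae ?_
      filter_upwards [ae_restrict_of_ae_weighted (Lp.coeFn_smul c v)] with x hx
      rw [hx, Pi.smul_apply, smul_eq_mul, smul_eq_mul, smul_eq_mul]
      ring
    have := hp φ h1 h2 h3
    simp only [WithLp.smul_fst, WithLp.smul_snd]
    rw [key, key, this]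
    ring

/-- The underlying element `v ∈ L²_a` of `v ∈ H¹_a`. -/
def toL2 {a : ℝ} (v : H1a a) : L2a a := (v : WithLp 1 (L2a a × L2a a)).fst

/-- The derivative `∂ₓv ∈ L²_a` of `v ∈ H¹_a`. -/
def dx {a : ℝ} (v : H1a a) : L2a a := (v : WithLp 1 (L2a a × L2a a)).snd

theorem norm_eq {a : ℝ} (v : H1a a) : ‖v‖ = ‖toL2 v‖ + ‖dx v‖ :=
  WithLp.prod_norm_eq_of_L1 _

/-- `u ∈ 𝕏¹_a = C(ℝ⁺_t; H¹_a) ∩ C¹(ℝ⁺_t; L²_a)`. Only times `t ≥ 0` matter. -/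
structure MemX1 {a : ℝ} (u : ℝ → H1a a) : Prop where
  cont : ContinuousOn u (Ici 0)
  contDiff : ContDiffOn ℝ 1 (fun t => toL2 (u t)) (Ici 0)

/-- `f ∈ 𝕐¹_a = L¹_loc(ℝ⁺_t; H¹_a) ∩ W^{1,1}_loc(ℝ⁺_t; L²_a)`. Only times `t ≥ 0` matter. -/
structure MemY1 {a : ℝ} (f : ℝ → H1a a) : Prop where
  locInt : LocallyIntegrableOn f (Ici 0) volume
  w11 : ∃ g : ℝ → L2a a, IsW11Loc (fun t => toL2 (f t)) g

/-- `u ∈ 𝕏¹_a` solves `∂ₜu + 𝒦⁰_μ *ₓ ∂ₓu = f` on `ℝ⁺ × ℝ⁺` with boundary data `ub` at `x = 0`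
and initial data `uin` at `t = 0`. -/
structure IsSolution (μ : ℝ) {a : ℝ} (f : ℝ → ℝ → ℝ) (uin ub : ℝ → ℝ) (u : ℝ → H1a a) :
    Prop where
  memX1 : MemX1 u
  equation : ∀ᵐ t ∂(volume.restrict (Ioi (0 : ℝ))), ∀ᵐ x ∂(volume.restrict (Ioi (0 : ℝ))),
    (derivWithin (fun s => toL2 (u s)) (Ici 0) t : L2a a) x
      + causalConv (besselKernel μ) (dx (u t)) x = f t x
  boundary : ∀ t, 0 ≤ t → HasBoundaryValue (toL2 (u t)) (ub t)
  initial : toL2 (u 0) =ᵐ[volume.restrict (Ioi 0)] uin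

/-- Solutions without weight: `u ∈ C(ℝ⁺_t; H¹(ℝ⁺))` and, for every `b > 0`, `u` belongs to
`𝕏¹_b` and solves the nonlocal problem there. -/
structure IsUnweightedSolution (μ : ℝ) (f : ℝ → ℝ → ℝ) (uin ub : ℝ → ℝ) (u : ℝ → H1a 0) :
    Prop where
  cont : ContinuousOn u (Ici 0)
  solves : ∀ b : ℝ, 0 < b → ∃ v : ℝ → H1a b, IsSolution μ f uin ub v ∧
    ∀ t, 0 ≤ t → toL2 (v t) =ᵐ[volume.restrict (Ioi 0)] toL2 (u t)

end NonlocalTransport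

end

open NonlocalTransport

/-! Let `B v = κ⁻¹ v + 𝒦' * v`, which is `∂ₓ(𝒦 * v)`. Since `𝒦'` is bounded, `B` is a bounded
operator on `L²_a` for every `a > 0`. Writing `u = ub · 1 + 1 * ∂ₓu` and using `B 1 = 𝒦` and `B (1 *
w) = 𝒦 * w`, the equation together with its boundary condition becomes the linear ODE `u' + B u = f
+ ub 𝒦` in `L²_a`, whose only solution is Duhamel's formula (`IsSolution.toL2_eq_duhamel`). The
derivative `w = ∂ₓu` obeys `w' + B w = ∂ₓf`: the compatibility conditions remove every boundary
source. Existence runs in the opposite direction: solve for `w`, put `u = ub + 1 * w`, and integrate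
using `1 * B w = 𝒦 * w` (`exists_solution`).

Decay comes from coercivity, `⟪v, B v⟫ ≥ c ‖v‖²` (`exists_coercive`). Multiplication by `e^{-ax}`
turns `L²_a` into an unweighted space and `B` into a Fourier multiplier, with symbol `κp G(κp) /
(πκ)` on the line `p = a + 2πiξ`, where `G` is `besselG`. Differentiating under the integral gives
`(1 + p²) G' + p G = 0`, so `(1 + p²) G²` is a positive constant on the right half-plane. If `p
G(p)` were purely imaginary, `p²` would be real and nonpositive, which is impossible there; by
connectedness and `G(1) > 0`, `Re (p G(p)) > 0`. By Riemann–Lebesgue the symbol tends to `1/κ` along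
the line, so its real part has a positive lower bound.

Without weight, the bound used for `B` degenerates as `a → 0`, but the contraction bounds for `exp
(-tB)` do not. Monotone convergence in the weight shows that the evolution on `L²_1` maps `L²_0` to
itself contractively (`evol_descends`). Strong continuity on `L²_0` follows because convergence in
the larger space, with norms not exceeding that of the limit, forces convergence in norm
(`exists_descent`). Duhamel's formula for this contraction semigroup then gives the second part. -/

open scoped BoundedContinuousFunction ENNReal

noncomputable section

namespace NonlocalTransport

/-! ### Bounded linear evolution equations with integrable forcing -/

section

variable {E : Type*} [NormedAddCommGroup E] [NormedSpace ℝ E]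

/-- Exchange of the order of integration on a triangle. -/
theorem integral_triangle_swap {G : ℝ → ℝ → E} {T : ℝ} (hT : 0 ≤ T)
    (hG : IntegrableOn (Function.uncurry G) (Ioc 0 T ×ˢ Ioc 0 T) (volume.prod volume)) :
    ∫ s in (0 : ℝ)..T, ∫ r in (0 : ℝ)..s, G s r = ∫ r in (0 : ℝ)..T, ∫ s in r..T, G s r := by
  have hmeas : MeasurableSet {p : ℝ × ℝ | p.2 ≤ p.1} := measurableSet_le measurable_snd measurable_fst
  have hG' : Integrable (Function.uncurry fun s r => {p : ℝ × ℝ | p.2 ≤ p.1}.indicator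
      (Function.uncurry G) (s, r)) ((volume.restrict (Ioc 0 T)).prod (volume.restrict (Ioc 0 T))) := by
    rw [Measure.prod_restrict]
    exact hG.indicator hmeas
  have hswap := integral_integral_swap hG'
  rw [intervalIntegral.integral_of_le hT, intervalIntegral.integral_of_le hT]
  calc _ = _ := ?_
    _ = _ := hswap
    _ = _ := ?_
  · refine setIntegral_congr_fun measurableSet_Ioc fun s hs => ?_
    rw [intervalIntegral.integral_of_le hs.1.le]
    have : Ioc 0 s = Iic s ∩ Ioc 0 T := by
      ext r; simp only [mem_Ioc, mem_inter_iff, mem_Iic]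
      exact ⟨fun h => ⟨h.2, h.1, h.2.trans hs.2⟩, fun h => ⟨h.2.1, h.1⟩⟩
    rw [this, ← Measure.restrict_restrict (measurableSet_Iic (a := s)),
      ← integral_indicator measurableSet_Iic]
    rfl
  · refine setIntegral_congr_fun measurableSet_Ioc fun r hr => ?_
    symm
    rw [intervalIntegral.integral_of_le hr.2, ← integral_Icc_eq_integral_Ioc]
    have : Icc r T = Ici r ∩ Ioc 0 T := by
      ext s; simp only [mem_Ioc, mem_Icc, mem_inter_iff, mem_Ici]
      exact ⟨fun h => ⟨h.1, hr.1.trans_le h.1, h.2⟩, fun h => ⟨h.1, h.2.2⟩⟩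
    rw [this, ← Measure.restrict_restrict (measurableSet_Ici (a := r)), ← integral_indicator measurableSet_Ici]
    rfl

variable {F : Type*} [NormedAddCommGroup F] [NormedSpace ℝ F] 

/-- Integration by parts against the primitive of an integrable function. -/
theorem integral_deriv_apply_primitive [CompleteSpace E] [CompleteSpace F] {L L' : ℝ → E →L[ℝ] F} (hL : ∀ t, HasDerivAt L (L' t) t)
    (hL' : Continuous L') {f : ℝ → E} {T : ℝ} (hT : 0 ≤ T)
    (hf : IntervalIntegrable f volume 0 T) :
    ∫ s in (0 : ℝ)..T, L' s (∫ r in (0 : ℝ)..s, f r) =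
      L T (∫ r in (0 : ℝ)..T, f r) - ∫ r in (0 : ℝ)..T, L r (f r) := by
  have hLc : Continuous L := continuous_iff_continuousAt.2 fun t => (hL t).continuousAt
  have hfi : IntegrableOn f (Ioc 0 T) := (intervalIntegrable_iff_integrableOn_Ioc_of_le hT).1 hf
  -- As `f` is merely integrable, its primitive need not be differentiable everywhere. Fubini on the
  -- triangle replaces the product rule: for fixed `r` the integral of `L' s (f r)` over `[r, T]` is
  -- `(L T - L r) (f r)`.
  have hInt : IntegrableOn (Function.uncurry fun s r => L' s (f r)) (Ioc 0 T ×ˢ Ioc 0 T)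
      (volume.prod volume) := by
    rw [IntegrableOn, ← Measure.prod_restrict]
    have h1 : Integrable L' (volume.restrict (Ioc 0 T)) :=
      hL'.integrableOn_Ioc
    have := Integrable.op_fst_snd (μ := volume.restrict (Ioc 0 T)) (ν := volume.restrict (Ioc 0 T))
      (op := fun (A : E →L[ℝ] F) x => A x) (by fun_prop) ⟨1, fun A x => by simpa using A.le_opNorm x⟩ h1 hfi
    exact this
  have e1 : ∫ s in (0 : ℝ)..T, L' s (∫ r in (0 : ℝ)..s, f r) =
      ∫ s in (0 : ℝ)..T, ∫ r in (0 : ℝ)..s, L' s (f r) := by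
    refine intervalIntegral.integral_congr fun s hs => ?_
    rw [uIcc_of_le hT] at hs
    refine (ContinuousLinearMap.intervalIntegral_comp_comm _ ?_).symm
    exact hf.mono_set (by rw [uIcc_of_le hs.1, uIcc_of_le hT]; exact Icc_subset_Icc le_rfl hs.2)
  have hLf : IntervalIntegrable (fun r => L r (f r)) volume 0 T := by
    rw [intervalIntegrable_iff_integrableOn_Ioc_of_le hT]
    obtain ⟨C, hC⟩ := (isCompact_Icc (a := (0:ℝ)) (b := T)).exists_bound_of_continuousOn hLc.continuousOn
    refine Integrable.mono' (hfi.norm.const_mul C) ?_ ?_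
    · exact (Continuous.comp_aestronglyMeasurable₂ (g := fun (A : E →L[ℝ] F) x => A x) (by fun_prop) hLc.aestronglyMeasurable
        hfi.aestronglyMeasurable)
    · refine (ae_restrict_iff' measurableSet_Ioc).2 (Eventually.of_forall fun r hr => ?_)
      exact ((L r).le_opNorm _).trans (mul_le_mul_of_nonneg_right (hC r ⟨hr.1.le, hr.2⟩) (norm_nonneg _))
  rw [e1, integral_triangle_swap hT hInt, ← ContinuousLinearMap.intervalIntegral_comp_comm _ hf,
    ← intervalIntegral.integral_sub _ hLf]
  · refine intervalIntegral.integral_congr fun r hr => ?_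
    have hd : ∀ s, HasDerivAt (fun s => L s (f r)) (L' s (f r)) s := fun s => by
      simpa using (hL s).clm_apply (hasDerivAt_const s (f r))
    exact intervalIntegral.integral_eq_sub_of_hasDerivAt (fun s _ => hd s)
      (by exact (hL'.clm_apply continuous_const).intervalIntegrable _ _)
  · exact ⟨(L T).integrable_comp hf.1, (L T).integrable_comp hf.2⟩

/-- The evolution family `exp (-tB)`. -/
def evol (B : E →L[ℝ] E) (t : ℝ) : E →L[ℝ] E := NormedSpace.exp (t • (-B))

@[simp] theorem evol_zero (B : E →L[ℝ] E) : evol B 0 = 1 := by simp [evol]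

/-- Duhamel's formula. -/
def duhamel (S : ℝ → E →L[ℝ] E) (x : E) (f : ℝ → E) (t : ℝ) : E :=
  S t x + ∫ s in (0 : ℝ)..t, S (t - s) (f s)

variable [CompleteSpace E] (B : E →L[ℝ] E)

theorem hasDerivAt_evol (t : ℝ) : HasDerivAt (evol B) (-(B * evol B t)) t := by
  have h := hasDerivAt_exp_smul_const' (𝕂 := ℝ) (-B) t
  rw [neg_mul] at h
  exact h

theorem continuous_evol : Continuous (evol B) :=
  continuous_iff_continuousAt.2 fun t => (hasDerivAt_evol B t).continuousAt

theorem evol_add (s t : ℝ) : evol B (s + t) = evol B s * evol B t := by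
  let _ : NormedAlgebra ℚ (E →L[ℝ] E) := NormedAlgebra.restrictScalars ℚ ℝ _
  unfold evol
  rw [add_smul, NormedSpace.exp_add_of_commute]
  exact ((Commute.refl (-B)).smul_left s).smul_right t

theorem evol_neg_mul (t : ℝ) : evol B (-t) * evol B t = 1 := by
  rw [← evol_add]; simp

variable {B} {x : E} {f y : ℝ → E}

theorem intervalIntegrable_evol_apply {a b : ℝ} (hf : IntervalIntegrable f volume a b) (t : ℝ) :
    IntervalIntegrable (fun s => evol B (t - s) (f s)) volume a b := by
  have hLc : Continuous fun s => evol B (t - s) := (continuous_evol B).comp (by fun_prop)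
  have key : ∀ a b, IntegrableOn f (Ioc a b) → IntegrableOn (fun s => evol B (t - s) (f s)) (Ioc a b) := by
    intro a b hfi
    obtain ⟨C, hC⟩ := (isCompact_Icc (a := a) (b := b)).exists_bound_of_continuousOn hLc.continuousOn
    refine Integrable.mono' (hfi.norm.const_mul C) ?_ ?_
    · exact (Continuous.comp_aestronglyMeasurable₂ (g := fun (A : E →L[ℝ] E) x => A x) (by fun_prop) hLc.aestronglyMeasurable
        hfi.aestronglyMeasurable)
    · refine (ae_restrict_iff' measurableSet_Ioc).2 (Eventually.of_forall fun r hr => ?_)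
      exact ((evol B (t-r)).le_opNorm _).trans (mul_le_mul_of_nonneg_right (hC r ⟨hr.1.le, hr.2⟩) (norm_nonneg _))
  exact ⟨key _ _ hf.1, key _ _ hf.2⟩

/-- The group law pulls `evol B t` out of the integral. What remains under the integral no longer
depends on `t`, so integration by parts and continuity of primitives apply. -/
theorem duhamel_evol_eq {t : ℝ} (hf : IntervalIntegrable f volume 0 t) :
    duhamel (evol B) x f t = evol B t (x + ∫ s in (0 : ℝ)..t, evol B (-s) (f s)) := by
  unfold duhamel
  have h := intervalIntegrable_evol_apply (B := B) hf 0
  simp only [zero_sub] at h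
  rw [map_add, ← ContinuousLinearMap.intervalIntegral_comp_comm _ h]
  congr 1
  refine intervalIntegral.integral_congr fun s _ => ?_
  rw [sub_eq_add_neg, evol_add]; rfl

/-- Duhamel's formula gives a solution of the integrated equation `y' + B y = f`. -/
theorem duhamel_evol_spec (hf : ∀ t, 0 ≤ t → IntervalIntegrable f volume 0 t) {t : ℝ} (ht : 0 ≤ t) :
    duhamel (evol B) x f t =
      x + (∫ s in (0 : ℝ)..t, f s) - ∫ s in (0 : ℝ)..t, B (duhamel (evol B) x f s) := by
  have hg : IntervalIntegrable (fun s => evol B (-s) (f s)) volume 0 t := by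
    simpa using intervalIntegrable_evol_apply (B := B) (hf t ht) 0
  have hL' : Continuous fun t => -(B * evol B t) := by
    have := continuous_evol B
    fun_prop
  -- Parts with `L = evol B` against `evol B (-s) (f s)`: in the remainder the two exponentials
  -- cancel and leave `f`.
  have key := integral_deriv_apply_primitive (hasDerivAt_evol B) hL' ht hg
  have e2 : ∫ r in (0 : ℝ)..t, evol B r (evol B (-r) (f r)) = ∫ r in (0 : ℝ)..t, f r := by
    refine intervalIntegral.integral_congr fun s _ => ?_
    have := evol_neg_mul B (-s)
    rw [neg_neg] at this
    exact congrArg (fun A : E →L[ℝ] E => A (f s)) this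
  have e3 : ∫ s in (0 : ℝ)..t, (-(B * evol B s)) x = evol B t x - x := by
    have := intervalIntegral.integral_eq_sub_of_hasDerivAt (f := fun s => evol B s x)
      (f' := fun s => (-(B * evol B s)) x) (a := 0) (b := t)
      (fun s _ => by simpa using (hasDerivAt_evol B s).clm_apply (hasDerivAt_const s x))
      ((hL'.clm_apply continuous_const).intervalIntegrable _ _)
    simpa using this
  have hcont : ContinuousOn (fun s => ∫ r in (0 : ℝ)..s, evol B (-r) (f r)) (uIcc 0 t) :=
    intervalIntegral.continuousOn_primitive_interval ((intervalIntegrable_iff').1 hg)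
  have e4 : ∫ s in (0 : ℝ)..t, B (duhamel (evol B) x f s) =
      - (∫ s in (0 : ℝ)..t, (-(B * evol B s)) x) -
        ∫ s in (0 : ℝ)..t, (-(B * evol B s)) (∫ r in (0 : ℝ)..s, evol B (-r) (f r)) := by
    rw [← intervalIntegral.integral_neg, ← intervalIntegral.integral_sub]
    · refine intervalIntegral.integral_congr fun s hs => ?_
      rw [uIcc_of_le ht] at hs
      rw [duhamel_evol_eq (hf s hs.1)]
      simp
    · exact ((hL'.clm_apply continuous_const).neg).intervalIntegrable _ _
    · exact (hL'.continuousOn.clm_apply hcont).intervalIntegrable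
  rw [e4, e3, key, e2, duhamel_evol_eq (hf t ht), map_add]
  abel

theorem continuousOn_duhamel_evol (hf : ∀ t, 0 ≤ t → IntervalIntegrable f volume 0 t) :
    ContinuousOn (duhamel (evol B) x f) (Ici 0) := by
  have h : ContinuousOn (fun t => evol B t (x + ∫ s in (0 : ℝ)..t, evol B (-s) (f s))) (Ici 0) := by
    refine (continuous_evol B).continuousOn.clm_apply (continuousOn_const.add ?_)
    intro t ht
    have hg : IntervalIntegrable (fun s => evol B (-s) (f s)) volume 0 (t + 1) := by
      simpa using intervalIntegrable_evol_apply (B := B) (hf (t + 1) (by simp at ht; linarith)) 0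
    have hc : ContinuousOn (fun s => ∫ r in (0 : ℝ)..s, evol B (-r) (f r)) (uIcc 0 (t + 1)) :=
      intervalIntegral.continuousOn_primitive_interval ((intervalIntegrable_iff').1 hg)
    simp only [mem_Ici] at ht
    rw [uIcc_of_le (by linarith)] at hc
    refine (hc t ⟨ht, by linarith⟩).mono_of_mem_nhdsWithin ?_
    refine mem_nhdsWithin.2 ⟨Iio (t + 1), isOpen_Iio, by simp, ?_⟩
    rintro s ⟨h1, h2⟩
    exact ⟨h2, le_of_lt h1⟩
  exact h.congr fun t ht => duhamel_evol_eq (hf t ht)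

/-- Uniqueness for the integrated equation `y' + B y = f`. -/
theorem eq_duhamel_evol (hf : ∀ t, 0 ≤ t → IntervalIntegrable f volume 0 t)
    (hy : ContinuousOn y (Ici 0))
    (h : ∀ t, 0 ≤ t → y t = x + (∫ s in (0 : ℝ)..t, f s) - ∫ s in (0 : ℝ)..t, B (y s))
    {t : ℝ} (ht : 0 ≤ t) : y t = duhamel (evol B) x f t := by
  set z : ℝ → E := fun t => y t - duhamel (evol B) x f t with hz
  have hzc : ContinuousOn z (Ici 0) := hy.sub (continuousOn_duhamel_evol hf)
  have hii : ∀ {g : ℝ → E} {s : ℝ}, ContinuousOn g (Ici 0) → 0 ≤ s →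
      IntervalIntegrable (fun r => B (g r)) volume 0 s := fun hg hs =>
    ContinuousOn.intervalIntegrable (B.continuous.comp_continuousOn (hg.mono (by
      rw [uIcc_of_le hs]; exact Icc_subset_Ici_self)))
  -- The datum and the forcing cancel in the difference, which solves `z' = -B z`, `z 0 = 0`;
  -- Grönwall then gives `z = 0`.
  have hzeq : ∀ s, 0 ≤ s → z s = - ∫ r in (0 : ℝ)..s, B (z r) := by
    intro s hs
    simp only [hz, map_sub]
    rw [intervalIntegral.integral_sub (hii hy hs) (hii (continuousOn_duhamel_evol hf) hs), h s hs,
      duhamel_evol_spec hf hs]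
    abel
  have hder : ∀ s ∈ Ico 0 t, HasDerivWithinAt z (-(B (z s))) (Ici s) s := by
    intro s hs
    have h1 : HasDerivWithinAt (fun u => ∫ r in (0 : ℝ)..u, B (z r)) (B (z s)) (Ici s) s := by
      have hm : ContinuousOn (fun r => B (z r)) (Ici 0) := B.continuous.comp_continuousOn hzc
      refine intervalIntegral.integral_hasDerivWithinAt_right (hii hzc hs.1) (t := Ioi s) ?_ ?_
      · exact (hm.mono fun r hr => hs.1.trans (le_of_lt hr)).stronglyMeasurableAtFilter_nhdsWithin measurableSet_Ioi _
      · exact (hm s hs.1).mono fun r hr => hs.1.trans (le_of_lt hr)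
    exact h1.neg.congr (fun u hu => hzeq u (hs.1.trans hu)) (hzeq s hs.1)
  have hG := norm_le_gronwallBound_of_norm_deriv_right_le (f := z) (f' := fun s => -(B (z s)))
    (δ := 0) (K := ‖B‖) (ε := 0) (a := 0) (b := t) (hzc.mono Icc_subset_Ici_self) hder
    (by rw [hzeq 0 le_rfl]; simp) (fun s _ => by simpa using B.le_opNorm (z s)) t ⟨ht, le_rfl⟩
  rw [gronwallBound_ε0_δ0] at hG
  exact sub_eq_zero.1 (norm_le_zero_iff.1 hG)

end

/-! ### Weak derivatives on the half-line -/

section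

variable {E : Type*} [NormedAddCommGroup E] [NormedSpace ℝ E]

theorem exists_Icc_of_tsupport_subset_Ioi {φ : ℝ → ℝ} (hc : HasCompactSupport φ)
    (hs : tsupport φ ⊆ Ioi 0) : ∃ ε T : ℝ, 0 < ε ∧ ε < T ∧ ∀ x, x ∉ Icc ε T → φ x = 0 := by
  rcases (tsupport φ).eq_empty_or_nonempty with h | h
  · refine ⟨1, 2, by norm_num, by norm_num, fun x _ => image_eq_zero_of_notMem_tsupport (by simp [h])⟩
  · obtain ⟨ε, hε⟩ := IsCompact.exists_isLeast hc h
    obtain ⟨T, hT⟩ := IsCompact.exists_isGreatest hc h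
    -- `φ` is not assumed continuous, so its support may be a single point; the shift by `1` keeps
    -- `ε < T` strict.
    refine ⟨ε, T + 1, hs hε.1, by linarith [hε.2 hT.1], fun x hx =>
      image_eq_zero_of_notMem_tsupport fun hx' => hx ⟨hε.2 hx', by linarith [hT.2 hx']⟩⟩

theorem hasCompactSupport_of_Icc {φ : ℝ → ℝ} {ε T : ℝ} (h : ∀ x, x ∉ Icc ε T → φ x = 0) :
    HasCompactSupport φ := HasCompactSupport.intro isCompact_Icc h

theorem tsupport_subset_Icc {φ : ℝ → ℝ} {ε T : ℝ} (h : ∀ x, x ∉ Icc ε T → φ x = 0) :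
    tsupport φ ⊆ Icc ε T :=
  closure_minimal (fun x hx => by by_contra hn; exact hx (h x hn)) isClosed_Icc

theorem integrable_smul_of_locallyIntegrableOn {v : ℝ → E} (hv : LocallyIntegrableOn v (Ici 0) volume)
    {φ : ℝ → ℝ} (hφ : Continuous φ) (hc : HasCompactSupport φ) :
    Integrable (fun x => φ x • v x) (volume.restrict (Ioi (0 : ℝ))) := by
  have h := (locallyIntegrableOn_iff_locallyIntegrable_restrict isClosed_Ici).1 hv
  have h2 : Integrable (fun x => φ x • v x) (volume.restrict (Ici (0 : ℝ))) :=
    h.integrable_smul_left_of_hasCompactSupport hφ hc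
  exact h2.mono_measure (Measure.restrict_mono Ioi_subset_Ici_self le_rfl)

theorem intervalIntegrable_of_locallyIntegrableOn {E : Type*} [NormedAddCommGroup E] {v : ℝ → E}
    (hv : LocallyIntegrableOn v (Ici 0) volume) {t : ℝ} (ht : 0 ≤ t) :
    IntervalIntegrable v volume 0 t := by
  rw [intervalIntegrable_iff_integrableOn_Icc_of_le ht]
  exact hv.integrableOn_compact_subset Icc_subset_Ici_self isCompact_Icc

theorem locallyIntegrableOn_of_intervalIntegrable {E : Type*} [NormedAddCommGroup E] {v : ℝ → E}
    (hv : ∀ t, 0 ≤ t → IntervalIntegrable v volume 0 t) : LocallyIntegrableOn v (Ici 0) volume := by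
  intro x hx
  simp only [mem_Ici] at hx
  refine ⟨Icc 0 (x + 1), ?_, (intervalIntegrable_iff_integrableOn_Icc_of_le (by linarith)).1
    (hv (x + 1) (by linarith))⟩
  refine mem_nhdsWithin.2 ⟨Iio (x + 1), isOpen_Iio, by simp, ?_⟩
  rintro s ⟨h1, h2⟩
  exact ⟨h2, le_of_lt h1⟩

theorem continuousOn_primitive_Ici {v : ℝ → E}
    (hv : ∀ t, 0 ≤ t → IntervalIntegrable v volume 0 t) :
    ContinuousOn (fun t => ∫ s in (0 : ℝ)..t, v s) (Ici 0) := by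
  intro t ht
  simp only [mem_Ici] at ht
  have hc := intervalIntegral.continuousOn_primitive_interval
    ((intervalIntegrable_iff').1 (hv (t + 1) (by linarith)))
  rw [uIcc_of_le (by linarith)] at hc
  refine (hc t ⟨ht, by linarith⟩).mono_of_mem_nhdsWithin ?_
  refine mem_nhdsWithin.2 ⟨Iio (t + 1), isOpen_Iio, by simp, ?_⟩
  rintro s ⟨h1, h2⟩
  exact ⟨h2, le_of_lt h1⟩

theorem setIntegral_Ioi_eq_intervalIntegral {g : ℝ → E} {T : ℝ} (hT : 0 ≤ T)
    (h : ∀ x, T < x → g x = 0) : ∫ s in Ioi (0 : ℝ), g s = ∫ s in (0 : ℝ)..T, g s := by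
  rw [intervalIntegral.integral_of_le hT]
  refine (setIntegral_eq_of_subset_of_forall_sdiff_eq_zero measurableSet_Ioi Ioc_subset_Ioi_self ?_)
  rintro x ⟨h1, h2⟩
  exact h x (not_le.1 fun h3 => h2 ⟨h1, h3⟩)

theorem HasWeakDeriv.congr {v w v' w' : ℝ → E} (h : HasWeakDeriv v w)
    (hv : v =ᵐ[volume.restrict (Ioi 0)] v') (hw : w =ᵐ[volume.restrict (Ioi 0)] w') :
    HasWeakDeriv v' w' := by
  intro φ h1 h2 h3
  have e1 : ∫ s in Ioi (0 : ℝ), deriv φ s • v' s = ∫ s in Ioi (0 : ℝ), deriv φ s • v s :=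
    integral_congr_ae (hv.mono fun x hx => by simp only [hx])
  have e2 : ∫ s in Ioi (0 : ℝ), φ s • w' s = ∫ s in Ioi (0 : ℝ), φ s • w s :=
    integral_congr_ae (hw.mono fun x hx => by simp only [hx])
  rw [e1, e2]
  exact h φ h1 h2 h3

/-- Integration by parts with the operator-valued function `φ · 1`; the boundary terms vanish
because the test function vanishes at `0` and at the right end `T` of its support. -/
theorem hasWeakDeriv_primitive [CompleteSpace E] {w : ℝ → E}
    (hw : ∀ t, 0 ≤ t → IntervalIntegrable w volume 0 t) (c : E) :
    HasWeakDeriv (fun t => c + ∫ s in (0 : ℝ)..t, w s) w := by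
  intro φ h1 h2 h3
  obtain ⟨ε, T, hε, hεT, hφ⟩ := exists_Icc_of_tsupport_subset_Ioi h2 h3
  have hT : 0 ≤ T := (hε.trans hεT).le
  have hout : ∀ x, T < x → φ x = 0 := fun x hx => hφ x fun h => not_lt.2 h.2 hx
  have hd : ∀ x, T < x → deriv φ x = 0 := fun x hx => by
    have : φ =ᶠ[nhds x] fun _ => 0 := (eventually_gt_nhds hx).mono hout
    rw [this.deriv_eq, deriv_const]
  have hφ0 : φ 0 = 0 := hφ 0 fun h => not_le.2 hε h.1
  have hdc : Continuous (deriv φ) := h1.continuous_deriv (by simp)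
  -- `hout` covers only `x > T`; the endpoint follows by continuity from the right.
  have hφT : φ T = 0 := by
    have hcl : T ∈ closure (Ioi T) := by rw [closure_Ioi]; exact self_mem_Ici
    exact closure_minimal (t := {x | φ x = 0}) (fun x hx => hout x hx)
      (isClosed_eq h1.continuous continuous_const) hcl
  have hder : ∀ t, HasDerivAt φ (deriv φ t) t := fun t =>
    (h1.differentiable (by simp) t).hasDerivAt
  rw [setIntegral_Ioi_eq_intervalIntegral hT (fun x hx => by rw [hd x hx, zero_smul]),
    setIntegral_Ioi_eq_intervalIntegral hT (fun x hx => by rw [hout x hx, zero_smul])]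
  have key := integral_deriv_apply_primitive (L := fun s => φ s • (1 : E →L[ℝ] E))
    (L' := fun s => deriv φ s • (1 : E →L[ℝ] E)) (fun t => by
      have := (hder t).smul_const (1 : E →L[ℝ] E)
      exact this)
    (hdc.smul continuous_const) hT (hw T hT)
  simp only [smul_apply, one_apply_eq_self, hφT, zero_smul] at key
  have hcont : ContinuousOn (fun t => ∫ s in (0 : ℝ)..t, w s) (uIcc 0 T) :=
    (continuousOn_primitive_Ici hw).mono (by rw [uIcc_of_le hT]; exact Icc_subset_Ici_self)
  simp only [smul_add]
  rw [intervalIntegral.integral_add, key, intervalIntegral.integral_smul_const,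
    intervalIntegral.integral_deriv_eq_sub' φ rfl (fun x _ => h1.differentiable (by simp) x)
      hdc.continuousOn, hφT, hφ0]
  · simp
  · exact (hdc.smul continuous_const).intervalIntegrable _ _
  · exact (hdc.continuousOn.smul hcont).intervalIntegrable

/-- Subtracting a multiple of such an `η` makes any test function mean-free, hence the derivative of
a test function. -/
theorem exists_test_integral_eq_one : ∃ η : ℝ → ℝ, ContDiff ℝ ∞ η ∧ HasCompactSupport η ∧
    tsupport η ⊆ Ioi 0 ∧ ∫ x, η x = 1 := by
  let b : ContDiffBump (1 : ℝ) := ⟨1 / 4, 1 / 2, by norm_num, by norm_num⟩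
  refine ⟨b.normed volume, b.contDiff_normed, b.hasCompactSupport_normed, ?_, b.integral_normed⟩
  rw [b.tsupport_normed_eq]
  intro x hx
  rw [Metric.mem_closedBall, Real.dist_eq, abs_le] at hx
  have : (b.rOut : ℝ) = 1 / 2 := rfl
  have h1 : -(1 / 2 : ℝ) ≤ x - 1 := hx.1
  simp only [mem_Ioi]
  linarith

/-- The fundamental lemma of the calculus of variations for the derivative. -/
theorem ae_eq_const_of_hasWeakDeriv_zero [CompleteSpace E] {d : ℝ → E}
    (hd : LocallyIntegrableOn d (Ici 0) volume)
    (h : ∀ φ : ℝ → ℝ, ContDiff ℝ ∞ φ → HasCompactSupport φ → tsupport φ ⊆ Ioi 0 →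
      ∫ s in Ioi (0 : ℝ), deriv φ s • d s = 0) :
    ∃ c : E, d =ᵐ[volume.restrict (Ioi 0)] fun _ => c := by
  obtain ⟨η, hη1, hη2, hη3, hη4⟩ := exists_test_integral_eq_one
  set c : E := ∫ s in Ioi (0 : ℝ), η s • d s with hc
  refine ⟨c, ?_⟩
  have hfull : ∀ (ψ : ℝ → ℝ) (g : ℝ → E), tsupport ψ ⊆ Ioi 0 →
      ∫ s in Ioi (0 : ℝ), ψ s • g s = ∫ s, ψ s • g s := fun ψ g hψ =>
    setIntegral_eq_integral_of_forall_compl_eq_zero fun x hx => by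
      rw [image_eq_zero_of_notMem_tsupport (fun h => hx (hψ h)), zero_smul]
  have hdc : LocallyIntegrableOn (fun x => d x - c) (Ici 0) volume :=
    hd.sub (continuous_const.locallyIntegrable.locallyIntegrableOn _)
  have key := isOpen_Ioi.ae_eq_zero_of_integral_contDiff_smul_eq_zero (μ := volume)
    (f := fun x => d x - c) (U := Ioi (0 : ℝ)) (hdc.mono_set Ioi_subset_Ici_self) ?_
  · rw [EventuallyEq, ae_restrict_iff' measurableSet_Ioi]
    filter_upwards [key] with x hx h0
    exact sub_eq_zero.1 (hx h0)
  intro ψ hψ1 hψ2 hψ3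
  obtain ⟨ε₁, T₁, hε₁, hT₁, hz₁⟩ := exists_Icc_of_tsupport_subset_Ioi hψ2 hψ3
  obtain ⟨ε₂, T₂, hε₂, hT₂, hz₂⟩ := exists_Icc_of_tsupport_subset_Ioi hη2 hη3
  set J : ℝ := ∫ x, ψ x with hJ
  -- `ρ` has mean zero, so its primitive `Φ` from `0` is again compactly supported in `(0, ∞)`.
  -- Testing the hypothesis with `Φ` yields `∫ ψ d = J c`, which is the claim for `d - c`.
  set ρ : ℝ → ℝ := fun x => ψ x - J * η x with hρ
  set ε := min ε₁ ε₂
  set T := max T₁ T₂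
  have hε : 0 < ε := lt_min hε₁ hε₂
  have hρ0 : ∀ x, x ∉ Icc ε T → ρ x = 0 := by
    intro x hx
    have h1 : x ∉ Icc ε₁ T₁ := fun h => hx ⟨(min_le_left _ _).trans h.1, h.2.trans (le_max_left _ _)⟩
    have h2 : x ∉ Icc ε₂ T₂ := fun h => hx ⟨(min_le_right _ _).trans h.1, h.2.trans (le_max_right _ _)⟩
    simp [hρ, hz₁ x h1, hz₂ x h2]
  have hρc : ContDiff ℝ ∞ ρ := hψ1.sub (contDiff_const.mul hη1)
  have hψi : Integrable ψ := hψ1.continuous.integrable_of_hasCompactSupport hψ2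
  have hηi : Integrable η := hη1.continuous.integrable_of_hasCompactSupport hη2
  have hρint : ∫ x, ρ x = 0 := by
    simp only [hρ]
    rw [integral_sub hψi (hηi.const_mul _), integral_const_mul, hη4]
    simp [hJ]
  set Φ : ℝ → ℝ := fun x => ∫ s in (0 : ℝ)..x, ρ s with hΦ
  have hΦd : ∀ x, HasDerivAt Φ (ρ x) x := fun x =>
    intervalIntegral.integral_hasDerivAt_right (hρc.continuous.intervalIntegrable _ _)
      (hρc.continuous.stronglyMeasurableAtFilter _ _) hρc.continuous.continuousAt
  have hΦ' : deriv Φ = ρ := funext fun x => (hΦd x).deriv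
  have hΦc : ContDiff ℝ ∞ Φ := by
    rw [contDiff_infty_iff_deriv, hΦ']
    exact ⟨fun x => (hΦd x).differentiableAt, hρc⟩
  have hεT : ε < T := (min_le_left _ _).trans_lt (hT₁.trans_le (le_max_left _ _))
  have hΦ0 : ∀ x, x ∉ Icc ε T → Φ x = 0 := by
    intro x hx
    by_cases hxε : x < ε
    · simp only [hΦ]
      rw [intervalIntegral.integral_congr (g := fun _ => (0 : ℝ)), intervalIntegral.integral_zero]
      intro s hs
      refine hρ0 s fun h => ?_
      have := hs.2
      rcases le_total 0 x with h0 | h0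
      · rw [max_eq_right h0] at this; linarith [h.1]
      · rw [max_eq_left h0] at this; linarith [h.1]
    · have hxT : T < x := not_le.1 fun h => hx ⟨not_lt.1 hxε, h⟩
      simp only [hΦ]
      rw [intervalIntegral.integral_of_le (by linarith),
        setIntegral_eq_integral_of_forall_compl_eq_zero, hρint]
      intro s hs
      refine hρ0 s fun h => hs ⟨by linarith [h.1], by linarith [h.2]⟩
  have hk := h Φ hΦc (hasCompactSupport_of_Icc hΦ0)
    ((tsupport_subset_Icc hΦ0).trans fun x hx => hε.trans_le hx.1)
  rw [hΦ'] at hk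
  have hI1 := integrable_smul_of_locallyIntegrableOn hd hψ1.continuous hψ2
  have hI2 := integrable_smul_of_locallyIntegrableOn hd hη1.continuous hη2
  simp only [hρ, sub_smul, mul_smul] at hk
  rw [integral_sub hI1 (by exact hI2.smul J), integral_smul, ← hc, sub_eq_zero] at hk
  rw [← hfull ψ _ hψ3]
  simp only [smul_sub]
  rw [integral_sub hI1 (hψi.smul_const c).integrableOn, hk, integral_smul_const,
    setIntegral_eq_integral_of_forall_compl_eq_zero fun x hx =>
      image_eq_zero_of_notMem_tsupport (fun h => hx (hψ3 h)), ← hJ, sub_self]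

/-- A function with a locally integrable weak derivative is, almost everywhere, a primitive. -/
theorem HasWeakDeriv.exists_ae_eq_primitive [CompleteSpace E] {v w : ℝ → E} (h : HasWeakDeriv v w)
    (hv : LocallyIntegrableOn v (Ici 0) volume) (hw : LocallyIntegrableOn w (Ici 0) volume) :
    ∃ c : E, v =ᵐ[volume.restrict (Ioi 0)] fun t => c + ∫ s in (0 : ℝ)..t, w s := by
  have hwi : ∀ t, 0 ≤ t → IntervalIntegrable w volume 0 t := fun t ht =>
    intervalIntegrable_of_locallyIntegrableOn hw ht
  have hp : LocallyIntegrableOn (fun t => ∫ s in (0 : ℝ)..t, w s) (Ici 0) volume :=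
    (continuousOn_primitive_Ici hwi).locallyIntegrableOn measurableSet_Ici
  obtain ⟨c, hc⟩ := ae_eq_const_of_hasWeakDeriv_zero (hv.sub hp) (fun φ h1 h2 h3 => by
    have h4 := h φ h1 h2 h3
    have h5 := hasWeakDeriv_primitive hwi 0 φ h1 h2 h3
    simp only [zero_add] at h5
    have hdc : Continuous (deriv φ) := h1.continuous_deriv (by simp)
    simp only [Pi.sub_apply, smul_sub]
    rw [integral_sub (integrable_smul_of_locallyIntegrableOn hv hdc h2.deriv)
      (integrable_smul_of_locallyIntegrableOn hp hdc h2.deriv), h4, h5, sub_self])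
  refine ⟨c, hc.mono fun x hx => ?_⟩
  simp only [Pi.sub_apply] at hx
  simp only [← hx, sub_add_cancel]

theorem eqOn_Ici_of_ae_eq {E : Type*} [NormedAddCommGroup E] {v w : ℝ → E} (hv : ContinuousOn v (Ici 0)) (hw : ContinuousOn w (Ici 0))
    (h : v =ᵐ[volume.restrict (Ioi 0)] w) : EqOn v w (Ici 0) := by
  refine Measure.eqOn_of_ae_eq (μ := volume) ?_ hv hw (by rw [interior_Ici, closure_Ioi])
  rwa [restrict_Ioi_eq_restrict_Ici] at h

theorem IsW11Loc.exists_continuousOn [CompleteSpace E] {v w : ℝ → E} (h : IsW11Loc v w) :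
    ∃ g : ℝ → E, ContinuousOn g (Ici 0) ∧ v =ᵐ[volume.restrict (Ioi 0)] g := by
  obtain ⟨c, hc⟩ := h.weakDeriv.exists_ae_eq_primitive h.locInt h.locInt_deriv
  exact ⟨_, continuousOn_const.add (continuousOn_primitive_Ici fun t ht =>
    intervalIntegrable_of_locallyIntegrableOn h.locInt_deriv ht), hc⟩

theorem IsW11Loc.eq_primitive [CompleteSpace E] {v w : ℝ → E} (h : IsW11Loc v w)
    (hv : ContinuousOn v (Ici 0)) {t : ℝ} (ht : 0 ≤ t) : v t = v 0 + ∫ s in (0 : ℝ)..t, w s := by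
  obtain ⟨c, hc⟩ := h.weakDeriv.exists_ae_eq_primitive h.locInt h.locInt_deriv
  have := eqOn_Ici_of_ae_eq hv (continuousOn_const.add (continuousOn_primitive_Ici fun t ht =>
    intervalIntegrable_of_locallyIntegrableOn h.locInt_deriv ht)) hc
  rw [this ht, this (self_mem_Ici)]
  simp

end

section

/-! ### Weighted spaces -/

/-- The density is finite and strictly positive, so the null sets do not depend on `a`; this allows
elements of spaces with different weights to be compared. -/
theorem ae_weighted_iff {a : ℝ} {p : ℝ → Prop} :
    (∀ᵐ x ∂(weightedMeasure a), p x) ↔ ∀ᵐ x ∂(volume.restrict (Ioi (0 : ℝ))), p x :=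
  ⟨ae_restrict_of_ae_weighted, fun h => (withDensity_absolutelyContinuous _ _).ae_le h⟩

theorem lintegral_weighted {a : ℝ} (g : ℝ → ℝ≥0∞) :
    ∫⁻ x, g x ∂(weightedMeasure a) =
      ∫⁻ x in Ioi (0 : ℝ), ENNReal.ofReal (Real.exp (-2 * a * x)) * g x := by
  unfold weightedMeasure
  rw [lintegral_withDensity_eq_lintegral_mul_non_measurable _ (by fun_prop)
    (Eventually.of_forall fun x => ENNReal.ofReal_lt_top)]
  rfl

theorem integral_weighted {a : ℝ} (g : ℝ → ℝ) :
    ∫ x, g x ∂(weightedMeasure a) = ∫ x in Ioi (0 : ℝ), Real.exp (-2 * a * x) * g x := by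
  unfold weightedMeasure
  rw [integral_withDensity_eq_integral_toReal_smul (by fun_prop)
    (Eventually.of_forall fun x => ENNReal.ofReal_lt_top)]
  simp [ENNReal.toReal_ofReal (Real.exp_pos _).le]

theorem L2a_ext {a : ℝ} {v w : L2a a} (h : v =ᵐ[volume.restrict (Ioi 0)] w) : v = w :=
  Lp.ext (ae_weighted_iff.2 h)

theorem coeFn_add' {a : ℝ} (v w : L2a a) :
    (v + w : L2a a) =ᵐ[volume.restrict (Ioi 0)] fun x => v x + w x :=
  ae_restrict_of_ae_weighted (Lp.coeFn_add v w)

theorem coeFn_sub' {a : ℝ} (v w : L2a a) :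
    (v - w : L2a a) =ᵐ[volume.restrict (Ioi 0)] fun x => v x - w x :=
  ae_restrict_of_ae_weighted (Lp.coeFn_sub v w)

theorem coeFn_smul' {a : ℝ} (c : ℝ) (v : L2a a) :
    (c • v : L2a a) =ᵐ[volume.restrict (Ioi 0)] fun x => c * v x :=
  ae_restrict_of_ae_weighted (Lp.coeFn_smul c v)

theorem isFiniteMeasure_weighted {a : ℝ} (ha : 0 < a) : IsFiniteMeasure (weightedMeasure a) := by
  refine ⟨?_⟩
  have h := lintegral_weighted (a := a) 1
  simp only [Pi.one_apply, lintegral_one, mul_one] at h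
  rw [h]
  have := (integrableOn_exp_mul_Ioi (a := -2 * a) (by linarith) 0)
  exact this.lintegral_lt_top

theorem intervalIntegrable_L2a {a : ℝ} (v : L2a a) {t : ℝ} (ht : 0 ≤ t) :
    IntervalIntegrable v volume 0 t := by
  -- The tent function is continuous, compactly supported, and equal to `1` on `[0, t]`.
  have h := integrable_mul_L2a v (φ := fun x => max 0 (min 1 (t + 1 - |x|))) (by fun_prop)
    (HasCompactSupport.intro (isCompact_Icc (a := -(t + 1)) (b := t + 1)) fun x hx => by
      have : t + 1 < |x| := by
        by_contra hn
        exact hx (abs_le.1 (not_lt.1 hn))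
      rw [max_eq_left]
      exact (min_le_right _ _).trans (by linarith))
  rw [intervalIntegrable_iff_integrableOn_Ioc_of_le ht]
  refine IntegrableOn.congr_fun (h.mono_measure (Measure.restrict_mono Ioc_subset_Ioi_self le_rfl))
    (fun x hx => ?_) measurableSet_Ioc
  have : (1 : ℝ) ≤ t + 1 - |x| := by rw [abs_of_pos hx.1]; linarith [hx.2]
  simp [min_eq_left this]

theorem locallyIntegrableOn_L2a {a : ℝ} (v : L2a a) : LocallyIntegrableOn v (Ici 0) volume :=
  locallyIntegrableOn_of_intervalIntegrable fun _ ht => intervalIntegrable_L2a v ht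

/-! ### Young's inequality -/

/-- Cauchy–Schwarz for the functions `1` and `W` with respect to the measure `H dμ`. -/
theorem sq_lintegral_mul_le {μ : Measure ℝ} {H W : ℝ → ℝ≥0∞} (hH : Measurable H)
    (hW : Measurable W) :
    (∫⁻ y, H y * W y ∂μ) ^ 2 ≤ (∫⁻ y, H y ∂μ) * ∫⁻ y, H y * W y ^ 2 ∂μ := by
  have h := ENNReal.lintegral_mul_le_Lp_mul_Lq (μ.withDensity H) (p := 2) (q := 2)
    Real.HolderConjugate.two_two (f := 1) (g := W) aemeasurable_const hW.aemeasurable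
  have h2 := pow_le_pow_left₀ (zero_le) h 2
  rw [mul_pow] at h2
  have e (z : ℝ≥0∞) : (z ^ (1 / 2 : ℝ)) ^ 2 = z := by
    rw [← ENNReal.rpow_natCast, ← ENNReal.rpow_mul]; norm_num
  rw [e, e] at h2
  simp only [Pi.one_apply, Pi.mul_apply, one_mul, ENNReal.rpow_two, one_pow, lintegral_one] at h2
  rw [lintegral_withDensity_eq_lintegral_mul _ hH hW,
    lintegral_withDensity_eq_lintegral_mul _ hH (hW.pow_const 2),
    withDensity_apply _ MeasurableSet.univ, Measure.restrict_univ] at h2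
  exact h2

/-- Young's convolution inequality `L¹ * L² ⊆ L²`. -/
theorem lintegral_sq_convolution_le {H W : ℝ → ℝ≥0∞} (hH : Measurable H) (hW : Measurable W) :
    ∫⁻ x, (∫⁻ y, H (x - y) * W y) ^ 2 ≤ (∫⁻ y, H y) ^ 2 * ∫⁻ y, W y ^ 2 := by
  calc ∫⁻ x, (∫⁻ y, H (x - y) * W y) ^ 2
      ≤ ∫⁻ x, (∫⁻ y, H y) * ∫⁻ y, H (x - y) * W y ^ 2 := by
        refine lintegral_mono fun x => ?_
        refine (sq_lintegral_mul_le (by fun_prop) hW).trans ?_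
        rw [lintegral_sub_left_eq_self]
    _ = (∫⁻ y, H y) * ∫⁻ y, ∫⁻ x, H (x - y) * W y ^ 2 := by
        rw [lintegral_const_mul, lintegral_lintegral_swap]
        · fun_prop
        · exact Measurable.lintegral_prod_right (by fun_prop)
    _ = (∫⁻ y, H y) * ∫⁻ y, (∫⁻ x, H x) * W y ^ 2 := by
        congr 1
        refine lintegral_congr fun y => ?_
        rw [lintegral_mul_const _ (by fun_prop), lintegral_sub_right_eq_self]
    _ = _ := by rw [lintegral_const_mul _ (by fun_prop)]; ring

/-! ### Causal convolution -/

theorem causalConv_congr {k v w : ℝ → ℝ} (h : v =ᵐ[volume.restrict (Ioi 0)] w) {x : ℝ}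
    (hx : 0 ≤ x) : causalConv k v x = causalConv k w x := by
  unfold causalConv
  rw [intervalIntegral.integral_of_le hx, intervalIntegral.integral_of_le hx]
  refine integral_congr_ae ?_
  have h' : v =ᵐ[volume.restrict (Ioc 0 x)] w :=
    ae_mono (Measure.restrict_mono Ioc_subset_Ioi_self le_rfl) h
  filter_upwards [h'] with y hy
  rw [hy]

theorem measurable_causalConv {k v : ℝ → ℝ} (hk : Continuous k) (hv : Measurable v) :
    AEStronglyMeasurable (causalConv k v) (volume.restrict (Ioi (0 : ℝ))) := by
  have h : StronglyMeasurable fun x => ∫ y, {p : ℝ × ℝ | 0 < p.2 ∧ p.2 ≤ p.1}.indicator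
      (fun p => k (p.1 - p.2) * v p.2) (x, y) := by
    refine StronglyMeasurable.integral_prod_right ?_
    refine Measurable.stronglyMeasurable ?_
    refine Measurable.indicator ?_ ?_
    · exact (hk.measurable.comp (measurable_fst.sub measurable_snd)).mul (hv.comp measurable_snd)
    · exact (measurableSet_lt measurable_const measurable_snd).inter
        (measurableSet_le measurable_snd measurable_fst)
  refine h.aestronglyMeasurable.congr ?_
  refine (ae_restrict_iff' measurableSet_Ioi).2 (Eventually.of_forall fun x hx => ?_)
  simp only [causalConv]
  rw [intervalIntegral.integral_of_le (le_of_lt hx), ← integral_indicator measurableSet_Ioc]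
  rfl

theorem lintegral_exp_neg {a : ℝ} (ha : 0 < a) :
    ∫⁻ y, (Ici (0 : ℝ)).indicator (fun z => ENNReal.ofReal (Real.exp (-a * z))) y =
      ENNReal.ofReal (1 / a) := by
  rw [lintegral_indicator measurableSet_Ici, ← ofReal_integral_eq_lintegral_ofReal,
    integral_Ici_eq_integral_Ioi, integral_exp_mul_Ioi (by linarith)]
  · congr 1
    simp only [mul_zero, Real.exp_zero]
    field_simp
  · rw [← IntegrableOn, integrableOn_Ici_iff_integrableOn_Ioi]
    exact integrableOn_exp_mul_Ioi (by linarith) 0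
  · exact Eventually.of_forall fun x => (Real.exp_pos _).le

/-- The factorisation `e^{-ax} = e^{-a(x-y)} e^{-ay}` moves the weight inside the convolution. With
`k` bounded by its sup norm, what is left is convolution with `e^{-az}` on `z ≥ 0`, of mass `1/a`,
and Young's inequality applies. Finiteness of this mass requires `a > 0`. -/
theorem lintegral_causalConv_sq_le {a : ℝ} (ha : 0 < a) (k : ℝ →ᵇ ℝ) {v : ℝ → ℝ}
    (hv : Measurable v) :
    ∫⁻ x, ‖causalConv k v x‖ₑ ^ 2 ∂(weightedMeasure a) ≤
      ENNReal.ofReal (‖k‖ / a) ^ 2 * ∫⁻ x, ‖v x‖ₑ ^ 2 ∂(weightedMeasure a) := by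
  set H : ℝ → ℝ≥0∞ := (Ici (0 : ℝ)).indicator (fun z => ENNReal.ofReal (Real.exp (-a * z))) with hH
  set W : ℝ → ℝ≥0∞ := (Ioi (0 : ℝ)).indicator
    (fun z => ENNReal.ofReal (Real.exp (-a * z)) * ‖v z‖ₑ) with hW
  have hHm : Measurable H := by
    refine Measurable.indicator ?_ measurableSet_Ici
    fun_prop
  have hWm : Measurable W := by
    refine Measurable.indicator ?_ measurableSet_Ioi
    fun_prop
  have hsq : ∀ x : ℝ, ENNReal.ofReal (Real.exp (-2 * a * x)) =
      ENNReal.ofReal (Real.exp (-a * x)) ^ 2 := fun x => by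
    rw [← ENNReal.ofReal_pow (Real.exp_pos _).le, ← Real.exp_nat_mul]
    congr 2; push_cast; ring
  rw [lintegral_weighted, lintegral_weighted]
  have hR : ∫⁻ x in Ioi (0 : ℝ), ENNReal.ofReal (Real.exp (-2 * a * x)) * ‖v x‖ₑ ^ 2 =
      ∫⁻ y, W y ^ 2 := by
    rw [← lintegral_indicator measurableSet_Ioi]
    refine lintegral_congr fun x => ?_
    by_cases hx : x ∈ Ioi (0 : ℝ)
    · simp only [hW, indicator_of_mem hx, hsq, mul_pow]
    · simp only [hW, indicator_of_notMem hx]; simp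
  have hL : ∀ x ∈ Ioi (0 : ℝ), ENNReal.ofReal (Real.exp (-2 * a * x)) * ‖causalConv k v x‖ₑ ^ 2 ≤
      ENNReal.ofReal ‖k‖ ^ 2 * (∫⁻ y, H (x - y) * W y) ^ 2 := by
    intro x hx
    rw [hsq, ← mul_pow, ← mul_pow]
    refine pow_le_pow_left₀ zero_le ?_ 2
    have h1 : ‖causalConv k v x‖ₑ ≤ ∫⁻ y in Ioc 0 x, ENNReal.ofReal ‖k‖ * ‖v y‖ₑ := by
      unfold causalConv
      rw [intervalIntegral.integral_of_le (le_of_lt hx)]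
      refine (enorm_integral_le_lintegral_enorm _).trans (lintegral_mono fun y => ?_)
      rw [enorm_mul]
      gcongr
      rw [← ofReal_norm]
      exact ENNReal.ofReal_le_ofReal (k.norm_coe_le_norm _)
    rw [lintegral_const_mul _ (by fun_prop)] at h1
    calc _ ≤ ENNReal.ofReal (Real.exp (-a * x)) *
          (ENNReal.ofReal ‖k‖ * ∫⁻ y in Ioc 0 x, ‖v y‖ₑ) := by gcongr
      _ = ENNReal.ofReal ‖k‖ * ∫⁻ y in Ioc 0 x, ENNReal.ofReal (Real.exp (-a * x)) * ‖v y‖ₑ := by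
        rw [lintegral_const_mul _ (by fun_prop)]; ring
      _ ≤ _ := by
        refine mul_le_mul_right ?_ _
        rw [← lintegral_indicator measurableSet_Ioc]
        refine lintegral_mono fun y => ?_
        by_cases hy : y ∈ Ioc 0 x
        · rw [indicator_of_mem hy]
          simp only [hH, hW]
          rw [indicator_of_mem (by simpa using hy.2), indicator_of_mem (by exact hy.1), ← mul_assoc,
            ← ENNReal.ofReal_mul (Real.exp_pos _).le, ← Real.exp_add]
          apply le_of_eq
          congr 3; ring
        · rw [indicator_of_notMem hy]; exact zero_le
  calc _ ≤ ∫⁻ x in Ioi (0 : ℝ), ENNReal.ofReal ‖k‖ ^ 2 * (∫⁻ y, H (x - y) * W y) ^ 2 :=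
        setLIntegral_mono' measurableSet_Ioi hL
    _ ≤ ∫⁻ x, ENNReal.ofReal ‖k‖ ^ 2 * (∫⁻ y, H (x - y) * W y) ^ 2 := setLIntegral_le_lintegral _ _
    _ = ENNReal.ofReal ‖k‖ ^ 2 * ∫⁻ x, (∫⁻ y, H (x - y) * W y) ^ 2 := by
        rw [lintegral_const_mul]
        exact (Measurable.lintegral_prod_right (by fun_prop)).pow_const 2
    _ ≤ ENNReal.ofReal ‖k‖ ^ 2 * ((∫⁻ y, H y) ^ 2 * ∫⁻ y, W y ^ 2) := by
        gcongr; exact lintegral_sq_convolution_le hHm hWm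
    _ = _ := by
        rw [lintegral_exp_neg ha, hR, div_eq_mul_one_div ‖k‖ a, ENNReal.ofReal_mul (norm_nonneg _)]
        ring

theorem eLpNorm_two_eq {μ : Measure ℝ} (f : ℝ → ℝ) :
    eLpNorm f 2 μ = (∫⁻ x, ‖f x‖ₑ ^ 2 ∂μ) ^ (1 / 2 : ℝ) := by
  rw [eLpNorm_eq_lintegral_rpow_enorm_toReal (by norm_num) (by norm_num)]
  simp

theorem eLpNorm_causalConv_le {a : ℝ} (ha : 0 < a) (k : ℝ →ᵇ ℝ) {v : ℝ → ℝ} (hv : Measurable v) :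
    eLpNorm (causalConv k v) 2 (weightedMeasure a) ≤
      ENNReal.ofReal (‖k‖ / a) * eLpNorm v 2 (weightedMeasure a) := by
  rw [eLpNorm_two_eq, eLpNorm_two_eq]
  refine (ENNReal.rpow_le_rpow (lintegral_causalConv_sq_le ha k hv) (by norm_num)).trans ?_
  rw [ENNReal.mul_rpow_of_nonneg _ _ (by norm_num), ← ENNReal.rpow_natCast, ← ENNReal.rpow_mul]
  norm_num

theorem memLp_causalConv {a : ℝ} (ha : 0 < a) (k : ℝ →ᵇ ℝ) (v : L2a a) :
    MemLp (causalConv k v) 2 (weightedMeasure a) := by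
  have hv := (Lp.stronglyMeasurable v).measurable
  refine ⟨?_, (eLpNorm_causalConv_le ha k hv).trans_lt ?_⟩
  · exact (measurable_causalConv k.continuous hv).mono_ac (withDensity_absolutelyContinuous _ _)
  · exact ENNReal.mul_lt_top ENNReal.ofReal_lt_top (Lp.memLp v).eLpNorm_lt_top

theorem intervalIntegrable_conv_mul {k v : ℝ → ℝ} (hk : Continuous k) {x : ℝ}
    (hv : IntervalIntegrable v volume 0 x) :
    IntervalIntegrable (fun y => k (x - y) * v y) volume 0 x :=
  hv.continuousOn_mul (by fun_prop)

/-- Causal convolution with a bounded continuous kernel as an operator on `L²_a`. -/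
def convCLM {a : ℝ} (ha : 0 < a) (k : ℝ →ᵇ ℝ) : L2a a →L[ℝ] L2a a :=
  LinearMap.mkContinuous
    { toFun := fun v => (memLp_causalConv ha k v).toLp _
      map_add' := fun v w => L2a_ext <| by
        filter_upwards [ae_restrict_of_ae_weighted (memLp_causalConv ha k (v + w)).coeFn_toLp,
          ae_restrict_of_ae_weighted (memLp_causalConv ha k v).coeFn_toLp,
          ae_restrict_of_ae_weighted (memLp_causalConv ha k w).coeFn_toLp, coeFn_add'
          ((memLp_causalConv ha k v).toLp _) ((memLp_causalConv ha k w).toLp _),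
          ae_restrict_mem measurableSet_Ioi] with x h1 h2 h3 h4 hx
        have hx : 0 ≤ x := le_of_lt hx
        rw [h1, h4, h2, h3, causalConv_congr (coeFn_add' v w) hx]
        unfold causalConv
        rw [← intervalIntegral.integral_add
          (intervalIntegrable_conv_mul k.continuous (intervalIntegrable_L2a v hx))
          (intervalIntegrable_conv_mul k.continuous (intervalIntegrable_L2a w hx))]
        simp only [mul_add]
      map_smul' := fun c v => L2a_ext <| by
        filter_upwards [ae_restrict_of_ae_weighted (memLp_causalConv ha k (c • v)).coeFn_toLp,
          ae_restrict_of_ae_weighted (memLp_causalConv ha k v).coeFn_toLp,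
          coeFn_smul' c ((memLp_causalConv ha k v).toLp _),
          ae_restrict_mem measurableSet_Ioi] with x h1 h2 h3 hx
        have hx : 0 ≤ x := le_of_lt hx
        simp only [RingHom.id_apply]
        rw [h1, h3, h2, causalConv_congr (coeFn_smul' c v) hx]
        unfold causalConv
        rw [← intervalIntegral.integral_const_mul]
        refine intervalIntegral.integral_congr fun y _ => ?_
        ring }
    (‖k‖ / a) fun v => by
      have hv := (Lp.stronglyMeasurable v).measurable
      have h := eLpNorm_causalConv_le ha k hv
      change ‖(memLp_causalConv ha k v).toLp _‖ ≤ _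
      rw [Lp.norm_toLp, Lp.norm_def]
      have h2 := ENNReal.toReal_mono (ENNReal.mul_ne_top ENNReal.ofReal_ne_top
        (Lp.memLp v).eLpNorm_ne_top) h
      rwa [ENNReal.toReal_mul, ENNReal.toReal_ofReal (by positivity)] at h2

theorem convCLM_coe {a : ℝ} (ha : 0 < a) (k : ℝ →ᵇ ℝ) (v : L2a a) :
    convCLM ha k v =ᵐ[volume.restrict (Ioi 0)] causalConv k v :=
  ae_restrict_of_ae_weighted (memLp_causalConv ha k v).coeFn_toLp

theorem memLp_bcf {a : ℝ} (ha : 0 < a) (k : ℝ →ᵇ ℝ) : MemLp k 2 (weightedMeasure a) := by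
  have := isFiniteMeasure_weighted ha
  exact MemLp.of_bound k.continuous.aestronglyMeasurable ‖k‖
    (Eventually.of_forall fun x => k.norm_coe_le_norm x)

/-- A bounded continuous function as an element of `L²_a`, `a > 0`. -/
def bcfL2 {a : ℝ} (ha : 0 < a) (k : ℝ →ᵇ ℝ) : L2a a := (memLp_bcf ha k).toLp k

theorem bcfL2_coe {a : ℝ} (ha : 0 < a) (k : ℝ →ᵇ ℝ) :
    bcfL2 ha k =ᵐ[volume.restrict (Ioi 0)] k :=
  ae_restrict_of_ae_weighted (memLp_bcf ha k).coeFn_toLp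

/-- The constant function `1`. -/
abbrev oneB : ℝ →ᵇ ℝ := BoundedContinuousFunction.const ℝ 1

theorem causalConv_one (v : ℝ → ℝ) (x : ℝ) : causalConv oneB v x = ∫ y in (0 : ℝ)..x, v y := by
  simp [causalConv]

/-- This is `1 * (k' * v) = k * v - k(0) (1 * v)`: after exchanging the integrals on the triangle,
the inner one is `k(x - r) - k(0)`. -/
theorem integral_causalConv {k k' v : ℝ → ℝ} (hk : ∀ x, HasDerivAt k (k' x) x) (hk' : Continuous k')
    {x : ℝ} (hx : 0 ≤ x) (hv : IntervalIntegrable v volume 0 x) :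
    ∫ y in (0 : ℝ)..x, causalConv k' v y = causalConv k v x - k 0 * ∫ y in (0 : ℝ)..x, v y := by
  have hkc : Continuous k := continuous_iff_continuousAt.2 fun t => (hk t).continuousAt
  unfold causalConv
  have hvi : IntegrableOn v (Ioc 0 x) := (intervalIntegrable_iff_integrableOn_Ioc_of_le hx).1 hv
  have hInt : IntegrableOn (Function.uncurry fun s r => k' (s - r) * v r) (Ioc 0 x ×ˢ Ioc 0 x)
      (volume.prod volume) := by
    rw [IntegrableOn, ← Measure.prod_restrict]
    have h1 : Integrable (fun p : ℝ × ℝ => v p.2)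
      ((volume.restrict (Ioc 0 x)).prod (volume.restrict (Ioc 0 x))) := Integrable.comp_snd hvi _
    obtain ⟨C, hC⟩ := (isCompact_Icc (a := -x) (b := x)).exists_bound_of_continuousOn
      hk'.continuousOn
    refine h1.bdd_mul (c := C) (hk'.comp (by fun_prop)).aestronglyMeasurable ?_
    rw [Measure.prod_restrict, ae_restrict_iff' (measurableSet_Ioc.prod measurableSet_Ioc)]
    refine Eventually.of_forall fun p hp => hC _ ⟨?_, ?_⟩
    · linarith [hp.1.1, hp.2.2]
    · linarith [hp.1.2, hp.2.1]
  rw [integral_triangle_swap hx hInt, ← intervalIntegral.integral_const_mul,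
    ← intervalIntegral.integral_sub (intervalIntegrable_conv_mul hkc hv) (hv.const_mul _)]
  refine intervalIntegral.integral_congr fun r _ => ?_
  rw [intervalIntegral.integral_mul_const, ← sub_mul]
  congr 1
  have := intervalIntegral.integral_eq_sub_of_hasDerivAt (f := fun s => k (s - r))
    (f' := fun s => k' (s - r)) (a := r) (b := x) (fun s _ => by
      simpa using (hk (s - r)).comp_sub_const s r)
    ((hk'.comp (by fun_prop)).intervalIntegrable _ _)
  simpa using this

/-- The same identity with the two convolutions in the other order, here by parts in `y` with `L y =
-k(x - y)`. -/
theorem causalConv_primitive {k k' v : ℝ → ℝ} (hk : ∀ x, HasDerivAt k (k' x) x)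
    (hk' : Continuous k') {x : ℝ} (hx : 0 ≤ x) (hv : IntervalIntegrable v volume 0 x) :
    causalConv k' (fun y => ∫ z in (0 : ℝ)..y, v z) x =
      causalConv k v x - k 0 * ∫ y in (0 : ℝ)..x, v y := by
  have key := integral_deriv_apply_primitive
    (L := fun y => (-k (x - y)) • (1 : ℝ →L[ℝ] ℝ)) (L' := fun y => k' (x - y) • (1 : ℝ →L[ℝ] ℝ))
    (fun t => by
      have h := ((hk (x - t)).comp_const_sub x t).neg.smul_const (1 : ℝ →L[ℝ] ℝ)
      rw [neg_neg] at h
      exact h)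
    ((hk'.comp (by fun_prop)).smul continuous_const) hx hv
  simp only [smul_apply, one_apply_eq_self, sub_self, smul_eq_mul, neg_mul,
    intervalIntegral.integral_neg] at key
  unfold causalConv
  rw [key]
  ring

theorem causalConv_const_one {k k' : ℝ → ℝ} (hk : ∀ x, HasDerivAt k (k' x) x)
    (hk' : Continuous k') (x : ℝ) : causalConv k' (fun _ => 1) x = k x - k 0 := by
  have := intervalIntegral.integral_eq_sub_of_hasDerivAt (f := fun y => -k (x - y))
    (f' := fun y => k' (x - y)) (a := 0) (b := x) (fun s _ => by
      have h := ((hk (x - s)).comp_const_sub x s).neg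
      rw [neg_neg] at h
      exact h)
    ((hk'.comp (by fun_prop)).intervalIntegrable _ _)
  simp only [causalConv, mul_one]
  rw [this]; simp; ring

theorem conv_one_conv {a : ℝ} (ha : 0 < a) {k k' : ℝ →ᵇ ℝ}
    (hk : ∀ x, HasDerivAt k (k' x) x) (v : L2a a) :
    convCLM ha oneB (convCLM ha k' v) = convCLM ha k v - k 0 • convCLM ha oneB v := by
  refine L2a_ext ?_
  filter_upwards [convCLM_coe ha oneB (convCLM ha k' v), convCLM_coe ha k v,
    convCLM_coe ha oneB v, coeFn_sub' (convCLM ha k v) (k 0 • convCLM ha oneB v),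
    coeFn_smul' (k 0) (convCLM ha oneB v), ae_restrict_mem measurableSet_Ioi] with x h1 h2 h3 h4 h5 hx
  have hx : 0 ≤ x := le_of_lt hx
  rw [h1, h4, h5, h2, h3, causalConv_congr (convCLM_coe ha k' v) hx, causalConv_one, causalConv_one,
    integral_causalConv hk k'.continuous hx (intervalIntegrable_L2a v hx)]

theorem conv_conv_one {a : ℝ} (ha : 0 < a) {k k' : ℝ →ᵇ ℝ}
    (hk : ∀ x, HasDerivAt k (k' x) x) (v : L2a a) :
    convCLM ha k' (convCLM ha oneB v) = convCLM ha k v - k 0 • convCLM ha oneB v := by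
  refine L2a_ext ?_
  filter_upwards [convCLM_coe ha k' (convCLM ha oneB v), convCLM_coe ha k v,
    convCLM_coe ha oneB v, coeFn_sub' (convCLM ha k v) (k 0 • convCLM ha oneB v),
    coeFn_smul' (k 0) (convCLM ha oneB v), ae_restrict_mem measurableSet_Ioi] with x h1 h2 h3 h4 h5 hx
  have hx : 0 ≤ x := le_of_lt hx
  have e : causalConv oneB v = fun y => ∫ z in (0 : ℝ)..y, v z := funext fun y => causalConv_one v y
  rw [h1, h4, h5, h2, h3, causalConv_congr (convCLM_coe ha oneB v) hx, e,
    causalConv_primitive hk k'.continuous hx (intervalIntegrable_L2a v hx)]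

theorem conv_bcf_one {a : ℝ} (ha : 0 < a) {k k' : ℝ →ᵇ ℝ}
    (hk : ∀ x, HasDerivAt k (k' x) x) :
    convCLM ha k' (bcfL2 ha oneB) = bcfL2 ha k - k 0 • bcfL2 ha oneB := by
  refine L2a_ext ?_
  filter_upwards [convCLM_coe ha k' (bcfL2 ha oneB), bcfL2_coe ha k, bcfL2_coe ha oneB,
    coeFn_sub' (bcfL2 ha k) (k 0 • bcfL2 ha oneB), coeFn_smul' (k 0) (bcfL2 ha oneB),
    ae_restrict_mem measurableSet_Ioi] with x h1 h2 h3 h4 h5 hx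
  have hx : 0 ≤ x := le_of_lt hx
  have e : (oneB : ℝ → ℝ) = fun _ => 1 := rfl
  rw [h1, h4, h5, h2, h3, causalConv_congr (bcfL2_coe ha oneB) hx, e,
    causalConv_const_one hk k'.continuous]
  ring

end

section

/-! ### The symbol of the Bessel kernel -/

/-- `∫₀^π p / (p² + sin² θ) dθ`. -/
def besselG (p : ℂ) : ℂ := ∫ θ in (0 : ℝ)..Real.pi, p / (p ^ 2 + (Real.sin θ : ℂ) ^ 2)

/-- In `p² + s² = (p + is)(p - is)` both factors have real part `Re p`. The bound is uniform in `s`,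
hence gives both nonvanishing denominators and domination. -/
theorem norm_sq_add_ge {p : ℂ} {r : ℝ} (hr : 0 ≤ r) (hp : r ≤ p.re) (s : ℝ) :
    r ^ 2 ≤ ‖p ^ 2 + (s : ℂ) ^ 2‖ := by
  have e : p ^ 2 + (s : ℂ) ^ 2 = (p + s * Complex.I) * (p - s * Complex.I) := by
    linear_combination ((s : ℂ) ^ 2) * Complex.I_sq
  rw [e, norm_mul, sq]
  have h1 : r ≤ ‖p + s * Complex.I‖ :=
    hp.trans ((le_of_eq (by simp)).trans (Complex.re_le_norm _))
  have h2 : r ≤ ‖p - s * Complex.I‖ :=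
    hp.trans ((le_of_eq (by simp)).trans (Complex.re_le_norm _))
  exact mul_le_mul h1 h2 hr (norm_nonneg _)

theorem sq_add_ne_zero {p : ℂ} (hp : 0 < p.re) (s : ℝ) : p ^ 2 + (s : ℂ) ^ 2 ≠ 0 := fun h => by
  have := norm_sq_add_ge hp.le le_rfl s
  rw [h, norm_zero] at this
  nlinarith

theorem continuous_besselG_integrand {p : ℂ} (hp : 0 < p.re) :
    Continuous fun θ : ℝ => p / (p ^ 2 + (Real.sin θ : ℂ) ^ 2) :=
  continuous_const.div (by fun_prop) fun θ => sq_add_ne_zero hp _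

theorem continuous_besselG_deriv_integrand {p : ℂ} (hp : 0 < p.re) :
    Continuous fun θ : ℝ => ((Real.sin θ : ℂ) ^ 2 - p ^ 2) / (p ^ 2 + (Real.sin θ : ℂ) ^ 2) ^ 2 :=
  Continuous.div (by fun_prop) (by fun_prop) fun θ => pow_ne_zero _ (sq_add_ne_zero hp _)

theorem hasDerivAt_besselG {p : ℂ} (hp : 0 < p.re) :
    HasDerivAt besselG (∫ θ in (0 : ℝ)..Real.pi,
      ((Real.sin θ : ℂ) ^ 2 - p ^ 2) / (p ^ 2 + (Real.sin θ : ℂ) ^ 2) ^ 2) p := by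
  set r := p.re / 2 with hr
  have hr0 : 0 < r := by positivity
  -- Radius `Re p / 2` keeps the ball in `Re q ≥ r`, where the denominators are bounded below.
  have hball : ∀ q ∈ Metric.ball p r, r ≤ q.re := fun q hq => by
    have h1 : |(q - p).re| ≤ ‖q - p‖ := Complex.abs_re_le_norm _
    have h2 : ‖q - p‖ < r := by simpa [dist_eq_norm] using hq
    have h3 := (abs_le.1 (h1.trans h2.le)).1
    simp only [Complex.sub_re] at h3
    linarith
  refine (intervalIntegral.hasDerivAt_integral_of_dominated_loc_of_deriv_le
    (F := fun q (θ : ℝ) => q / (q ^ 2 + (Real.sin θ : ℂ) ^ 2))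
    (F' := fun q (θ : ℝ) => ((Real.sin θ : ℂ) ^ 2 - q ^ 2) / (q ^ 2 + (Real.sin θ : ℂ) ^ 2) ^ 2)
    (bound := fun _ => (1 + (‖p‖ + r) ^ 2) / (r ^ 2) ^ 2)
    (Metric.ball_mem_nhds p hr0) ?_ ?_ ?_ ?_ ?_ ?_).2
  · filter_upwards [Metric.ball_mem_nhds p hr0] with q hq
    exact (continuous_besselG_integrand (hr0.trans_le (hball q hq))).aestronglyMeasurable
  · exact (continuous_besselG_integrand hp).intervalIntegrable _ _
  · exact (continuous_besselG_deriv_integrand hp).aestronglyMeasurable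
  · refine Eventually.of_forall fun θ _ q hq => ?_
    rw [norm_div, norm_pow]
    have h2 : ‖q - p‖ < r := by simpa [dist_eq_norm] using hq
    have hq' : ‖q‖ ≤ ‖p‖ + r := by
      have := norm_add_le p (q - p)
      rw [add_sub_cancel] at this
      linarith
    have hs : ‖(Real.sin θ : ℂ)‖ ≤ 1 := by
      rw [Complex.norm_real]; exact Real.abs_sin_le_one θ
    gcongr
    · refine (norm_sub_le _ _).trans ?_
      rw [norm_pow, norm_pow]
      gcongr
      exact pow_le_one₀ (norm_nonneg _) hs
    · exact norm_sq_add_ge hr0.le (hball q hq) _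
  · exact intervalIntegrable_const
  · refine Eventually.of_forall fun θ _ q hq => ?_
    have hne := sq_add_ne_zero (hr0.trans_le (hball q hq)) (Real.sin θ)
    have h := (hasDerivAt_id q).div (((hasDerivAt_id q).pow 2).add_const ((Real.sin θ : ℂ) ^ 2)) hne
    refine h.congr_deriv ?_
    simp only [id, Pi.pow_apply, Nat.cast_ofNat]
    congr 1
    ring

/-- The combined integrand is the exact `θ`-derivative of `-sin θ cos θ / (p² + sin² θ)`, which
vanishes at `0` and `π`. This is the equation of a multiple of `(1 + p²)^{-1/2}`, obtained without
evaluating the integral. -/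
theorem besselG_ode {p : ℂ} (hp : 0 < p.re) :
    (1 + p ^ 2) * (∫ θ in (0 : ℝ)..Real.pi,
      ((Real.sin θ : ℂ) ^ 2 - p ^ 2) / (p ^ 2 + (Real.sin θ : ℂ) ^ 2) ^ 2) + p * besselG p = 0 := by
  unfold besselG
  have hc1 := continuous_besselG_deriv_integrand hp
  have hc2 := continuous_besselG_integrand hp
  rw [← intervalIntegral.integral_const_mul, ← intervalIntegral.integral_const_mul,
    ← intervalIntegral.integral_add ((hc1.const_mul _).intervalIntegrable _ _)
      ((hc2.const_mul _).intervalIntegrable _ _)]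
  have hd : ∀ θ : ℝ, HasDerivAt
      (fun θ : ℝ => -((Real.sin θ : ℂ) * (Real.cos θ : ℂ) / (p ^ 2 + (Real.sin θ : ℂ) ^ 2)))
      ((1 + p ^ 2) * (((Real.sin θ : ℂ) ^ 2 - p ^ 2) / (p ^ 2 + (Real.sin θ : ℂ) ^ 2) ^ 2) +
        p * (p / (p ^ 2 + (Real.sin θ : ℂ) ^ 2))) θ := by
    intro θ
    have hne := sq_add_ne_zero hp (Real.sin θ)
    have h1 := (Real.hasDerivAt_sin θ).ofReal_comp
    have h2 := (Real.hasDerivAt_cos θ).ofReal_comp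
    have h := ((h1.mul h2).div ((h1.pow 2).const_add (p ^ 2)) hne).neg
    refine h.congr_deriv ?_
    have hcs : (Real.cos θ : ℂ) ^ 2 = 1 - (Real.sin θ : ℂ) ^ 2 := by
      rw [← Complex.ofReal_pow, ← Complex.ofReal_pow, Real.cos_sq']; push_cast; ring
    simp only [Pi.mul_apply, Pi.pow_apply, Nat.cast_ofNat, Complex.ofReal_neg]
    field_simp
    linear_combination ((Real.sin θ : ℂ) ^ 2 - p ^ 2) * hcs
  rw [intervalIntegral.integral_eq_sub_of_hasDerivAt (fun θ _ => hd θ)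
    (((hc1.const_mul _).add (hc2.const_mul _)).intervalIntegrable _ _)]
  simp

theorem isPreconnected_re_pos : IsPreconnected {p : ℂ | 0 < p.re} :=
  (convex_halfSpace_re_gt 0).isPreconnected

theorem isOpen_re_pos : IsOpen {p : ℂ | 0 < p.re} := isOpen_lt continuous_const Complex.continuous_re

theorem besselG_one : ∃ g : ℝ, 0 < g ∧ besselG 1 = g := by
  refine ⟨∫ θ in (0 : ℝ)..Real.pi, 1 / (1 + Real.sin θ ^ 2), ?_, ?_⟩
  · refine intervalIntegral.intervalIntegral_pos_of_pos ?_ (fun θ => by positivity) Real.pi_pos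
    exact (Continuous.div (by fun_prop) (by fun_prop) fun θ => by positivity).intervalIntegrable _ _
  · unfold besselG
    rw [← intervalIntegral.integral_ofReal]
    refine intervalIntegral.integral_congr fun θ _ => ?_
    push_cast
    simp

/-- By `besselG_ode` the derivative of `(1 + p²) G²` is zero on the connected half-plane, so the
value is the one at `p = 1`. Squaring avoids any choice of branch of the square root. -/
theorem besselG_sq {p : ℂ} (hp : 0 < p.re) :
    ∃ C : ℝ, 0 < C ∧ (1 + p ^ 2) * besselG p ^ 2 = C := by
  obtain ⟨g, hg, hg1⟩ := besselG_one
  refine ⟨2 * g ^ 2, by positivity, ?_⟩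
  have hder : ∀ q : ℂ, 0 < q.re → HasDerivAt (fun q => (1 + q ^ 2) * besselG q ^ 2) 0 q := by
    intro q hq
    have h := (((hasDerivAt_id q).pow 2).const_add 1).mul ((hasDerivAt_besselG hq).pow 2)
    refine h.congr_deriv ?_
    have := besselG_ode hq
    simp only [id, Pi.pow_apply, Nat.cast_ofNat]
    linear_combination 2 * besselG q * this
  have := isOpen_re_pos.is_const_of_deriv_eq_zero isPreconnected_re_pos
    (fun q hq => (hder q hq).differentiableAt.differentiableWithinAt)
    (fun q hq => (hder q hq).deriv) hp (y := 1) (by simp)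
  rw [this, hg1]
  push_cast
  ring

/-- The symbol `p G(p)` has positive real part on the right half-plane. -/
theorem besselG_re_pos {p : ℂ} (hp : 0 < p.re) : 0 < (p * besselG p).re := by
  -- If `q G(q) = iy`, multiplying `(1 + q²) G² = C` by `q²` gives `q² (C + y²) = -y²`. Then `q²` is
  -- real and nonpositive, whereas `Re q > 0` makes a real `q²` positive.
  have hne : ∀ q : ℂ, 0 < q.re → (q * besselG q).re ≠ 0 := by
    intro q hq h0
    obtain ⟨C, hC, hCe⟩ := besselG_sq hq
    set y := (q * besselG q).im
    have hq' : q * besselG q = y * Complex.I := by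
      apply Complex.ext <;> simp [h0, y]
    have h1 : q ^ 2 * (C + y ^ 2) = -y ^ 2 := by
      linear_combination (-q ^ 2) * hCe + (1 + q ^ 2) * (q * besselG q + y * Complex.I) * hq' +
        (1 + q ^ 2) * y ^ 2 * Complex.I_sq
    have h2 := congrArg Complex.im h1
    have h3 := congrArg Complex.re h1
    have e : (C + y ^ 2 : ℂ) = ((C + y ^ 2 : ℝ) : ℂ) := by push_cast; ring
    have e' : (-y ^ 2 : ℂ) = ((-y ^ 2 : ℝ) : ℂ) := by push_cast; ring
    rw [e, e'] at h2 h3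
    rw [Complex.im_mul_ofReal, Complex.ofReal_im, sq, Complex.mul_im] at h2
    rw [Complex.re_mul_ofReal, Complex.ofReal_re, sq q, Complex.mul_re] at h3
    have hpos : 0 < C + y ^ 2 := by positivity
    have him : q.im = 0 := by
      have : q.re * q.im + q.im * q.re = 0 := by
        rcases mul_eq_zero.1 h2 with h | h
        · exact h
        · exact absurd h hpos.ne'
      have h4 : q.re * q.im = 0 := by linarith
      exact (mul_eq_zero.1 h4).resolve_left hq.ne'
    rw [him] at h3
    nlinarith [mul_pos (mul_pos hq hq) hpos, sq_nonneg y]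
  by_contra hn
  have hcont : ContinuousOn (fun q : ℂ => (q * besselG q).re) {p : ℂ | 0 < p.re} := fun q hq =>
    (Complex.continuous_re.continuousAt.comp
      (continuousAt_id.mul (hasDerivAt_besselG hq).continuousAt)).continuousWithinAt
  obtain ⟨g, hg, hg1⟩ := besselG_one
  have h1 : 0 ≤ ((1 : ℂ) * besselG 1).re := by rw [hg1]; simp [hg.le]
  -- A nonpositive value at `p` and a nonnegative one at `1` would force a zero on the connected
  -- half-plane.
  obtain ⟨q, hq, hq0⟩ := isPreconnected_re_pos.intermediate_value (a := p) (b := 1) hp (by simp)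
    hcont ⟨not_lt.1 hn, h1⟩
  exact hne q hq hq0

/-! ### The Bessel kernel and its derivative -/

theorem kappa_pos {μ : ℝ} (hμ : 0 < μ) : 0 < kappa μ := Real.sqrt_pos.2 (by positivity)

theorem besselJ_zero_eq (t : ℝ) :
    besselJ 0 t = (1 / Real.pi) * ∫ θ in (0 : ℝ)..Real.pi, Real.cos (t * Real.sin θ) := by
  simp [besselJ]

/-- The derivative of the Bessel kernel. -/
def besselKernelDeriv (μ : ℝ) (x : ℝ) : ℝ :=
  -(1 / (Real.pi * kappa μ ^ 2)) *
    ∫ θ in (0 : ℝ)..Real.pi, Real.sin θ * Real.sin (x / kappa μ * Real.sin θ)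

theorem hasDerivAt_besselKernel (μ : ℝ) (x : ℝ) :
    HasDerivAt (besselKernel μ) (besselKernelDeriv μ x) x := by
  have h : HasDerivAt (fun t => ∫ θ in (0 : ℝ)..Real.pi, Real.cos (t * Real.sin θ))
      (∫ θ in (0 : ℝ)..Real.pi, -Real.sin (x / kappa μ * Real.sin θ) * Real.sin θ)
      (x / kappa μ) := by
    refine (intervalIntegral.hasDerivAt_integral_of_dominated_loc_of_deriv_le
      (F := fun t θ => Real.cos (t * Real.sin θ))
      (F' := fun t θ => -Real.sin (t * Real.sin θ) * Real.sin θ)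
      (bound := fun _ => 1) univ_mem ?_ ?_ ?_ ?_ ?_ ?_).2
    · exact Eventually.of_forall fun t => Continuous.aestronglyMeasurable (by fun_prop)
    · exact Continuous.intervalIntegrable (by fun_prop) _ _
    · exact Continuous.aestronglyMeasurable (by fun_prop)
    · refine Eventually.of_forall fun θ _ t _ => ?_
      rw [norm_mul, norm_neg]
      exact mul_le_one₀ (Real.abs_sin_le_one _) (norm_nonneg _) (Real.abs_sin_le_one _)
    · exact intervalIntegrable_const
    · refine Eventually.of_forall fun θ _ t _ => ?_
      simpa using ((hasDerivAt_id t).mul_const (Real.sin θ)).cos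
  have h2 := ((h.comp x ((hasDerivAt_id x).div_const (kappa μ))).const_mul
    (1 / Real.pi)).const_mul (1 / kappa μ)
  have e : besselKernel μ = fun x => 1 / kappa μ * (1 / Real.pi *
      (((fun t => ∫ θ in (0 : ℝ)..Real.pi, Real.cos (t * Real.sin θ)) ∘ fun x => x / kappa μ) x)) :=
    funext fun x => by rw [besselKernel, besselJ_zero_eq]; rfl
  rw [e]
  refine h2.congr_deriv ?_
  have e3 : ∫ θ in (0 : ℝ)..Real.pi, -Real.sin (x / kappa μ * Real.sin θ) * Real.sin θ =
      - ∫ θ in (0 : ℝ)..Real.pi, Real.sin θ * Real.sin (x / kappa μ * Real.sin θ) := by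
    rw [← intervalIntegral.integral_neg]
    refine intervalIntegral.integral_congr fun θ _ => ?_
    ring
  rw [e3, besselKernelDeriv]
  ring

theorem continuous_besselKernelDeriv (μ : ℝ) : Continuous (besselKernelDeriv μ) := by
  unfold besselKernelDeriv
  refine continuous_const.mul ?_
  exact intervalIntegral.continuous_parametric_intervalIntegral_of_continuous' (by fun_prop) _ _

theorem abs_besselKernel_le {μ : ℝ} (hμ : 0 < μ) (x : ℝ) : ‖besselKernel μ x‖ ≤ 1 / kappa μ := by
  have hk := kappa_pos hμ
  rw [besselKernel, besselJ_zero_eq, norm_mul, norm_mul]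
  have h := intervalIntegral.norm_integral_le_of_norm_le_const (a := 0) (b := Real.pi) (C := 1)
    (f := fun θ => Real.cos (x / kappa μ * Real.sin θ)) fun θ _ => Real.abs_cos_le_one _
  rw [sub_zero, one_mul, abs_of_pos Real.pi_pos] at h
  rw [Real.norm_of_nonneg (by positivity), Real.norm_of_nonneg (by positivity)]
  have : 1 / Real.pi * ‖∫ θ in (0 : ℝ)..Real.pi, Real.cos (x / kappa μ * Real.sin θ)‖ ≤ 1 := by
    rw [one_div, inv_mul_le_iff₀ Real.pi_pos]; linarith
  exact mul_le_of_le_one_right (by positivity) this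

theorem abs_besselKernelDeriv_le {μ : ℝ} (hμ : 0 < μ) (x : ℝ) :
    ‖besselKernelDeriv μ x‖ ≤ 1 / kappa μ ^ 2 := by
  have hk := kappa_pos hμ
  rw [besselKernelDeriv, norm_mul, norm_neg]
  have h := intervalIntegral.norm_integral_le_of_norm_le_const (a := 0) (b := Real.pi) (C := 1)
    (f := fun θ => Real.sin θ * Real.sin (x / kappa μ * Real.sin θ)) fun θ _ => by
      rw [norm_mul]
      exact mul_le_one₀ (Real.abs_sin_le_one _) (norm_nonneg _) (Real.abs_sin_le_one _)
  rw [sub_zero, one_mul, abs_of_pos Real.pi_pos] at h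
  rw [Real.norm_of_nonneg (by positivity), one_div_mul_eq_div]
  calc _ ≤ Real.pi / (Real.pi * kappa μ ^ 2) := by gcongr
    _ = _ := by field_simp

theorem besselKernel_zero (μ : ℝ) : besselKernel μ 0 = 1 / kappa μ := by
  rw [besselKernel, besselJ_zero_eq]
  simp

/-- The Bessel kernel as a bounded continuous function. -/
def besselB {μ : ℝ} (hμ : 0 < μ) : ℝ →ᵇ ℝ :=
  BoundedContinuousFunction.ofNormedAddCommGroup (besselKernel μ)
    (continuous_iff_continuousAt.2 fun t => (hasDerivAt_besselKernel μ t).continuousAt) _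
    (abs_besselKernel_le hμ)

/-- The derivative of the Bessel kernel as a bounded continuous function. -/
def besselB' {μ : ℝ} (hμ : 0 < μ) : ℝ →ᵇ ℝ :=
  BoundedContinuousFunction.ofNormedAddCommGroup (besselKernelDeriv μ)
    (continuous_besselKernelDeriv μ) _ (abs_besselKernelDeriv_le hμ)

theorem hasDerivAt_besselB {μ : ℝ} (hμ : 0 < μ) (x : ℝ) :
    HasDerivAt (besselB hμ) (besselB' hμ x) x := hasDerivAt_besselKernel μ x

theorem besselB_zero {μ : ℝ} (hμ : 0 < μ) : besselB hμ 0 = 1 / kappa μ := besselKernel_zero μ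

/-! ### Laplace transform -/

theorem integral_exp_mul_sin {p : ℂ} (hp : 0 < p.re) (w : ℝ) :
    ∫ x in Ioi (0 : ℝ), Complex.exp (-p * x) * (Real.sin (w * x) : ℂ) = w / (p ^ 2 + w ^ 2) := by
  have h1 : (-p + w * Complex.I).re < 0 := by simp [hp]
  have h2 : (-p - w * Complex.I).re < 0 := by simp [hp]
  have e : ∀ x : ℝ, Complex.exp (-p * x) * (Real.sin (w * x) : ℂ) =
      (Complex.exp ((-p - w * Complex.I) * x) - Complex.exp ((-p + w * Complex.I) * x)) *
        (Complex.I / 2) := by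
    intro x
    rw [Complex.ofReal_sin, Complex.sin]
    have e1 : (-p - w * Complex.I) * x = -p * x + -((w * x : ℝ) : ℂ) * Complex.I := by
      push_cast; ring
    have e2 : (-p + w * Complex.I) * x = -p * x + ((w * x : ℝ) : ℂ) * Complex.I := by
      push_cast; ring
    rw [e1, e2, Complex.exp_add, Complex.exp_add]
    ring
  simp_rw [e]
  rw [integral_mul_const, integral_sub (integrableOn_exp_mul_complex_Ioi h2 0)
    (integrableOn_exp_mul_complex_Ioi h1 0), integral_exp_mul_complex_Ioi h2,
    integral_exp_mul_complex_Ioi h1]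
  have n1 : -p + w * Complex.I ≠ 0 := fun h => by rw [h] at h1; simp at h1
  have n2 : -p - w * Complex.I ≠ 0 := fun h => by rw [h] at h2; simp at h2
  have n3 := sq_add_ne_zero hp w
  simp only [Complex.ofReal_zero, mul_zero, Complex.exp_zero]
  field_simp
  linear_combination (-2 * p ^ 2 * w) * Complex.I_sq

end

/-! ### Fourier transform of the damped kernel and the quadratic form of convolution -/

section

open scoped FourierTransform ComplexConjugate Convolution InnerProductSpace

/-- Fubini reduces the transform to that of `sin (x sin θ / κ)`, and `sin² / (q² + sin²) = 1 - q² /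
(q² + sin²)` with `q = κp` produces `besselG`. The term `-1/κ` is `-𝒦(0)`; it cancels against the
multiple `κ⁻¹` of the identity in the transport operator. -/
theorem laplace_besselKernelDeriv {μ : ℝ} (hμ : 0 < μ) {p : ℂ} (hp : 0 < p.re) :
    ∫ x in Ioi (0 : ℝ), Complex.exp (-p * x) * (besselKernelDeriv μ x : ℂ) =
      (kappa μ * p * besselG (kappa μ * p)) / (Real.pi * kappa μ) - 1 / kappa μ := by
  have hκ := kappa_pos hμ
  set κ := kappa μ with hκd
  have hκc : (κ : ℂ) ≠ 0 := by exact_mod_cast hκ.ne'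
  have hπ : (Real.pi : ℂ) ≠ 0 := by exact_mod_cast Real.pi_ne_zero
  have hκp : 0 < ((κ : ℂ) * p).re := by simp [hκ, hp]
  have e1 : ∀ x : ℝ, Complex.exp (-p * x) * (besselKernelDeriv μ x : ℂ) =
      (-(1 / (Real.pi * κ ^ 2)) : ℂ) * ∫ θ in Ioc (0 : ℝ) Real.pi,
        Complex.exp (-p * x) * ((Real.sin θ : ℂ) * (Real.sin (Real.sin θ / κ * x) : ℂ)) := by
    intro x
    rw [integral_const_mul, besselKernelDeriv, intervalIntegral.integral_of_le Real.pi_pos.le]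
    have : ∫ θ in Ioc (0 : ℝ) Real.pi, (Real.sin θ : ℂ) * (Real.sin (Real.sin θ / κ * x) : ℂ) =
        ((∫ θ in Ioc (0 : ℝ) Real.pi, Real.sin θ * Real.sin (x / κ * Real.sin θ) : ℝ) : ℂ) := by
      rw [← integral_complex_ofReal]
      refine integral_congr_ae (Eventually.of_forall fun θ => ?_)
      simp only [Complex.ofReal_mul]
      congr 3; ring
    rw [this]
    push_cast
    ring
  simp_rw [e1]
  rw [integral_const_mul, integral_integral_swap]
  · have e2 : ∀ θ : ℝ, ∫ x in Ioi (0 : ℝ), Complex.exp (-p * x) *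
        ((Real.sin θ : ℂ) * (Real.sin (Real.sin θ / κ * x) : ℂ)) =
        κ - κ * (κ * p) * (κ * p / ((κ * p) ^ 2 + (Real.sin θ : ℂ) ^ 2)) := by
      intro θ
      have : ∀ x : ℝ, Complex.exp (-p * x) * ((Real.sin θ : ℂ) *
          (Real.sin (Real.sin θ / κ * x) : ℂ)) = (Real.sin θ : ℂ) *
          (Complex.exp (-p * x) * (Real.sin (Real.sin θ / κ * x) : ℂ)) := fun x => by ring
      simp_rw [this]
      rw [integral_const_mul, integral_exp_mul_sin hp]
      have n1 := sq_add_ne_zero hp (Real.sin θ / κ)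
      have n2 := sq_add_ne_zero hκp (Real.sin θ)
      generalize Real.sin θ = s at n1 n2 ⊢
      have e : p ^ 2 + ((s / κ : ℝ) : ℂ) ^ 2 = ((κ * p) ^ 2 + (s : ℂ) ^ 2) / κ ^ 2 := by
        push_cast; field_simp
      rw [e]
      rw [mul_pow] at n2 ⊢
      push_cast
      field_simp
      ring
    simp_rw [e2]
    rw [← intervalIntegral.integral_of_le Real.pi_pos.le, intervalIntegral.integral_sub,
      intervalIntegral.integral_const, intervalIntegral.integral_const_mul]
    · change _ * (_ - κ * (κ * p) * besselG (κ * p)) = _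
      simp only [sub_zero, Complex.real_smul]
      field_simp
      ring
    · exact intervalIntegrable_const
    · exact ((continuous_besselG_integrand hκp).const_mul _).intervalIntegrable _ _
  · have hexp : Integrable (fun x : ℝ => Complex.exp (-p * x)) (volume.restrict (Ioi (0 : ℝ))) :=
      integrableOn_exp_mul_complex_Ioi (by simpa using hp) 0
    have h1 := hexp.comp_fst (volume.restrict (Ioc (0 : ℝ) Real.pi))
    refine Integrable.mono h1 ?_ (Eventually.of_forall fun z => ?_)
    · exact Continuous.aestronglyMeasurable (by simp only [Function.uncurry_def]; fun_prop)
    · simp only [Function.uncurry]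
      rw [norm_mul]
      refine mul_le_of_le_one_right (norm_nonneg _) ?_
      rw [norm_mul, Complex.norm_real, Complex.norm_real]
      exact mul_le_one₀ (Real.abs_sin_le_one _) (norm_nonneg _) (Real.abs_sin_le_one _)

/-- The kernel `e^{-ax} 𝒦'(x) 1_{x > 0}` on the whole line. -/
def dampedKernel (μ a : ℝ) : ℝ → ℂ :=
  (Ioi (0 : ℝ)).indicator fun x => ((Real.exp (-a * x) * besselKernelDeriv μ x : ℝ) : ℂ)

theorem integrable_dampedKernel {μ : ℝ} (hμ : 0 < μ) {a : ℝ} (ha : 0 < a) :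
    Integrable (dampedKernel μ a) := by
  unfold dampedKernel
  rw [integrable_indicator_iff measurableSet_Ioi]
  refine Integrable.ofReal ?_
  refine Integrable.mul_bdd (c := 1 / kappa μ ^ 2)
    (integrableOn_exp_mul_Ioi (a := -a) (by linarith) 0)
    (continuous_besselKernelDeriv μ).aestronglyMeasurable
    (Eventually.of_forall fun x => abs_besselKernelDeriv_le hμ x)

/-- The Fourier transform at `ξ` is the Laplace transform at `a + 2πiξ`. The witness is `κ` times
this number; only the positivity of its real part is used later. -/
theorem fourier_dampedKernel {μ : ℝ} (hμ : 0 < μ) {a : ℝ} (ha : 0 < a) (ξ : ℝ) :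
    ∃ p : ℂ, 0 < p.re ∧ 𝓕 (dampedKernel μ a) ξ =
      (p * besselG p) / (Real.pi * kappa μ) - 1 / kappa μ := by
  set p : ℂ := a + 2 * Real.pi * ξ * Complex.I with hpd
  have hp : 0 < p.re := by simp [hpd, ha]
  refine ⟨kappa μ * p, by simpa using mul_pos (kappa_pos hμ) hp, ?_⟩
  rw [← laplace_besselKernelDeriv hμ hp, Real.fourier_real_eq_integral_exp_smul,
    ← integral_indicator measurableSet_Ioi]
  refine integral_congr_ae (Eventually.of_forall fun x => ?_)
  by_cases hx : x ∈ Ioi (0 : ℝ)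
  · simp only [dampedKernel, indicator_of_mem hx, smul_eq_mul, Complex.ofReal_mul,
      Complex.ofReal_exp]
    rw [← mul_assoc, ← Complex.exp_add]
    congr 2
    rw [hpd]; push_cast; ring
  · simp only [dampedKernel, indicator_of_notMem hx, smul_zero]

/-- Uniform positivity of the symbol on a vertical line. -/
theorem exists_symbol_lower_bound {μ : ℝ} (hμ : 0 < μ) {a : ℝ} (ha : 0 < a) :
    ∃ c : ℝ, 0 < c ∧ ∀ ξ : ℝ, c ≤ 1 / kappa μ + (𝓕 (dampedKernel μ a) ξ).re := by
  have hκ := kappa_pos hμ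
  set m : ℝ → ℝ := fun ξ => 1 / kappa μ + (𝓕 (dampedKernel μ a) ξ).re with hm
  have hpos : ∀ ξ, 0 < m ξ := by
    intro ξ
    obtain ⟨p, hp, he⟩ := fourier_dampedKernel hμ ha ξ
    have h1 : m ξ = (p * besselG p).re / (Real.pi * kappa μ) := by
      simp only [hm]
      rw [he, Complex.sub_re, ← Complex.ofReal_mul, Complex.div_ofReal_re]
      have : ((1 : ℂ) / (kappa μ : ℂ)).re = 1 / kappa μ := by
        rw [← Complex.ofReal_one, ← Complex.ofReal_div, Complex.ofReal_re]
      rw [this]; ring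
    rw [h1]
    exact div_pos (besselG_re_pos hp) (by positivity)
  have hcont : Continuous m := by
    have h : Continuous (𝓕 (dampedKernel μ a)) :=
      VectorFourier.fourierIntegral_continuous Real.continuous_fourierChar
        (by exact continuous_inner) (integrable_dampedKernel hμ ha)
    exact continuous_const.add (Complex.continuous_re.comp h)
  -- By Riemann–Lebesgue `m` tends to `1/κ`, hence is at least `1/(2κ)` off a compact set; on that
  -- set the continuous positive function attains its minimum.
  have hlim : Tendsto m (cocompact ℝ) (nhds (1 / kappa μ)) := by
    have h := (Complex.continuous_re.tendsto 0).comp (Real.zero_at_infty_fourier (dampedKernel μ a))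
    have h2 := h.const_add (1 / kappa μ)
    rw [Complex.zero_re, add_zero] at h2
    exact h2
  have hev : ∀ᶠ ξ in cocompact ℝ, 1 / (2 * kappa μ) ≤ m ξ := by
    refine hlim.eventually (eventually_ge_nhds ?_)
    gcongr; linarith
  obtain ⟨K, hK, hKs⟩ := mem_cocompact.1 hev
  rcases K.eq_empty_or_nonempty with h | h
  · refine ⟨1 / (2 * kappa μ), by positivity, fun ξ => hKs ?_⟩
    simp [h]
  · obtain ⟨ξ₀, _, hmin⟩ := hK.exists_isMinOn h hcont.continuousOn
    refine ⟨min (m ξ₀) (1 / (2 * kappa μ)), lt_min (hpos _) (by positivity), fun ξ => ?_⟩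
    by_cases hξ : ξ ∈ K
    · exact (min_le_left _ _).trans (hmin hξ)
    · exact (min_le_right _ _).trans (hKs hξ)

/-- Parseval in a form where `h` need only be integrable: the transform is moved from `h ⋆ φ` onto
the Schwartz function `𝓕 φ`, where Fourier inversion returns `φ`. -/
theorem integral_conj_convolution_mul {h : ℝ → ℂ} (hh : Integrable h) (φ : SchwartzMap ℝ ℂ) :
    ∫ x, conj ((h ⋆[ContinuousLinearMap.mul ℂ ℂ] (φ : ℝ → ℂ)) x) * φ x =
      ∫ ξ, conj (𝓕 h ξ) * ((‖𝓕 φ ξ‖ ^ 2 : ℝ) : ℂ) := by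
  have hconv : Integrable (h ⋆[ContinuousLinearMap.mul ℂ ℂ] (φ : ℝ → ℂ)) :=
    hh.integrable_convolution _ (φ.integrable (μ := volume))
  have key := VectorFourier.integral_sesq_fourierIntegral_eq_neg_flip (innerSL ℂ)
    (L := innerₗ ℝ) Real.continuous_fourierChar continuous_inner hconv ((𝓕 φ).integrable (μ := volume))
  have e1 : ∀ ξ, VectorFourier.fourierIntegral Real.fourierChar volume (innerₗ ℝ)
      (h ⋆[ContinuousLinearMap.mul ℂ ℂ] (φ : ℝ → ℂ)) ξ = 𝓕 h ξ * 𝓕 φ ξ := fun ξ => by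
    have := Real.fourier_mul_convolution_eq hh (φ.integrable (μ := volume)) ξ
    rw [SchwartzMap.fourier_coe]
    exact this
  have e2 : ∀ x, VectorFourier.fourierIntegral Real.fourierChar volume (-(innerₗ ℝ).flip)
      ((𝓕 φ : SchwartzMap ℝ ℂ) : ℝ → ℂ) x = φ x := fun x => by
    have h1 : (𝓕⁻ (𝓕 φ : SchwartzMap ℝ ℂ)) x = φ x := by simp
    rw [SchwartzMap.fourierInv_coe] at h1
    rw [← h1, Real.fourierInv_eq, VectorFourier.fourierIntegral]
    refine integral_congr_ae (Eventually.of_forall fun v => ?_)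
    have e3 : ((-(innerₗ ℝ).flip) v) x = -(x * v) := by
      change -(inner ℝ x v) = _
      simp [mul_comm]
    have e4 : inner ℝ v x = x * v := by simp
    simp only [e3, e4, neg_neg]
  simp_rw [e1, e2] at key
  simp only [innerSL_apply_apply, RCLike.inner_apply] at key
  rw [integral_congr_ae (Eventually.of_forall fun x => mul_comm _ _), ← key]
  refine integral_congr_ae (Eventually.of_forall fun ξ => ?_)
  simp only [map_mul]
  have : ((‖𝓕 φ ξ‖ ^ 2 : ℝ) : ℂ) = conj (𝓕 φ ξ) * 𝓕 φ ξ := by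
    rw [Complex.conj_mul']; push_cast; rfl
  rw [this]; ring

/-- On the Fourier side the quadratic form is the symbol integrated against `|𝓕 φ|²`, so a pointwise
bound on the symbol is enough. -/
theorem re_integral_conj_convolution_ge {h : ℝ → ℂ} (hh : Integrable h) (φ : SchwartzMap ℝ ℂ)
    {c k₀ : ℝ} (hc : ∀ ξ, c ≤ k₀ + (𝓕 h ξ).re) :
    c * ∫ x, ‖φ x‖ ^ 2 ≤ k₀ * (∫ x, ‖φ x‖ ^ 2) +
      (∫ x, conj ((h ⋆[ContinuousLinearMap.mul ℂ ℂ] (φ : ℝ → ℂ)) x) * φ x).re := by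
  have hsq : Integrable fun ξ => ‖𝓕 φ ξ‖ ^ 2 := by
    have := (SchwartzMap.memLp (𝓕 φ) 2 volume).integrable_norm_pow (by norm_num)
    simpa using this
  have hF : Continuous (𝓕 h) :=
    VectorFourier.fourierIntegral_continuous Real.continuous_fourierChar
      (by exact continuous_inner) hh
  have hbd : ∀ ξ, ‖𝓕 h ξ‖ ≤ ∫ x, ‖h x‖ := fun ξ =>
    VectorFourier.norm_fourierIntegral_le_integral_norm _ _ _ _ _
  have hint : Integrable fun ξ => conj (𝓕 h ξ) * ((‖𝓕 φ ξ‖ ^ 2 : ℝ) : ℂ) := by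
    refine (hsq.ofReal (𝕜 := ℂ)).bdd_mul (c := ∫ x, ‖h x‖) ?_ (Eventually.of_forall fun ξ => ?_)
    · exact (Complex.continuous_conj.comp hF).aestronglyMeasurable
    · rw [RCLike.norm_conj]; exact hbd ξ
  rw [integral_conj_convolution_mul hh φ, ← SchwartzMap.integral_norm_sq_fourier]
  have hre : (∫ ξ, conj (𝓕 h ξ) * ((‖𝓕 φ ξ‖ ^ 2 : ℝ) : ℂ)).re =
      ∫ ξ, (conj (𝓕 h ξ) * ((‖𝓕 φ ξ‖ ^ 2 : ℝ) : ℂ)).re := (integral_re hint).symm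
  rw [hre, ← integral_const_mul, ← integral_const_mul, ← integral_add (hsq.const_mul _) (by exact hint.re)]
  refine integral_mono (hsq.const_mul _) ((hsq.const_mul _).add (by exact hint.re)) fun ξ => ?_
  simp only [Complex.re_mul_ofReal, Complex.conj_re]
  nlinarith [hc ξ, sq_nonneg ‖𝓕 φ ξ‖]

end

section

open scoped FourierTransform ComplexConjugate Convolution InnerProductSpace

/-! ### Coercivity of the transport operator -/

theorem isLocallyFiniteMeasure_weighted (a : ℝ) : IsLocallyFiniteMeasure (weightedMeasure a) := by
  have h : Continuous fun x : ℝ => Real.exp (-2 * a * x) := by fun_prop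
  exact IsLocallyFiniteMeasure.withDensity_ofReal h

theorem memLp_test {a : ℝ} {ψ : ℝ → ℝ} (h : Continuous ψ) (hc : HasCompactSupport ψ) :
    MemLp ψ 2 (weightedMeasure a) := by
  have := isLocallyFiniteMeasure_weighted a
  exact h.memLp_of_hasCompactSupport hc

theorem inner_L2a {a : ℝ} (v w : L2a a) :
    ⟪v, w⟫_ℝ = ∫ x in Ioi (0 : ℝ), Real.exp (-2 * a * x) * (v x * w x) := by
  rw [L2.inner_def, integral_weighted]
  refine integral_congr_ae (Eventually.of_forall fun x => ?_)
  simp [mul_comm]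

/-- The classes of smooth functions with compact support in `(0, ∞)`. -/
def testL2 (a : ℝ) : Submodule ℝ (L2a a) where
  carrier := {v | ∃ ψ : ℝ → ℝ, ContDiff ℝ ∞ ψ ∧ HasCompactSupport ψ ∧ tsupport ψ ⊆ Ioi 0 ∧
    v =ᵐ[volume.restrict (Ioi 0)] ψ}
  zero_mem' := ⟨0, contDiff_const, HasCompactSupport.zero, by simp [tsupport],
    ae_restrict_of_ae_weighted (Lp.coeFn_zero ℝ 2 (weightedMeasure a))⟩
  add_mem' := by
    rintro v w ⟨ψ, h1, h2, h3, h4⟩ ⟨φ, k1, k2, k3, k4⟩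
    refine ⟨ψ + φ, h1.add k1, h2.add k2, (tsupport_add ψ φ).trans (union_subset h3 k3), ?_⟩
    filter_upwards [coeFn_add' v w, h4, k4] with x e1 e2 e3
    rw [e1, e2, e3]; rfl
  smul_mem' := by
    rintro c v ⟨ψ, h1, h2, h3, h4⟩
    refine ⟨fun x => c * ψ x, contDiff_const.mul h1, h2.mul_left, ?_, ?_⟩
    · exact (tsupport_mul_subset_right (f := fun _ => c) (g := ψ)).trans h3
    · filter_upwards [coeFn_smul' c v, h4] with x e1 e2
      rw [e1, e2]

/-- If `w` is orthogonal to all test functions, `e^{-2ax} w` integrates to zero against each of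
them; the fundamental lemma and positivity of the weight give `w = 0`. -/
theorem dense_testL2 (a : ℝ) : Dense (testL2 a : Set (L2a a)) := by
  rw [Submodule.dense_iff_topologicalClosure_eq_top, Submodule.topologicalClosure_eq_top_iff,
    Submodule.eq_bot_iff]
  intro w hw
  rw [Submodule.mem_orthogonal] at hw
  have hloc : LocallyIntegrableOn (fun x => Real.exp (-2 * a * x) * w x) (Ioi 0) volume :=
    LocallyIntegrableOn.continuousOn_mul ((locallyIntegrableOn_L2a w).mono_set Ioi_subset_Ici_self)
      (by fun_prop) isOpen_Ioi.isLocallyClosed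
  have key := isOpen_Ioi.ae_eq_zero_of_integral_contDiff_smul_eq_zero hloc ?_
  · refine L2a_ext ?_
    rw [EventuallyEq, ae_restrict_iff' measurableSet_Ioi]
    have hz := (ae_restrict_iff' measurableSet_Ioi).1
      (ae_restrict_of_ae_weighted (Lp.coeFn_zero ℝ 2 (weightedMeasure a)))
    filter_upwards [key, hz] with x hx hz h0
    rw [hz h0]
    exact (mul_eq_zero.1 (hx h0)).resolve_left (Real.exp_pos _).ne'
  intro ψ h1 h2 h3
  set v : L2a a := (memLp_test (a := a) h1.continuous h2).toLp ψ with hv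
  have hvψ : v =ᵐ[volume.restrict (Ioi 0)] ψ := ae_restrict_of_ae_weighted (MemLp.coeFn_toLp _)
  have h := hw v ⟨ψ, h1, h2, h3, hvψ⟩
  rw [inner_L2a] at h
  rw [← h, ← setIntegral_eq_integral_of_forall_compl_eq_zero (s := Ioi 0)]
  · refine integral_congr_ae ?_
    filter_upwards [hvψ] with x hx
    rw [hx, smul_eq_mul]; ring
  · intro x hx
    rw [image_eq_zero_of_notMem_tsupport (fun h => hx (h3 h)), zero_smul]

theorem convolution_dampedKernel {μ a : ℝ} {ψ : ℝ → ℝ} (h0 : ∀ x, x ≤ 0 → ψ x = 0) {x : ℝ}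
    (hx : 0 ≤ x) :
    (dampedKernel μ a ⋆[ContinuousLinearMap.mul ℂ ℂ]
      fun x => ((Real.exp (-a * x) * ψ x : ℝ) : ℂ)) x =
      ((Real.exp (-a * x) * causalConv (besselKernelDeriv μ) ψ x : ℝ) : ℂ) := by
  rw [convolution_eq_swap]
  simp only [ContinuousLinearMap.mul_apply']
  rw [causalConv, intervalIntegral.integral_of_le hx, ← integral_const_mul,
    ← integral_complex_ofReal, integral_Ioc_eq_integral_Ioo, ← integral_indicator measurableSet_Ioo]
  refine integral_congr_ae (Eventually.of_forall fun t => ?_)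
  simp only
  by_cases ht : t ∈ Ioo 0 x
  · rw [indicator_of_mem ht, dampedKernel, indicator_of_mem (by simpa using ht.2),
      ← Complex.ofReal_mul]
    congr 1
    have : Real.exp (-a * (x - t)) * Real.exp (-a * t) = Real.exp (-a * x) := by
      rw [← Real.exp_add]; congr 1; ring
    rw [← this]; ring
  · rw [indicator_of_notMem ht]
    by_cases ht0 : t ≤ 0
    · rw [h0 t ht0]; simp
    · rw [dampedKernel, indicator_of_notMem, zero_mul]
      simp only [mem_Ioi, sub_pos, not_lt]
      exact not_lt.1 fun h => ht ⟨not_le.1 ht0, h⟩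

/-- The transport operator `v ↦ κ⁻¹ v + 𝒦' * v`, which equals `∂ₓ (𝒦 * v)`. -/
def transportOp {μ : ℝ} (hμ : 0 < μ) {a : ℝ} (ha : 0 < a) : L2a a →L[ℝ] L2a a :=
  (1 / kappa μ) • (1 : L2a a →L[ℝ] L2a a) + convCLM ha (besselB' hμ)

/-- The map `ψ ↦ e^{-ax} ψ` is isometric from `L²_a` to `L²` and turns `𝒦' *` into convolution with
the damped kernel. For a test function the image is Schwartz, so the Fourier bound applies. -/
theorem coercive_on_test {μ : ℝ} (hμ : 0 < μ) {a : ℝ} (ha : 0 < a) {c : ℝ}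
    (hc : ∀ ξ : ℝ, c ≤ 1 / kappa μ + (𝓕 (dampedKernel μ a) ξ).re) {v : L2a a}
    (hv : v ∈ testL2 a) : c * ‖v‖ ^ 2 ≤ ⟪v, transportOp hμ ha v⟫_ℝ := by
  obtain ⟨ψ, h1, h2, h3, h4⟩ := hv
  have hψ0 : ∀ x, x ≤ 0 → ψ x = 0 := fun x hx =>
    image_eq_zero_of_notMem_tsupport fun h => not_lt.2 hx (h3 h)
  set g : ℝ → ℂ := fun x => ((Real.exp (-a * x) * ψ x : ℝ) : ℂ) with hg
  have hexp : ContDiff ℝ ∞ fun x : ℝ => Real.exp (-a * x) :=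
    Real.contDiff_exp.comp (contDiff_const.mul contDiff_id)
  have hgc : ContDiff ℝ ∞ g := Complex.ofRealCLM.contDiff.comp (hexp.mul h1)
  have hgs : HasCompactSupport g :=
    (h2.mul_left (f := fun x => Real.exp (-a * x))).comp_left (g := ((↑) : ℝ → ℂ)) Complex.ofReal_zero
  set φ : SchwartzMap ℝ ℂ := hgs.toSchwartzMap hgc
  have hφ : (φ : ℝ → ℂ) = g := rfl
  have key := re_integral_conj_convolution_ge (integrable_dampedKernel hμ ha) φ hc
  have hsq : ∀ x : ℝ, Real.exp (-2 * a * x) = Real.exp (-a * x) * Real.exp (-a * x) := fun x => by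
    rw [← Real.exp_add]; congr 1; ring
  have e1 : ∫ x, ‖φ x‖ ^ 2 = ‖v‖ ^ 2 := by
    rw [← real_inner_self_eq_norm_sq, inner_L2a, hφ,
      ← setIntegral_eq_integral_of_forall_compl_eq_zero (s := Ioi 0)]
    · refine integral_congr_ae ?_
      filter_upwards [h4] with x hx
      rw [hx, hsq, hg]
      simp only [Complex.norm_real, Real.norm_eq_abs, sq_abs]
      ring
    · intro x hx
      simp [hg, hψ0 x (not_lt.1 hx)]
  have e2 : (∫ x, conj ((dampedKernel μ a ⋆[ContinuousLinearMap.mul ℂ ℂ] (φ : ℝ → ℂ)) x) * φ x).re =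
      ⟪v, convCLM ha (besselB' hμ) v⟫_ℝ := by
    have : ∫ x, conj ((dampedKernel μ a ⋆[ContinuousLinearMap.mul ℂ ℂ] (φ : ℝ → ℂ)) x) * φ x =
        ((⟪v, convCLM ha (besselB' hμ) v⟫_ℝ : ℝ) : ℂ) := by
      rw [inner_L2a, ← integral_complex_ofReal, hφ,
        ← setIntegral_eq_integral_of_forall_compl_eq_zero (s := Ioi 0)]
      · refine integral_congr_ae ?_
        filter_upwards [h4, convCLM_coe ha (besselB' hμ) v, ae_restrict_mem measurableSet_Ioi]
          with x hx hx2 hx0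
        rw [hx2, hx, hg, convolution_dampedKernel hψ0 (le_of_lt hx0),
          causalConv_congr h4 (le_of_lt hx0), Complex.conj_ofReal, ← Complex.ofReal_mul, hsq]
        congr 1
        change _ = _ * (_ * causalConv (besselKernelDeriv μ) ψ x)
        ring
      · intro x hx
        simp [hg, hψ0 x (not_lt.1 hx)]
    rw [this, Complex.ofReal_re]
  rw [e1, e2] at key
  rw [transportOp, add_apply, smul_apply, one_apply_eq_self, inner_add_right,
    inner_smul_right, real_inner_self_eq_norm_sq]
  exact key

theorem exists_coercive {μ : ℝ} (hμ : 0 < μ) {a : ℝ} (ha : 0 < a) :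
    ∃ c : ℝ, 0 < c ∧ ∀ v : L2a a, c * ‖v‖ ^ 2 ≤ ⟪v, transportOp hμ ha v⟫_ℝ := by
  obtain ⟨c, hc, hc'⟩ := exists_symbol_lower_bound hμ ha
  refine ⟨c, hc, fun v => ?_⟩
  have hcl : IsClosed {v : L2a a | c * ‖v‖ ^ 2 ≤ ⟪v, transportOp hμ ha v⟫_ℝ} := by
    refine isClosed_le (by fun_prop) ?_
    exact continuous_id.inner (transportOp hμ ha).continuous
  exact hcl.closure_subset_iff.2 (fun v hv => coercive_on_test hμ ha hc' hv) (dense_testL2 a v)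

/-- A coercive operator generates an exponentially decaying evolution. -/
theorem norm_evol_le {E : Type*} [NormedAddCommGroup E] [InnerProductSpace ℝ E] [CompleteSpace E]
    {B : E →L[ℝ] E} {c : ℝ} (hB : ∀ v, c * ‖v‖ ^ 2 ≤ ⟪v, B v⟫_ℝ) {t : ℝ} (ht : 0 ≤ t) (x : E) :
    ‖evol B t x‖ ≤ Real.exp (-c * t) * ‖x‖ := by
  set y : ℝ → E := fun s => evol B s x with hy
  have hyd : ∀ s, HasDerivAt y (-(B (y s))) s := fun s => by
    simpa using (hasDerivAt_evol B s).clm_apply (hasDerivAt_const s x)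
  set z : ℝ → ℝ := fun s => Real.exp (2 * c * s) * ‖y s‖ ^ 2 with hz
  have hzd : ∀ s, HasDerivAt z (Real.exp (2 * c * s) *
      (2 * (c * ‖y s‖ ^ 2 - ⟪y s, B (y s)⟫_ℝ))) s := fun s => by
    have h1 : HasDerivAt (fun s => Real.exp (2 * c * s)) (Real.exp (2 * c * s) * (2 * c)) s := by
      simpa using ((hasDerivAt_id s).const_mul (2 * c)).exp
    refine (h1.mul (hyd s).norm_sq).congr_deriv ?_
    rw [inner_neg_right]; ring
  -- Energy estimate: coercivity makes `e^{2cs} ‖y s‖²` nonincreasing.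
  have hanti : AntitoneOn z (Ici 0) := by
    refine antitoneOn_of_deriv_nonpos (convex_Ici 0)
      (fun s _ => (hzd s).continuousAt.continuousWithinAt)
      (fun s _ => (hzd s).differentiableAt.differentiableWithinAt) fun s _ => ?_
    rw [(hzd s).deriv]
    have := hB (y s)
    exact mul_nonpos_of_nonneg_of_nonpos (Real.exp_pos _).le (by linarith)
  have h := hanti self_mem_Ici ht ht
  simp only [hz, hy, mul_zero, Real.exp_zero, one_mul, evol_zero, one_apply_eq_self] at h
  have h2 : ‖evol B t x‖ ^ 2 ≤ (Real.exp (-c * t) * ‖x‖) ^ 2 := by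
    have e : Real.exp (2 * c * t) * Real.exp (-c * t) ^ 2 = 1 := by
      rw [← Real.exp_nat_mul, ← Real.exp_add]
      simp only [Nat.cast_ofNat, Real.exp_eq_one_iff]; ring
    rw [mul_pow]
    have h3 := mul_le_mul_of_nonneg_left h (sq_nonneg (Real.exp (-c * t)))
    calc _ = Real.exp (2 * c * t) * Real.exp (-c * t) ^ 2 * ‖evol B t x‖ ^ 2 := by rw [e, one_mul]
      _ ≤ _ := by linarith
  exact le_of_sq_le_sq h2 (by positivity)

/-- The boundary term `𝒦(0) (1 * v)` cancels the multiple `κ⁻¹` of the identity. This identity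
integrates the equation for `∂ₓu` to the one for `u`. -/
theorem one_conv_transportOp {μ : ℝ} (hμ : 0 < μ) {a : ℝ} (ha : 0 < a) (v : L2a a) :
    convCLM ha oneB (transportOp hμ ha v) = convCLM ha (besselB hμ) v := by
  rw [transportOp, add_apply, map_add,
    conv_one_conv ha (hasDerivAt_besselB hμ), besselB_zero]
  simp

theorem transportOp_conv_one {μ : ℝ} (hμ : 0 < μ) {a : ℝ} (ha : 0 < a) (v : L2a a) :
    transportOp hμ ha (convCLM ha oneB v) = convCLM ha (besselB hμ) v := by
  rw [transportOp, add_apply,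
    conv_conv_one ha (hasDerivAt_besselB hμ), besselB_zero]
  simp

/-- Applied to the part `ub · 1` of `u`, this produces the source `ub 𝒦` of the ODE and hence the
kernel norm in the estimate. -/
theorem transportOp_one {μ : ℝ} (hμ : 0 < μ) {a : ℝ} (ha : 0 < a) :
    transportOp hμ ha (bcfL2 ha oneB) = bcfL2 ha (besselB hμ) := by
  rw [transportOp, add_apply,
    conv_bcf_one ha (hasDerivAt_besselB hμ), besselB_zero]
  simp

end

section

/-! ### The space `H¹_a` -/

/-- The inclusion `H¹_a → L²_a`. -/
def toL2L (a : ℝ) : H1a a →L[ℝ] L2a a :=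
  LinearMap.mkContinuous
    { toFun := toL2, map_add' := fun _ _ => rfl, map_smul' := fun _ _ => rfl } 1 fun v => by
      rw [one_mul, norm_eq]
      exact le_add_of_nonneg_right (norm_nonneg _)

/-- The derivative `H¹_a → L²_a`. -/
def dxL (a : ℝ) : H1a a →L[ℝ] L2a a :=
  LinearMap.mkContinuous
    { toFun := dx, map_add' := fun _ _ => rfl, map_smul' := fun _ _ => rfl } 1 fun v => by
      rw [one_mul, norm_eq]
      exact le_add_of_nonneg_left (norm_nonneg _)

theorem hasWeakDeriv_H1a {a : ℝ} (v : H1a a) : HasWeakDeriv (toL2 v) (dx v) := v.2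

/-- The element of `H¹_a` with given components. -/
def mkH1a {a : ℝ} (v w : L2a a) (h : HasWeakDeriv v w) : H1a a := ⟨WithLp.toLp 1 (v, w), h⟩

theorem H1a_ext' {a : ℝ} {v w : H1a a} (h : toL2 v = toL2 w) (h' : dx v = dx w) : v = w := by
  have : ‖v - w‖ = 0 := by
    rw [norm_eq]
    have e1 : toL2 (v - w) = toL2 v - toL2 w := rfl
    have e2 : dx (v - w) = dx v - dx w := rfl
    rw [e1, e2, h, h', sub_self, sub_self, norm_zero, add_zero]
  exact sub_eq_zero.1 (norm_eq_zero.1 this)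

/-- Uniqueness of weak derivatives. -/
theorem HasWeakDeriv.unique {v w w' : ℝ → ℝ} (h : HasWeakDeriv v w) (h' : HasWeakDeriv v w')
    (hw : LocallyIntegrableOn w (Ici 0) volume) (hw' : LocallyIntegrableOn w' (Ici 0) volume) :
    w =ᵐ[volume.restrict (Ioi 0)] w' := by
  have key := isOpen_Ioi.ae_eq_zero_of_integral_contDiff_smul_eq_zero (μ := volume)
    (f := fun x => w x - w' x) (U := Ioi (0 : ℝ)) ((hw.sub hw').mono_set Ioi_subset_Ici_self) ?_
  · rw [EventuallyEq, ae_restrict_iff' measurableSet_Ioi]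
    filter_upwards [key] with x hx h0
    exact sub_eq_zero.1 (hx h0)
  intro φ h1 h2 h3
  rw [← setIntegral_eq_integral_of_forall_compl_eq_zero (s := Ioi 0) fun x hx => by
    rw [image_eq_zero_of_notMem_tsupport (fun h => hx (h3 h)), zero_smul]]
  simp only [smul_sub]
  rw [integral_sub (integrable_smul_of_locallyIntegrableOn hw h1.continuous h2)
    (integrable_smul_of_locallyIntegrableOn hw' h1.continuous h2)]
  have e1 := h φ h1 h2 h3
  have e2 := h' φ h1 h2 h3
  linarith

theorem H1a_ext {a : ℝ} {v w : H1a a} (h : toL2 v = toL2 w) : v = w := by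
  refine H1a_ext' h (L2a_ext ?_)
  have hw := hasWeakDeriv_H1a w
  rw [← h] at hw
  exact (hasWeakDeriv_H1a v).unique hw (locallyIntegrableOn_L2a _) (locallyIntegrableOn_L2a _)

theorem continuousOn_H1a {a : ℝ} {u : ℝ → H1a a} {s : Set ℝ}
    (h1 : ContinuousOn (fun t => toL2 (u t)) s) (h2 : ContinuousOn (fun t => dx (u t)) s) :
    ContinuousOn u s := by
  intro t ht
  rw [ContinuousWithinAt, tendsto_iff_norm_sub_tendsto_zero]
  have e1 := tendsto_iff_norm_sub_tendsto_zero.1 (h1 t ht)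
  have e2 := tendsto_iff_norm_sub_tendsto_zero.1 (h2 t ht)
  have e3 := e1.add e2
  rw [add_zero] at e3
  refine e3.congr fun s => ?_
  rw [norm_eq (u s - u t)]
  rfl

theorem HasBoundaryValue.ae_eq_primitive {a : ℝ} {v : H1a a} {c : ℝ}
    (h : HasBoundaryValue (toL2 v) c) :
    toL2 v =ᵐ[volume.restrict (Ioi 0)] fun x => c + ∫ y in (0 : ℝ)..x, dx v y := by
  obtain ⟨c', hc'⟩ := (hasWeakDeriv_H1a v).exists_ae_eq_primitive
    (locallyIntegrableOn_L2a _) (locallyIntegrableOn_L2a _)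
  obtain ⟨g, hg, hvg, hg0⟩ := h
  have he := eqOn_Ici_of_ae_eq hg (continuousOn_const.add
    (continuousOn_primitive_Ici fun t ht => intervalIntegrable_L2a (dx v) ht)) (hvg.symm.trans hc')
  have h0 := he (self_mem_Ici (a := (0 : ℝ)))
  simp only [Pi.add_apply, hg0, intervalIntegral.integral_same, add_zero] at h0
  rwa [h0]

theorem hasBoundaryValue_of_ae_eq_primitive {a : ℝ} {v : ℝ → ℝ} {w : L2a a} {c : ℝ}
    (h : v =ᵐ[volume.restrict (Ioi 0)] fun x => c + ∫ y in (0 : ℝ)..x, w y) :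
    HasBoundaryValue v c :=
  ⟨_, continuousOn_const.add (continuousOn_primitive_Ici fun _ ht => intervalIntegrable_L2a w ht), h,
    by simp⟩

theorem primitive_coe {a : ℝ} (ha : 0 < a) (c : ℝ) (w : L2a a) :
    (c • bcfL2 ha oneB + convCLM ha oneB w : L2a a) =ᵐ[volume.restrict (Ioi 0)]
      fun x => c + ∫ y in (0 : ℝ)..x, w y := by
  filter_upwards [coeFn_add' (c • bcfL2 ha oneB) (convCLM ha oneB w),
    coeFn_smul' c (bcfL2 ha oneB), bcfL2_coe ha oneB, convCLM_coe ha oneB w] with x h1 h2 h3 h4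
  rw [h1, h2, h3, h4, causalConv_one]
  simp

/-- The fundamental theorem of calculus as an identity in `L²_a`; constants belong to this space
because `a > 0`. -/
theorem toL2_eq_of_boundary {a : ℝ} (ha : 0 < a) {v : H1a a} {c : ℝ}
    (h : HasBoundaryValue (toL2 v) c) : toL2 v = c • bcfL2 ha oneB + convCLM ha oneB (dx v) :=
  L2a_ext (h.ae_eq_primitive.trans (primitive_coe ha c (dx v)).symm)

theorem hasWeakDeriv_const_add_primitive {a : ℝ} (ha : 0 < a) (c : ℝ) (w : L2a a) :
    HasWeakDeriv (c • bcfL2 ha oneB + convCLM ha oneB w : L2a a) w :=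
  (hasWeakDeriv_primitive (fun _ ht => intervalIntegrable_L2a w ht) c).congr
    (primitive_coe ha c w).symm EventuallyEq.rfl

/-! ### Duhamel estimates -/

theorem norm_duhamel_le {E : Type*} [NormedAddCommGroup E] [NormedSpace ℝ E] {S : ℝ → E →L[ℝ] E}
    {c : ℝ} (hS : ∀ s, 0 ≤ s → ∀ x, ‖S s x‖ ≤ Real.exp (-c * s) * ‖x‖) {x : E} {f : ℝ → E} {t : ℝ}
    (ht : 0 ≤ t) {g : ℝ → ℝ} (hg : IntervalIntegrable g volume 0 t) (hfg : ∀ s, ‖f s‖ ≤ g s) :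
    ‖duhamel S x f t‖ ≤ Real.exp (-c * t) * ‖x‖ +
      ∫ s in (0 : ℝ)..t, Real.exp (-c * (t - s)) * g s := by
  refine (norm_add_le _ _).trans (add_le_add (hS t ht x) ?_)
  refine intervalIntegral.norm_integral_le_of_norm_le ht (Eventually.of_forall fun s hs => ?_) ?_
  · refine (hS _ (by linarith [hs.2]) _).trans ?_
    gcongr
    exact hfg s
  · exact hg.continuousOn_mul (by fun_prop)

theorem intervalIntegrable_toL2 {a : ℝ} {f : ℝ → H1a a} (hf : LocallyIntegrableOn f (Ici 0) volume)
    {t : ℝ} (ht : 0 ≤ t) : IntervalIntegrable (fun s => toL2 (f s)) volume 0 t :=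
  have h := intervalIntegrable_of_locallyIntegrableOn hf ht
  ⟨(toL2L a).integrable_comp h.1, (toL2L a).integrable_comp h.2⟩

theorem intervalIntegrable_dx {a : ℝ} {f : ℝ → H1a a} (hf : LocallyIntegrableOn f (Ici 0) volume)
    {t : ℝ} (ht : 0 ≤ t) : IntervalIntegrable (fun s => dx (f s)) volume 0 t :=
  have h := intervalIntegrable_of_locallyIntegrableOn hf ht
  ⟨(dxL a).integrable_comp h.1, (dxL a).integrable_comp h.2⟩

theorem intervalIntegrable_of_continuousOn_Ici {E : Type*} [NormedAddCommGroup E] {g : ℝ → E}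
    (hg : ContinuousOn g (Ici 0)) {t : ℝ} (ht : 0 ≤ t) : IntervalIntegrable g volume 0 t :=
  ContinuousOn.intervalIntegrable (hg.mono (by rw [uIcc_of_le ht]; exact Icc_subset_Ici_self))

theorem ae_Ioc_of_ae_Ioi {p : ℝ → Prop} {t : ℝ}
    (h : ∀ᵐ s ∂(volume.restrict (Ioi (0 : ℝ))), p s) : ∀ᵐ s, s ∈ Ioc 0 t → p s := by
  rw [← ae_restrict_iff' measurableSet_Ioc]
  exact ae_mono (Measure.restrict_mono Ioc_subset_Ioi_self le_rfl) h

theorem integral_congr_ae_Ioi {E : Type*} [NormedAddCommGroup E] [NormedSpace ℝ E] {f g : ℝ → E}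
    {t : ℝ} (ht : 0 ≤ t) (h : f =ᵐ[volume.restrict (Ioi 0)] g) :
    ∫ s in (0 : ℝ)..t, f s = ∫ s in (0 : ℝ)..t, g s :=
  intervalIntegral.integral_congr_ae (by rw [uIoc_of_le ht]; exact ae_Ioc_of_ae_Ioi h)

/-- A primitive of a function continuous on `[0, ∞)` is `C¹` there. -/
theorem contDiffOn_of_eq_primitive {E : Type*} [NormedAddCommGroup E] [NormedSpace ℝ E]
    [CompleteSpace E] {U g : ℝ → E} {x : E} (hg : ContinuousOn g (Ici 0))
    (hU : ∀ t, 0 ≤ t → U t = x + ∫ s in (0 : ℝ)..t, g s) :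
    ContDiffOn ℝ 1 U (Ici 0) ∧ ∀ t, 0 ≤ t → derivWithin U (Ici 0) t = g t := by
  -- Constant extension to negative times makes the primitive differentiable on both sides of `0`.
  set G : ℝ → E := fun s => g (max s 0) with hG
  have hGc : Continuous G := hg.comp_continuous (by fun_prop) fun s => mem_Ici.2 (le_max_right _ _)
  have hP : ∀ t, HasDerivAt (fun t => x + ∫ s in (0 : ℝ)..t, G s) (G t) t := fun t =>
    (intervalIntegral.integral_hasDerivAt_right (hGc.intervalIntegrable _ _)
      (hGc.stronglyMeasurableAtFilter _ _) hGc.continuousAt).const_add x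
  have hUP : ∀ t ∈ Ici (0 : ℝ), U t = x + ∫ s in (0 : ℝ)..t, G s := fun t ht => by
    rw [hU t ht]
    congr 1
    refine intervalIntegral.integral_congr fun s hs => ?_
    rw [uIcc_of_le ht] at hs
    simp [hG, max_eq_left hs.1]
  refine ⟨ContDiffOn.congr ?_ hUP, fun t ht => ?_⟩
  · refine ContDiff.contDiffOn (contDiff_one_iff_deriv.2 ⟨fun t => (hP t).differentiableAt, ?_⟩)
    rwa [funext fun t => (hP t).deriv]
  · rw [((hP t).hasDerivWithinAt.congr hUP (hUP t ht)).derivWithin (uniqueDiffOn_Ici 0 t ht)]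
    simp [hG, max_eq_left ht]

theorem eq_primitive_of_contDiffOn {E : Type*} [NormedAddCommGroup E] [NormedSpace ℝ E]
    [CompleteSpace E] {U : ℝ → E} (hU : ContDiffOn ℝ 1 U (Ici 0)) {t : ℝ} (ht : 0 ≤ t) :
    U t = U 0 + ∫ s in (0 : ℝ)..t, derivWithin U (Ici 0) s := by
  have hc := hU.continuousOn_derivWithin (uniqueDiffOn_Ici 0) le_rfl
  rw [intervalIntegral.integral_eq_sub_of_hasDerivAt_of_le ht
    (hU.continuousOn.mono Icc_subset_Ici_self) (fun s hs => ?_)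
    (intervalIntegrable_of_continuousOn_Ici hc ht), add_sub_cancel]
  exact ((hU.differentiableOn (by simp) s hs.1.le).hasDerivWithinAt).hasDerivAt (Ici_mem_nhds hs.1)

/-! ### The weighted problem -/

section Weighted

variable {μ a : ℝ} {f : ℝ → H1a a} {F : ℝ → ℝ → ℝ} {u₀ : H1a a}
  {uin ub ub' : ℝ → ℝ}

/-- Every solution is given by Duhamel's formula. -/
theorem IsSolution.toL2_eq_duhamel (hμ : 0 < μ) (ha : 0 < a) {v : ℝ → H1a a} (hv : IsSolution μ F uin ub v)
    (hf : LocallyIntegrableOn f (Ici 0) volume) (hub : ContinuousOn ub (Ici 0))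
    (hF : ∀ᵐ t ∂(volume.restrict (Ioi (0 : ℝ))), F t =ᵐ[volume.restrict (Ioi 0)] toL2 (f t))
    (hin : uin =ᵐ[volume.restrict (Ioi 0)] toL2 u₀) {t : ℝ} (ht : 0 ≤ t) :
    toL2 (v t) = duhamel (evol (transportOp hμ ha)) (toL2 u₀)
      (fun t => toL2 (f t) + ub t • bcfL2 ha (besselB hμ)) t := by
  have hubK : ContinuousOn (fun t => ub t • bcfL2 ha (besselB hμ)) (Ici 0) :=
    hub.smul continuousOn_const
  have hBv : ContinuousOn (fun t => transportOp hμ ha (toL2 (v t))) (Ici 0) :=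
    (transportOp hμ ha).continuous.comp_continuousOn hv.memX1.contDiff.continuousOn
  refine eq_duhamel_evol (y := fun t => toL2 (v t)) (fun _ ht => (intervalIntegrable_toL2 hf ht).add
    (intervalIntegrable_of_continuousOn_Ici hubK ht)) hv.memX1.contDiff.continuousOn ?_ ht
  intro t ht
  have h0 : toL2 (v 0) = toL2 u₀ := L2a_ext (hv.initial.trans hin)
  rw [eq_primitive_of_contDiffOn hv.memX1.contDiff ht, h0, add_sub_assoc,
    ← intervalIntegral.integral_sub ((intervalIntegrable_toL2 hf ht).add
      (intervalIntegrable_of_continuousOn_Ici hubK ht))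
      (intervalIntegrable_of_continuousOn_Ici hBv ht)]
  congr 1
  refine integral_congr_ae_Ioi ht ?_
  filter_upwards [hv.equation, hF, ae_restrict_mem measurableSet_Ioi] with s hs hFs hs0
  have hb := toL2_eq_of_boundary ha (hv.boundary s (le_of_lt hs0))
  -- Splitting off the boundary value gives `𝒦 * ∂ₓv = B v - ub 𝒦`, so the equation reads `v' + B v
  -- = f + ub 𝒦`.
  have hB : transportOp hμ ha (toL2 (v s)) =
      ub s • bcfL2 ha (besselB hμ) + convCLM ha (besselB hμ) (dx (v s)) := by
    conv_lhs => rw [hb]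
    rw [map_add, map_smul, transportOp_one, transportOp_conv_one]
  have hD : derivWithin (fun s => toL2 (v s)) (Ici 0) s =
      toL2 (f s) - convCLM ha (besselB hμ) (dx (v s)) := by
    refine L2a_ext ?_
    filter_upwards [hs, hFs, coeFn_sub' (toL2 (f s)) (convCLM ha (besselB hμ) (dx (v s))),
      convCLM_coe ha (besselB hμ) (dx (v s))] with x h1 h2 h3 h4
    rw [h3, h4, ← h2, ← h1]
    exact (add_sub_cancel_right _ _).symm
  rw [hD, hB]
  abel

theorem IsSolution.unique (hμ : 0 < μ) (ha : 0 < a) {v w : ℝ → H1a a} (hv : IsSolution μ F uin ub v)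
    (hw : IsSolution μ F uin ub w)
    (hf : LocallyIntegrableOn f (Ici 0) volume) (hub : ContinuousOn ub (Ici 0))
    (hF : ∀ᵐ t ∂(volume.restrict (Ioi (0 : ℝ))), F t =ᵐ[volume.restrict (Ioi 0)] toL2 (f t))
    (hin : uin =ᵐ[volume.restrict (Ioi 0)] toL2 u₀) : EqOn v w (Ici 0) := fun _ ht =>
  H1a_ext ((IsSolution.toL2_eq_duhamel hμ ha hv hf hub hF hin ht).trans
    (IsSolution.toL2_eq_duhamel hμ ha hw hf hub hF hin ht).symm)

/-- Existence for the weighted problem, with Duhamel's formula for the derivative. -/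
theorem exists_solution (hμ : 0 < μ) (ha : 0 < a) (hf : LocallyIntegrableOn f (Ici 0) volume)
    {g : ℝ → L2a a} (hg : ContinuousOn g (Ici 0))
    (hfg : (fun t => toL2 (f t)) =ᵐ[volume.restrict (Ioi 0)] g)
    (hF : ∀ᵐ t ∂(volume.restrict (Ioi (0 : ℝ))), F t =ᵐ[volume.restrict (Ioi 0)] toL2 (f t))
    (hin : uin =ᵐ[volume.restrict (Ioi 0)] toL2 u₀) (hub : ContinuousOn ub (Ici 0))
    (hub' : ∀ t, 0 ≤ t → IntervalIntegrable ub' volume 0 t)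
    (hubi : ∀ t, 0 ≤ t → ub t = ub 0 + ∫ s in (0 : ℝ)..t, ub' s)
    (hu₀ : HasBoundaryValue (toL2 u₀) (ub 0))
    (hcomp : ∀ᵐ t ∂(volume.restrict (Ioi (0 : ℝ))), HasBoundaryValue (toL2 (f t)) (ub' t)) :
    ∃ u : ℝ → H1a a, IsSolution μ F uin ub u ∧ ∀ t,
      dx (u t) = duhamel (evol (transportOp hμ ha)) (dx u₀) (fun s => dx (f s)) t := by
  -- The prospective `∂ₓu`, solving `w' + B w = ∂ₓf`; `u` is then its primitive with boundary value
  -- `ub`.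
  set w : ℝ → L2a a := duhamel (evol (transportOp hμ ha)) (dx u₀) (fun s => dx (f s)) with hw
  have hwc : ContinuousOn w (Ici 0) := continuousOn_duhamel_evol fun _ ht => intervalIntegrable_dx hf ht
  set U : ℝ → L2a a := fun t => ub t • bcfL2 ha oneB + convCLM ha oneB (w t) with hU
  set u : ℝ → H1a a := fun t => mkH1a (U t) (w t) (hasWeakDeriv_const_add_primitive ha _ _) with hu
  have hUc : ContinuousOn U (Ici 0) :=
    (hub.smul continuousOn_const).add ((convCLM ha oneB).continuous.comp_continuousOn hwc)
  have hKw : ContinuousOn (fun t => convCLM ha (besselB hμ) (w t)) (Ici 0) :=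
    (convCLM ha (besselB hμ)).continuous.comp_continuousOn hwc
  have hUi : ∀ t, 0 ≤ t → U t = toL2 u₀ +
      ∫ s in (0 : ℝ)..t, (g s - convCLM ha (besselB hμ) (w s)) := by
    intro t ht
    have hdx := intervalIntegrable_dx hf ht
    have hBw : IntervalIntegrable (fun s => transportOp hμ ha (w s)) volume 0 t :=
      intervalIntegrable_of_continuousOn_Ici
        ((transportOp hμ ha).continuous.comp_continuousOn hwc) ht
    have e1 : convCLM ha oneB (w t) = convCLM ha oneB (dx u₀) +
        (∫ s in (0 : ℝ)..t, convCLM ha oneB (dx (f s))) -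
        ∫ s in (0 : ℝ)..t, convCLM ha (besselB hμ) (w s) := by
      rw [hw, duhamel_evol_spec (fun t ht => intervalIntegrable_dx hf ht) ht, ← hw, map_sub, map_add,
        ← ContinuousLinearMap.intervalIntegral_comp_comm _ hdx,
        ← ContinuousLinearMap.intervalIntegral_comp_comm _ hBw]
      simp only [one_conv_transportOp hμ ha]
    -- The second compatibility condition enters here: `f = ub' · 1 + 1 * ∂ₓf`. The continuous
    -- representative `g` of `f` makes the time derivative of `u` continuous.
    have e2 : (∫ s in (0 : ℝ)..t, g s) = (∫ s in (0 : ℝ)..t, ub' s) • bcfL2 ha oneB +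
        ∫ s in (0 : ℝ)..t, convCLM ha oneB (dx (f s)) := by
      rw [← intervalIntegral.integral_smul_const, ← intervalIntegral.integral_add]
      · refine integral_congr_ae_Ioi ht ?_
        filter_upwards [hfg, hcomp] with s h1 h2
        rw [← h1, toL2_eq_of_boundary ha h2]
      · exact ⟨(hub' t ht).1.smul_const _, (hub' t ht).2.smul_const _⟩
      · exact ⟨(convCLM ha oneB).integrable_comp hdx.1, (convCLM ha oneB).integrable_comp hdx.2⟩
    simp only [hU]
    rw [e1, intervalIntegral.integral_sub (intervalIntegrable_of_continuousOn_Ici hg ht)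
      (intervalIntegrable_of_continuousOn_Ici hKw ht), e2, toL2_eq_of_boundary ha hu₀, hubi t ht,
      add_smul]
    abel
  obtain ⟨hC1, hder⟩ := contDiffOn_of_eq_primitive (hg.sub hKw) hUi
  refine ⟨u, ⟨⟨continuousOn_H1a hUc hwc, hC1⟩, ?_, fun t _ => ?_, ?_⟩, fun t => rfl⟩
  · filter_upwards [hfg, hF, ae_restrict_mem measurableSet_Ioi] with t h1 h2 ht
    have e : derivWithin (fun s => toL2 (u s)) (Ici 0) t = g t - convCLM ha (besselB hμ) (w t) :=
      hder t (le_of_lt ht)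
    rw [e, ← h1]
    filter_upwards [coeFn_sub' (toL2 (f t)) (convCLM ha (besselB hμ) (w t)),
      convCLM_coe ha (besselB hμ) (w t), h2] with x k1 k2 k3
    rw [k1, k2, k3]
    exact sub_add_cancel _ _
  · exact hasBoundaryValue_of_ae_eq_primitive (primitive_coe ha (ub t) (w t))
  · refine EventuallyEq.trans ?_ hin.symm
    have : toL2 (u 0) = toL2 u₀ := by
      have := hUi 0 le_rfl
      rw [intervalIntegral.integral_same, add_zero] at this
      exact this
    rw [this]

end Weighted

theorem weighted_theorem {μ : ℝ} (hμ : 0 < μ) {a : ℝ} (ha : 0 < a) :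
    MemLp (besselKernel μ) 2 (weightedMeasure a) ∧
      ∃ c : ℝ, 0 < c ∧
        ∀ (f : ℝ → H1a a) (uin : H1a a) (ub ub' : ℝ → ℝ),
          MemY1 f →
          ContinuousOn ub (Ici 0) →
          IsW11Loc ub ub' →
          HasBoundaryValue (toL2 uin) (ub 0) →
          (∀ᵐ t ∂(volume.restrict (Ioi (0 : ℝ))),
            HasBoundaryValue (toL2 (f t)) (ub' t)) →
          ∃ u : ℝ → H1a a,
            IsSolution μ (fun t => toL2 (f t)) (toL2 uin) ub u ∧
            (∀ v : ℝ → H1a a,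
              IsSolution μ (fun t => toL2 (f t)) (toL2 uin) ub v →
              EqOn v u (Ici 0)) ∧
            ∀ t : ℝ, 0 ≤ t →
              ‖u t‖ ≤ Real.exp (-c * t) * ‖uin‖ +
                ∫ s in (0 : ℝ)..t, Real.exp (-c * (t - s)) *
                  (‖f s‖ + (eLpNorm (besselKernel μ) 2
                    (weightedMeasure a)).toReal * |ub s|) := by
  refine ⟨memLp_bcf ha (besselB hμ), ?_⟩
  obtain ⟨c, hc, hcoer⟩ := exists_coercive hμ ha
  refine ⟨c, hc, fun f uin ub ub' hf hub hw hin hcomp => ?_⟩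
  obtain ⟨f', hf'⟩ := hf.w11
  obtain ⟨g, hg, hfg⟩ := hf'.exists_continuousOn
  have hF : ∀ᵐ t ∂(volume.restrict (Ioi (0 : ℝ))),
    (toL2 (f t) : ℝ → ℝ) =ᵐ[volume.restrict (Ioi 0)] toL2 (f t) :=
    Eventually.of_forall fun t => EventuallyEq.rfl
  obtain ⟨u, hu, hdx⟩ := exists_solution hμ ha (F := fun t => toL2 (f t)) hf.locInt hg hfg hF
    EventuallyEq.rfl hub
    (fun t ht => intervalIntegrable_of_locallyIntegrableOn hw.locInt_deriv ht)
    (fun t ht => hw.eq_primitive hub ht) hin hcomp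
  refine ⟨u, hu, fun v hv => IsSolution.unique hμ ha hv hu hf.locInt hub hF EventuallyEq.rfl, fun t ht => ?_⟩
  have hS : ∀ s, 0 ≤ s → ∀ x, ‖evol (transportOp hμ ha) s x‖ ≤ Real.exp (-c * s) * ‖x‖ :=
    fun s hs x => norm_evol_le hcoer hs x
  set K := (eLpNorm (besselKernel μ) 2 (weightedMeasure a)).toReal with hK
  have hKn : ‖bcfL2 ha (besselB hμ)‖ = K := Lp.norm_toLp _ _
  have hi1 : IntervalIntegrable (fun s => ‖toL2 (f s)‖ + K * |ub s|) volume 0 t :=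
    (intervalIntegrable_toL2 hf.locInt ht).norm.add
      (intervalIntegrable_of_continuousOn_Ici (continuousOn_const.mul hub.abs) ht)
  have hi2 : IntervalIntegrable (fun s => ‖dx (f s)‖) volume 0 t :=
    (intervalIntegrable_dx hf.locInt ht).norm
  -- Both components evolve under the same `B`, hence with the same rate `c`; the boundary source
  -- appears only in the one for `u`.
  have b1 : ‖toL2 (u t)‖ ≤ Real.exp (-c * t) * ‖toL2 uin‖ +
      ∫ s in (0 : ℝ)..t, Real.exp (-c * (t - s)) * (‖toL2 (f s)‖ + K * |ub s|) := by
    rw [IsSolution.toL2_eq_duhamel hμ ha hu hf.locInt hub hF EventuallyEq.rfl ht]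
    refine norm_duhamel_le hS ht hi1 fun s => (norm_add_le _ _).trans ?_
    rw [norm_smul, hKn, Real.norm_eq_abs, mul_comm]
  have b2 : ‖dx (u t)‖ ≤ Real.exp (-c * t) * ‖dx uin‖ +
      ∫ s in (0 : ℝ)..t, Real.exp (-c * (t - s)) * ‖dx (f s)‖ := by
    rw [hdx t]
    exact norm_duhamel_le hS ht hi2 fun s => le_rfl
  rw [norm_eq]
  refine (add_le_add b1 b2).trans (le_of_eq ?_)
  rw [add_add_add_comm, ← mul_add, ← norm_eq uin, ← intervalIntegral.integral_add
    (hi1.continuousOn_mul (by fun_prop)) (hi2.continuousOn_mul (by fun_prop))]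
  congr 1
  refine intervalIntegral.integral_congr fun s _ => ?_
  rw [norm_eq (f s)]
  ring

end

section

open scoped InnerProductSpace Topology

/-! ### Descent of an evolution family to a smaller Hilbert space -/

section Descent

variable {X Y : Type*} [NormedAddCommGroup X] [InnerProductSpace ℝ X]
  [NormedAddCommGroup Y] [InnerProductSpace ℝ Y]

/-- Injectivity of `j` makes the lifted vector unique, and uniqueness makes the choice linear. -/
theorem exists_contraction_lift {j : X →L[ℝ] Y} (hj : Function.Injective j) {A : Y →L[ℝ] Y}
    (h : ∀ x, ∃ y, j y = A (j x) ∧ ‖y‖ ≤ ‖x‖) :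
    ∃ T : X →L[ℝ] X, ∀ x, j (T x) = A (j x) ∧ ‖T x‖ ≤ ‖x‖ := by
  choose T hT using h
  refine ⟨LinearMap.mkContinuous ⟨⟨T, fun x y => hj ?_⟩, fun c x => hj ?_⟩ 1 fun x => ?_, hT⟩
  · rw [map_add, (hT _).1, (hT _).1, (hT _).1, map_add, map_add]
  · simp only [RingHom.id_apply]
    rw [map_smul, (hT _).1, (hT _).1, map_smul, map_smul]
  · rw [one_mul]; exact (hT x).2

variable [CompleteSpace X] [CompleteSpace Y]

/-- The orthogonal complement of the range of `j*` is the kernel of `j`, which is zero, so the range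
is dense. -/
theorem exists_adjoint_near {j : X →L[ℝ] Y} (hj : Function.Injective j) (x : X) {ε : ℝ}
    (hε : 0 < ε) : ∃ z : Y, ‖x - ContinuousLinearMap.adjoint j z‖ < ε := by
  have hd : ((ContinuousLinearMap.adjoint j).range).topologicalClosure = ⊤ := by
    rw [Submodule.topologicalClosure_eq_top_iff, Submodule.eq_bot_iff]
    intro y hy
    rw [Submodule.mem_orthogonal] at hy
    have h := hy (ContinuousLinearMap.adjoint j (j y)) ⟨j y, rfl⟩
    rw [ContinuousLinearMap.adjoint_inner_left, inner_self_eq_zero] at h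
    exact hj (by rw [h, map_zero])
  have hx : x ∈ closure (((ContinuousLinearMap.adjoint j).range : Submodule ℝ X) : Set X) := by
    rw [← Submodule.topologicalClosure_coe, hd]; trivial
  obtain ⟨y, ⟨z, hz⟩, hy⟩ := Metric.mem_closure_iff.1 hx ε hε
  refine ⟨z, ?_⟩
  rw [dist_eq_norm, ← hz] at hy
  exact hy

/-- Norm bounds and convergence in a weaker topology give strong convergence. -/
theorem tendsto_of_norm_le_of_tendsto {ι : Type*} {l : Filter ι} {j : X →L[ℝ] Y}
    (hj : Function.Injective j) {y : ι → X} {x : X} (hn : ∀ᶠ i in l, ‖y i‖ ≤ ‖x‖)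
    (ht : Tendsto (fun i => j (y i)) l (𝓝 (j x))) : Tendsto y l (𝓝 x) := by
  rw [tendsto_iff_norm_sub_tendsto_zero]
  have hsq : Tendsto (fun i => ‖y i - x‖ ^ 2) l (𝓝 0) := by
    rw [Metric.tendsto_nhds]
    intro ε hε
    obtain ⟨z, hz⟩ := exists_adjoint_near hj x (ε := ε / (8 * (‖x‖ + 1))) (by positivity)
    have h1 := (tendsto_iff_norm_sub_tendsto_zero.1 ht).mul_const ‖z‖
    rw [zero_mul] at h1
    filter_upwards [hn, h1.eventually (gt_mem_nhds (by positivity : 0 < ε / 4))] with i h2 h3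
    rw [Real.dist_eq, sub_zero, abs_of_nonneg (sq_nonneg _)]
    -- The difference of squared norms is nonpositive. In the inner product, `x` is replaced by a
    -- nearby `j* z`, which moves the pairing to `Y`, where convergence is known. The tolerance is
    -- chosen so that each of the two pieces is at most `ε/4`.
    have e1 : ‖y i - x‖ ^ 2 = ‖y i‖ ^ 2 - ‖x‖ ^ 2 - 2 * ⟪y i - x, x⟫_ℝ := by
      rw [norm_sub_sq_real, inner_sub_left, real_inner_self_eq_norm_sq]; ring
    have e2 : ⟪y i - x, x⟫_ℝ = ⟪y i - x, x - ContinuousLinearMap.adjoint j z⟫_ℝ +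
        ⟪j (y i) - j x, z⟫_ℝ := by
      rw [inner_sub_right, ContinuousLinearMap.adjoint_inner_right, map_sub, sub_add_cancel]
    have b1 : |⟪y i - x, x - ContinuousLinearMap.adjoint j z⟫_ℝ| ≤ 2 * ‖x‖ * (ε / (8 * (‖x‖ + 1))) := by
      refine (abs_real_inner_le_norm _ _).trans ?_
      gcongr
      exact (norm_sub_le _ _).trans (by linarith)
    have b2 : |⟪j (y i) - j x, z⟫_ℝ| ≤ ‖j (y i) - j x‖ * ‖z‖ := abs_real_inner_le_norm _ _
    have b3 : 2 * ‖x‖ * (ε / (8 * (‖x‖ + 1))) ≤ ε / 4 := by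
      rw [mul_div_assoc', div_le_div_iff₀ (by positivity) (by norm_num)]
      nlinarith [norm_nonneg x]
    have b4 : ‖y i‖ ^ 2 ≤ ‖x‖ ^ 2 := pow_le_pow_left₀ (norm_nonneg _) h2 2
    have c1 := (abs_le.1 b1).1
    have c2 := (abs_le.1 b2).1
    rw [e1, e2]
    linarith
  have := hsq.sqrt
  simpa [Real.sqrt_sq (norm_nonneg _)] using this

/-- A continuous evolution which acts contractively on a smaller Hilbert space is strongly
continuous there. -/
theorem exists_descent {j : X →L[ℝ] Y} (hj : Function.Injective j) (B : Y →L[ℝ] Y)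
    (h : ∀ t, 0 ≤ t → ∀ x, ∃ y, j y = evol B t (j x) ∧ ‖y‖ ≤ ‖x‖) :
    ∃ S : ℝ → X →L[ℝ] X, (∀ t x, ‖S t x‖ ≤ ‖x‖) ∧ (∀ t, 0 ≤ t → ∀ x, j (S t x) = evol B t (j x)) ∧
      (∀ t, t ≤ 0 → ∀ x, S t x = x) ∧ Continuous fun p : ℝ × X => S p.1 p.2 := by
  -- Clipping time at `0` makes `S t` the identity for `t ≤ 0`, so that joint continuity holds on
  -- all of `ℝ × X`.
  choose S hS using fun t : ℝ => exists_contraction_lift hj (h (max t 0) (le_max_right _ _))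
  have hSj : ∀ t, 0 ≤ t → ∀ x, j (S t x) = evol B t (j x) := fun t ht x => by
    rw [(hS t x).1, max_eq_left ht]
  refine ⟨S, fun t x => (hS t x).2, hSj, fun t ht x => hj (by
    rw [(hS t x).1, max_eq_right ht, evol_zero]; rfl), ?_⟩
  have hneg : ∀ t x, S t x = S (max t 0) x := fun t x => hj (by
    rw [(hS t x).1, hSj _ (le_max_right _ _)])
  have hadd : ∀ s t, 0 ≤ s → 0 ≤ t → ∀ x, S (s + t) x = S s (S t x) := fun s t hs ht x => hj (by
    rw [hSj _ (add_nonneg hs ht), hSj _ hs, hSj _ ht, evol_add]; rfl)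
  have hzero : ∀ x, S 0 x = x := fun x => hj (by rw [hSj 0 le_rfl, evol_zero]; rfl)
  have hlim : ∀ x, Tendsto (fun t => ‖S t x - x‖) (𝓝 0) (𝓝 0) := by
    intro x
    refine tendsto_iff_norm_sub_tendsto_zero.1 (tendsto_of_norm_le_of_tendsto hj
      (Eventually.of_forall fun t => (hS t x).2) ?_)
    have hc : Continuous fun t => evol B (max t 0) (j x) :=
      ((continuous_evol B).comp (by fun_prop)).clm_apply continuous_const
    have := hc.tendsto 0
    simp only [max_self, evol_zero, one_apply_eq_self] at this
    exact this.congr fun t => ((hS t x).1).symm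
  -- The semigroup law and contractivity carry continuity at time `0` to every time.
  have hle : ∀ x s t, 0 ≤ s → s ≤ t → ‖S t x - S s x‖ ≤ ‖S (t - s) x - x‖ := by
    intro x s t hs hst
    have e : S t x = S s (S (t - s) x) := by
      rw [← hadd s (t - s) hs (sub_nonneg.2 hst), add_sub_cancel]
    rw [e, ← map_sub]
    exact (hS s _).2
  have hle' : ∀ x s t, ‖S t x - S s x‖ ≤ ‖S |max t 0 - max s 0| x - x‖ := by
    intro x s t
    rw [hneg t, hneg s]
    rcases le_total (max s 0) (max t 0) with hst | hst
    · rw [abs_of_nonneg (sub_nonneg.2 hst)]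
      exact hle x _ _ (le_max_right _ _) hst
    · rw [abs_of_nonpos (sub_nonpos.2 hst), neg_sub, norm_sub_rev]
      exact hle x _ _ (le_max_right _ _) hst
  rw [continuous_iff_continuousAt]
  rintro ⟨s, x⟩
  rw [ContinuousAt, tendsto_iff_norm_sub_tendsto_zero]
  have g1 : Tendsto (fun p : ℝ × X => ‖p.2 - x‖) (𝓝 (s, x)) (𝓝 0) := by
    have : Continuous fun p : ℝ × X => ‖p.2 - x‖ := by fun_prop
    simpa using this.tendsto (s, x)
  have g2 : Tendsto (fun p : ℝ × X => ‖S |max p.1 0 - max s 0| x - x‖) (𝓝 (s, x)) (𝓝 0) := by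
    refine (hlim x).comp ?_
    have : Continuous fun p : ℝ × X => |max p.1 0 - max s 0| := by fun_prop
    simpa using this.tendsto (s, x)
  have g3 := g1.add g2
  rw [add_zero] at g3
  refine squeeze_zero (fun p => norm_nonneg _) (fun p => ?_) g3
  calc ‖S p.1 p.2 - S s x‖ = ‖S p.1 (p.2 - x) + (S p.1 x - S s x)‖ := by rw [map_sub]; abel_nf
    _ ≤ _ := (norm_add_le _ _).trans (add_le_add (hS _ _).2 (hle' x s p.1))

end Descent

/-! ### Duhamel's formula for strongly continuous contractions -/

section StronglyContinuous

variable {X : Type*} [NormedAddCommGroup X] [NormedSpace ℝ X] {S : ℝ → X →L[ℝ] X}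

theorem aestronglyMeasurable_evolution (hc : Continuous fun p : ℝ × X => S p.1 p.2) {F : ℝ → X}
    {ν : Measure ℝ} (hF : AEStronglyMeasurable F ν) (t : ℝ) :
    AEStronglyMeasurable (fun s => S (t - s) (F s)) ν := by
  have h1 : AEStronglyMeasurable (fun s : ℝ => t - s) ν :=
    Continuous.aestronglyMeasurable (by fun_prop)
  exact hc.comp_aestronglyMeasurable (h1.prodMk hF)

theorem intervalIntegrable_evolution (hS : ∀ t x, ‖S t x‖ ≤ ‖x‖)
    (hc : Continuous fun p : ℝ × X => S p.1 p.2) {F : ℝ → X} {a b : ℝ}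
    (hF : IntervalIntegrable F volume a b) (t : ℝ) :
    IntervalIntegrable (fun s => S (t - s) (F s)) volume a b :=
  ⟨Integrable.mono hF.1 (aestronglyMeasurable_evolution hc hF.1.aestronglyMeasurable t)
    (Eventually.of_forall fun _ => hS _ _),
   Integrable.mono hF.2 (aestronglyMeasurable_evolution hc hF.2.aestronglyMeasurable t)
    (Eventually.of_forall fun _ => hS _ _)⟩

/-- Since `S` is the identity at nonpositive times, extending the integral from `[0, t]` to a fixed
`[0, T]` adds exactly `∫ F` over `[t, T]`. The integral over `[0, T]` is continuous by dominated
convergence, the correction as a primitive. -/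
theorem continuousOn_duhamel (hS : ∀ t x, ‖S t x‖ ≤ ‖x‖)
    (hc : Continuous fun p : ℝ × X => S p.1 p.2) (h0 : ∀ t, t ≤ 0 → ∀ x, S t x = x)
    {F : ℝ → X} (hF : ∀ t, 0 ≤ t → IntervalIntegrable F volume 0 t) (x : X) :
    ContinuousOn (duhamel S x F) (Ici 0) := by
  have h1 : Continuous fun t => S t x := hc.comp (by fun_prop : Continuous fun t : ℝ => (t, x))
  have key : ∀ T, 0 ≤ T → ContinuousOn (duhamel S x F) (Icc 0 T) := by
    intro T hT
    have h2 : Continuous fun t => ∫ s in (0 : ℝ)..T, S (t - s) (F s) := by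
      refine intervalIntegral.continuous_of_dominated_interval (bound := fun s => ‖F s‖)
        (fun t => ?_) (fun t => Eventually.of_forall fun s _ => hS _ _) (hF T hT).norm
        (Eventually.of_forall fun s _ => ?_)
      · rw [uIoc_of_le hT]
        exact aestronglyMeasurable_evolution hc (hF T hT).1.aestronglyMeasurable t
      · exact hc.comp (by fun_prop : Continuous fun t : ℝ => (t - s, F s))
    have h3 : ContinuousOn (fun t => ∫ s in (0 : ℝ)..t, F s) (Icc 0 T) :=
      (continuousOn_primitive_Ici hF).mono Icc_subset_Ici_self
    refine ((h1.continuousOn.add (h2.continuousOn.sub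
      ((continuousOn_const (c := ∫ s in (0 : ℝ)..T, F s)).sub h3)))).congr fun t ht => ?_
    have hi := intervalIntegrable_evolution hS hc (hF T hT) t
    have hi1 : IntervalIntegrable (fun s => S (t - s) (F s)) volume 0 t :=
      intervalIntegrable_evolution hS hc (hF t ht.1) t
    have hsub : uIcc t T ⊆ uIcc 0 T := by
      rw [uIcc_of_le ht.2, uIcc_of_le hT]; exact Icc_subset_Icc ht.1 le_rfl
    have e1 : ∫ s in t..T, S (t - s) (F s) = ∫ s in t..T, F s := by
      refine intervalIntegral.integral_congr fun s hs => ?_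
      rw [uIcc_of_le ht.2] at hs
      exact h0 _ (by linarith [hs.1]) _
    have e2 := intervalIntegral.integral_add_adjacent_intervals hi1 (hi.mono_set hsub)
    have e3 := intervalIntegral.integral_add_adjacent_intervals (hF t ht.1)
      ((hF T hT).mono_set hsub)
    simp only [Pi.add_apply, Pi.sub_apply, duhamel]
    rw [← e2, ← e3, e1]
    abel
  intro t ht
  have ht : 0 ≤ t := ht
  refine ((key (t + 1) (by linarith)) t ⟨ht, by linarith⟩).mono_of_mem_nhdsWithin ?_
  refine mem_nhdsWithin.2 ⟨Iio (t + 1), isOpen_Iio, by simp, ?_⟩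
  rintro s ⟨h1, h2⟩
  exact ⟨h2, le_of_lt h1⟩

theorem map_duhamel {Y : Type*} [NormedAddCommGroup Y] [NormedSpace ℝ Y] [CompleteSpace X]
    [CompleteSpace Y] (hS : ∀ t x, ‖S t x‖ ≤ ‖x‖)
    (hc : Continuous fun p : ℝ × X => S p.1 p.2) {S' : ℝ → Y →L[ℝ] Y} {j : X →L[ℝ] Y}
    (hj : ∀ t, 0 ≤ t → ∀ x, j (S t x) = S' t (j x)) {F : ℝ → X} {t : ℝ} (ht : 0 ≤ t)
    (hF : IntervalIntegrable F volume 0 t) (x : X) :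
    j (duhamel S x F t) = duhamel S' (j x) (fun s => j (F s)) t := by
  unfold duhamel
  rw [map_add, hj t ht,
    ← ContinuousLinearMap.intervalIntegral_comp_comm _ (intervalIntegrable_evolution hS hc hF t)]
  congr 1
  refine intervalIntegral.integral_congr fun s hs => ?_
  rw [uIcc_of_le ht] at hs
  exact hj _ (by linarith [hs.2]) _

end StronglyContinuous

theorem duhamel_zero {X : Type*} [NormedAddCommGroup X] [NormedSpace ℝ X] (S : ℝ → X →L[ℝ] X)
    (x : X) (t : ℝ) : duhamel S x (fun _ => 0) t = S t x := by simp [duhamel]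

/-- The image of the evolution under `j` solves the integrated equation for `B'`, so uniqueness
identifies it. -/
theorem map_evol {X Y : Type*} [NormedAddCommGroup X] [NormedSpace ℝ X] [CompleteSpace X]
    [NormedAddCommGroup Y] [NormedSpace ℝ Y] [CompleteSpace Y] {j : X →L[ℝ] Y} {B : X →L[ℝ] X}
    {B' : Y →L[ℝ] Y} (h : ∀ x, j (B x) = B' (j x)) {t : ℝ} (ht : 0 ≤ t) (x : X) :
    j (evol B t x) = evol B' t (j x) := by
  have hBc : Continuous fun t => evol B t x := (continuous_evol B).clm_apply continuous_const
  rw [← duhamel_zero (evol B')]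
  refine eq_duhamel_evol (y := fun t => j (evol B t x)) (fun t _ => intervalIntegrable_const)
    (j.continuous.comp hBc).continuousOn (fun t ht => ?_) ht
  have hs := duhamel_evol_spec (B := B) (x := x) (f := fun _ => 0)
    (fun t _ => intervalIntegrable_const) ht
  simp only [intervalIntegral.integral_zero, add_zero, duhamel_zero] at hs ⊢
  have hi : IntervalIntegrable (fun s => B (evol B s x)) volume 0 t :=
    (B.continuous.comp hBc).intervalIntegrable _ _
  rw [hs, map_sub, ← ContinuousLinearMap.intervalIntegral_comp_comm _ hi]
  simp only [h]

end

section

open scoped InnerProductSpace Topology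

/-! ### Inclusions between weighted spaces -/

theorem weightedMeasure_mono {a b : ℝ} (h : a ≤ b) : weightedMeasure b ≤ weightedMeasure a := by
  refine withDensity_mono ((ae_restrict_iff' measurableSet_Ioi).2 (Eventually.of_forall ?_))
  intro x hx
  refine ENNReal.ofReal_le_ofReal (Real.exp_le_exp.2 ?_)
  have hx : 0 < x := hx
  nlinarith

theorem incl_memLp {a b : ℝ} (h : a ≤ b) (v : L2a a) : MemLp v 2 (weightedMeasure b) :=
  (Lp.memLp v).mono_measure (weightedMeasure_mono h)

/-- The inclusion `L²_a → L²_b`, `a ≤ b`. -/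
def incl {a b : ℝ} (h : a ≤ b) : L2a a →L[ℝ] L2a b :=
  LinearMap.mkContinuous
    { toFun := fun v => (incl_memLp h v).toLp _
      map_add' := fun v w => L2a_ext <| by
        filter_upwards [ae_restrict_of_ae_weighted (incl_memLp h (v + w)).coeFn_toLp,
          ae_restrict_of_ae_weighted (incl_memLp h v).coeFn_toLp,
          ae_restrict_of_ae_weighted (incl_memLp h w).coeFn_toLp,
          coeFn_add' ((incl_memLp h v).toLp _) ((incl_memLp h w).toLp _), coeFn_add' v w]
          with x h1 h2 h3 h4 h5
        rw [h1, h4, h2, h3, h5]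
      map_smul' := fun c v => L2a_ext <| by
        filter_upwards [ae_restrict_of_ae_weighted (incl_memLp h (c • v)).coeFn_toLp,
          ae_restrict_of_ae_weighted (incl_memLp h v).coeFn_toLp,
          coeFn_smul' c ((incl_memLp h v).toLp _), coeFn_smul' c v] with x h1 h2 h3 h4
        simp only [RingHom.id_apply]
        rw [h1, h3, h2, h4] }
    1 fun v => by
      change ‖(incl_memLp h v).toLp _‖ ≤ _
      rw [Lp.norm_toLp, Lp.norm_def, one_mul]
      exact ENNReal.toReal_mono (Lp.memLp v).eLpNorm_ne_top
        (eLpNorm_mono_measure _ (weightedMeasure_mono h))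

theorem incl_coe {a b : ℝ} (h : a ≤ b) (v : L2a a) : incl h v =ᵐ[volume.restrict (Ioi 0)] v :=
  ae_restrict_of_ae_weighted (incl_memLp h v).coeFn_toLp

theorem norm_incl_le {a b : ℝ} (h : a ≤ b) (v : L2a a) : ‖incl h v‖ ≤ ‖v‖ := by
  simpa using (incl h).le_of_opNorm_le (LinearMap.mkContinuous_norm_le _ zero_le_one _) v

theorem incl_injective {a b : ℝ} (h : a ≤ b) : Function.Injective (incl h) := fun v w hvw =>
  L2a_ext ((incl_coe h v).symm.trans ((by rw [hvw] : (incl h v : ℝ → ℝ) =ᵐ[_] incl h w).trans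
    (incl_coe h w)))

theorem incl_incl {a b c : ℝ} (h : a ≤ b) (h' : b ≤ c) (v : L2a a) :
    incl h' (incl h v) = incl (h.trans h') v :=
  L2a_ext (((incl_coe h' _).trans (incl_coe h v)).trans (incl_coe (h.trans h') v).symm)

theorem incl_transportOp {μ : ℝ} (hμ : 0 < μ) {a b : ℝ} (ha : 0 < a) (hb : 0 < b) (h : a ≤ b)
    (v : L2a a) : incl h (transportOp hμ ha v) = transportOp hμ hb (incl h v) := by
  have hc : incl h (convCLM ha (besselB' hμ) v) = convCLM hb (besselB' hμ) (incl h v) := by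
    refine L2a_ext ?_
    filter_upwards [incl_coe h (convCLM ha (besselB' hμ) v), convCLM_coe ha (besselB' hμ) v,
      convCLM_coe hb (besselB' hμ) (incl h v), ae_restrict_mem measurableSet_Ioi] with x h1 h2 h3 hx
    rw [h1, h2, h3, causalConv_congr (incl_coe h v) (le_of_lt hx)]
  simp only [transportOp, add_apply, smul_apply, one_apply_eq_self, map_add, map_smul, hc]

/-- The norm in `L²_0` is the supremum of the weighted norms. -/
theorem eLpNorm_zero_le {z : ℝ → ℝ} (hz : Measurable z) {M : ℝ≥0∞}
    (h : ∀ b : ℝ, 0 < b → b ≤ 1 → eLpNorm z 2 (weightedMeasure b) ≤ M) :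
    eLpNorm z 2 (weightedMeasure 0) ≤ M := by
  have e (w : ℝ≥0∞) : (w ^ (1 / 2 : ℝ)) ^ 2 = w := by
    rw [← ENNReal.rpow_natCast, ← ENNReal.rpow_mul]; norm_num
  have hsq : ∀ b : ℝ, 0 < b → b ≤ 1 →
      ∫⁻ x in Ioi (0 : ℝ), ENNReal.ofReal (Real.exp (-2 * b * x)) * ‖z x‖ₑ ^ 2 ≤ M ^ 2 := by
    intro b hb hb1
    have := pow_le_pow_left₀ zero_le (h b hb hb1) 2
    rwa [eLpNorm_two_eq, e, lintegral_weighted] at this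
  have key : ∫⁻ x in Ioi (0 : ℝ), ENNReal.ofReal (Real.exp (-2 * 0 * x)) * ‖z x‖ₑ ^ 2 ≤ M ^ 2 := by
    -- Along `b = 1/(n+1)` the weights increase to `1` on the half-line, so monotone convergence
    -- applies.
    have hb0 : Tendsto (fun n : ℕ => 1 / ((n : ℝ) + 1)) atTop (𝓝 0) :=
      tendsto_one_div_add_atTop_nhds_zero_nat
    refine le_of_tendsto' (lintegral_tendsto_of_tendsto_of_monotone (μ := volume.restrict (Ioi 0))
      (f := fun (n : ℕ) x => ENNReal.ofReal (Real.exp (-2 * (1 / ((n : ℝ) + 1)) * x)) * ‖z x‖ₑ ^ 2)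
      (fun n => by fun_prop) ?_ ?_) fun n => hsq _ (by positivity) ?_
    · refine (ae_restrict_iff' measurableSet_Ioi).2 (Eventually.of_forall fun x hx n m hnm => ?_)
      have hx : 0 < x := hx
      have : 1 / ((m : ℝ) + 1) ≤ 1 / ((n : ℝ) + 1) := by
        have : (n : ℝ) ≤ m := by exact_mod_cast hnm
        gcongr
      simp only
      gcongr ENNReal.ofReal (Real.exp ?_) * _
      nlinarith
    · refine Eventually.of_forall fun x => ?_
      refine ENNReal.Tendsto.mul_const ?_ (Or.inr (by finiteness))
      refine ENNReal.tendsto_ofReal ?_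
      have hc : Continuous fun b : ℝ => Real.exp (-2 * b * x) := by fun_prop
      exact (hc.tendsto 0).comp hb0
    · rw [div_le_one (by positivity)]
      linarith [(Nat.cast_nonneg n : (0 : ℝ) ≤ n)]
  rw [eLpNorm_two_eq, lintegral_weighted]
  have := ENNReal.rpow_le_rpow key (by norm_num : (0 : ℝ) ≤ 1 / 2)
  refine this.trans (le_of_eq ?_)
  rw [← ENNReal.rpow_natCast, ← ENNReal.rpow_mul]
  norm_num

/-- The evolution on `L²_1` preserves `L²_0` and is contractive there. -/
theorem evol_descends {μ : ℝ} (hμ : 0 < μ) {t : ℝ} (ht : 0 ≤ t) (x : L2a 0) :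
    ∃ y : L2a 0, incl zero_le_one y =
      evol (transportOp hμ one_pos) t (incl zero_le_one x) ∧ ‖y‖ ≤ ‖x‖ := by
  set z : L2a 1 := evol (transportOp hμ one_pos) t (incl zero_le_one x) with hz
  have hzm : Measurable z := (Lp.stronglyMeasurable z).measurable
  have hle : eLpNorm z 2 (weightedMeasure 0) ≤ ENNReal.ofReal ‖x‖ := by
    refine eLpNorm_zero_le hzm fun b hb hb1 => ?_
    -- The evolution in `L²_b` agrees with `z` under the inclusion and is contractive for each `b`.
    -- Its decay rate may degenerate as `b → 0`, but only its sign is used.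
    set zb : L2a b := evol (transportOp hμ hb) t (incl hb.le x) with hzb
    have h1 : incl hb1 zb = z := by
      rw [hzb, map_evol (j := incl hb1) (B' := transportOp hμ one_pos)
        (incl_transportOp hμ hb one_pos hb1) ht, incl_incl]
    have h2 : z =ᵐ[weightedMeasure b] zb := by
      refine ae_weighted_iff.2 ?_
      rw [← h1]
      exact incl_coe hb1 zb
    obtain ⟨c, hc, hcoer⟩ := exists_coercive hμ hb
    have h3 : ‖zb‖ ≤ ‖x‖ := by
      refine (norm_evol_le hcoer ht _).trans ((mul_le_of_le_one_left (norm_nonneg _) ?_).trans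
        (norm_incl_le _ _))
      rw [Real.exp_le_one_iff]
      nlinarith
    rw [eLpNorm_congr_ae h2]
    rw [← ENNReal.ofReal_toReal (Lp.memLp zb).eLpNorm_ne_top, ← Lp.norm_def]
    exact ENNReal.ofReal_le_ofReal h3
  have hzL : MemLp z 2 (weightedMeasure 0) :=
    ⟨hzm.aestronglyMeasurable, hle.trans_lt ENNReal.ofReal_lt_top⟩
  refine ⟨hzL.toLp z, L2a_ext ((incl_coe _ _).trans
    (ae_restrict_of_ae_weighted hzL.coeFn_toLp)), ?_⟩
  rw [Lp.norm_toLp]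
  exact ENNReal.toReal_le_of_le_ofReal (norm_nonneg _) hle

/-- The evolution on `L²_0`. -/
theorem exists_unweighted_evolution {μ : ℝ} (hμ : 0 < μ) :
    ∃ S : ℝ → L2a 0 →L[ℝ] L2a 0, (∀ t x, ‖S t x‖ ≤ ‖x‖) ∧
      (∀ (b : ℝ) (hb : 0 < b) (t : ℝ), 0 ≤ t → ∀ x,
        incl hb.le (S t x) = evol (transportOp hμ hb) t (incl hb.le x)) ∧
      (∀ t, t ≤ 0 → ∀ x, S t x = x) ∧ Continuous fun p : ℝ × L2a 0 => S p.1 p.2 := by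
  obtain ⟨S, h1, h2, h3, h4⟩ := exists_descent (incl_injective zero_le_one)
    (transportOp hμ one_pos) fun t ht x => evol_descends hμ ht x
  refine ⟨S, h1, fun b hb t ht x => ?_, h3, h4⟩
  -- For `b ≤ 1` the comparison takes place in `L²_1`; for `b ≥ 1` the identity in `L²_1` is pushed
  -- forward to `L²_b`.
  rcases le_total b 1 with hb1 | hb1
  · refine incl_injective hb1 ?_
    rw [incl_incl, h2 t ht, map_evol (j := incl hb1) (B' := transportOp hμ one_pos)
      (incl_transportOp hμ hb one_pos hb1) ht, incl_incl]
  · have h := congrArg (incl hb1) (h2 t ht x)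
    rw [incl_incl, map_evol (j := incl hb1) (B' := transportOp hμ hb)
      (incl_transportOp hμ one_pos hb hb1) ht, incl_incl] at h
    exact h

/-! ### The unweighted problem -/

theorem hasWeakDeriv_incl {a b : ℝ} (h : a ≤ b) {v w : L2a a} :
    HasWeakDeriv (incl h v) (incl h w) ↔ HasWeakDeriv v w :=
  ⟨fun hw => hw.congr (incl_coe h v) (incl_coe h w),
    fun hw => hw.congr (incl_coe h v).symm (incl_coe h w).symm⟩

/-- The inclusion `H¹_a → H¹_b`, `a ≤ b`. -/
def inclH {a b : ℝ} (h : a ≤ b) : H1a a →L[ℝ] H1a b :=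
  LinearMap.mkContinuous
    { toFun := fun v => mkH1a (incl h (toL2 v)) (incl h (dx v))
        ((hasWeakDeriv_incl h).2 (hasWeakDeriv_H1a v))
      map_add' := fun v w => H1a_ext' (map_add (incl h) (toL2 v) (toL2 w))
        (map_add (incl h) (dx v) (dx w))
      map_smul' := fun c v => H1a_ext' (map_smul (incl h) c (toL2 v))
        (map_smul (incl h) c (dx v)) } 1 fun v => by
      rw [one_mul, norm_eq, norm_eq]
      exact add_le_add (norm_incl_le h _) (norm_incl_le h _)

theorem HasBoundaryValue.congr {v w : ℝ → ℝ} {c : ℝ} (h : HasBoundaryValue v c)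
    (hvw : v =ᵐ[volume.restrict (Ioi 0)] w) : HasBoundaryValue w c := by
  obtain ⟨g, h1, h2, h3⟩ := h
  exact ⟨g, h1, hvw.symm.trans h2, h3⟩

theorem locallyIntegrableOn_inclH {a b : ℝ} (h : a ≤ b) {f : ℝ → H1a a}
    (hf : LocallyIntegrableOn f (Ici 0) volume) :
    LocallyIntegrableOn (fun t => inclH h (f t)) (Ici 0) volume :=
  locallyIntegrableOn_of_intervalIntegrable fun _ ht =>
    have hi := intervalIntegrable_of_locallyIntegrableOn hf ht
    ⟨(inclH h).integrable_comp hi.1, (inclH h).integrable_comp hi.2⟩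

theorem unweighted_theorem {μ : ℝ} (hμ : 0 < μ) (f : ℝ → H1a 0) (uin : H1a 0) (hf : MemY1 f)
    (hin : HasBoundaryValue (toL2 uin) 0)
    (hcomp : ∀ᵐ t ∂(volume.restrict (Ioi (0 : ℝ))), HasBoundaryValue (toL2 (f t)) 0) :
    ∃ u : ℝ → H1a 0,
      IsUnweightedSolution μ (fun t => toL2 (f t)) (toL2 uin) (fun _ => 0) u ∧
      (∀ v : ℝ → H1a 0,
        IsUnweightedSolution μ (fun t => toL2 (f t)) (toL2 uin) (fun _ => 0) v →
        EqOn v u (Ici 0)) ∧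
      ∀ t : ℝ, 0 ≤ t → ‖u t‖ ≤ ‖uin‖ + ∫ s in (0 : ℝ)..t, ‖f s‖ := by
  obtain ⟨f', hf'⟩ := hf.w11
  obtain ⟨g, hg, hfg⟩ := hf'.exists_continuousOn
  obtain ⟨S, hS, hSb, hS0, hSc⟩ := exists_unweighted_evolution hμ
  have hF : ∀ (b : ℝ) (hb : 0 ≤ b), ∀ᵐ t ∂(volume.restrict (Ioi (0 : ℝ))),
      (toL2 (f t) : ℝ → ℝ) =ᵐ[volume.restrict (Ioi 0)] toL2 (inclH hb (f t)) := fun b hb =>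
    Eventually.of_forall fun t => (incl_coe hb _).symm
  have hinb : ∀ (b : ℝ) (hb : 0 ≤ b),
      (toL2 uin : ℝ → ℝ) =ᵐ[volume.restrict (Ioi 0)] toL2 (inclH hb uin) := fun b hb =>
    (incl_coe hb _).symm
  set U : ℝ → L2a 0 := duhamel S (toL2 uin) fun t => toL2 (f t) with hU
  set W : ℝ → L2a 0 := duhamel S (dx uin) fun t => dx (f t) with hW
  have hsol : ∀ (b : ℝ) (hb : 0 < b), ∃ v : ℝ → H1a b,
      IsSolution μ (fun t => toL2 (f t)) (toL2 uin) (fun _ => 0) v ∧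
      ∀ t, 0 ≤ t → toL2 (v t) = incl hb.le (U t) ∧ dx (v t) = incl hb.le (W t) := by
    intro b hb
    obtain ⟨v, hv, hdv⟩ := exists_solution hμ hb (f := fun t => inclH hb.le (f t))
      (F := fun t => toL2 (f t)) (u₀ := inclH hb.le uin) (uin := toL2 uin) (ub := fun _ => 0)
      (ub' := fun _ => 0) (g := fun t => incl hb.le (g t))
      (locallyIntegrableOn_inclH hb.le hf.locInt)
      ((incl hb.le).continuous.comp_continuousOn hg)
      (hfg.mono fun t ht => congrArg (incl hb.le) ht) (hF b hb.le) (hinb b hb.le)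
      continuousOn_const (fun t _ => intervalIntegrable_const) (fun t _ => by simp)
      (hin.congr (hinb b hb.le)) (by
        filter_upwards [hcomp, hF b hb.le] with t h1 h2 using h1.congr h2)
    refine ⟨v, hv, fun t ht => ⟨?_, ?_⟩⟩
    · rw [IsSolution.toL2_eq_duhamel hμ hb hv (locallyIntegrableOn_inclH hb.le hf.locInt)
        continuousOn_const (hF b hb.le) (hinb b hb.le) ht, hU,
        map_duhamel hS hSc (hSb b hb) ht (intervalIntegrable_toL2 hf.locInt ht)]
      simp only [zero_smul, add_zero]
      rfl
    · rw [hdv t, hW, map_duhamel hS hSc (hSb b hb) ht (intervalIntegrable_dx hf.locInt ht)]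
      rfl
  -- Weak derivatives do not see the weight, so the relation is read off from the solution with
  -- weight `1`.
  have hweak : ∀ t, 0 ≤ t → HasWeakDeriv (U t) (W t) := by
    intro t ht
    obtain ⟨v, -, hv⟩ := hsol 1 one_pos
    have h := hasWeakDeriv_H1a (v t)
    rw [(hv t ht).1, (hv t ht).2] at h
    exact (hasWeakDeriv_incl _).1 h
  -- The relation between `U` and `W` is established only for `t ≥ 0`, so negative times are clipped
  -- to `0`.
  set u : ℝ → H1a 0 := fun t => mkH1a (U (max t 0)) (W (max t 0)) (hweak _ (le_max_right _ _))
    with hu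
  have hut : ∀ t, 0 ≤ t → toL2 (u t) = U t := fun t ht => by
    change U (max t 0) = U t
    rw [max_eq_left ht]
  have hudx : ∀ t, 0 ≤ t → dx (u t) = W t := fun t ht => by
    change W (max t 0) = W t
    rw [max_eq_left ht]
  have husol : IsUnweightedSolution μ (fun t => toL2 (f t)) (toL2 uin) (fun _ => 0) u := by
    refine ⟨continuousOn_H1a ?_ ?_, fun b hb => ?_⟩
    · exact (continuousOn_duhamel hS hSc hS0
        (fun t ht => intervalIntegrable_toL2 hf.locInt ht) _).congr hut
    · exact (continuousOn_duhamel hS hSc hS0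
        (fun t ht => intervalIntegrable_dx hf.locInt ht) _).congr hudx
    · obtain ⟨v, hv, hv'⟩ := hsol b hb
      refine ⟨v, hv, fun t ht => ?_⟩
      rw [(hv' t ht).1, hut t ht]
      exact incl_coe _ _
  refine ⟨u, husol, fun v hv t ht => ?_, fun t ht => ?_⟩
  · obtain ⟨v₁, hv₁, hvv⟩ := hv.solves 1 one_pos
    obtain ⟨u₁, hu₁, huu⟩ := husol.solves 1 one_pos
    have h := IsSolution.unique hμ one_pos hv₁ hu₁
      (locallyIntegrableOn_inclH zero_le_one hf.locInt) continuousOn_const (hF 1 zero_le_one)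
      (hinb 1 zero_le_one) ht
    refine H1a_ext (L2a_ext ((hvv t ht).symm.trans ?_))
    rw [h]
    exact huu t ht
  · have hS' : ∀ s, 0 ≤ s → ∀ x, ‖S s x‖ ≤ Real.exp (-0 * s) * ‖x‖ := fun s _ x => by
      simpa using hS s x
    have b1 := norm_duhamel_le hS' (x := toL2 uin) ht (intervalIntegrable_toL2 hf.locInt ht).norm
      fun s => le_rfl
    have b2 := norm_duhamel_le hS' (x := dx uin) ht (intervalIntegrable_dx hf.locInt ht).norm
      fun s => le_rfl
    simp only [neg_zero, zero_mul, Real.exp_zero, one_mul] at b1 b2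
    rw [norm_eq, hut t ht, hudx t ht]
    refine (add_le_add b1 b2).trans (le_of_eq ?_)
    rw [add_add_add_comm, ← norm_eq uin, ← intervalIntegral.integral_add
      (intervalIntegrable_toL2 hf.locInt ht).norm (intervalIntegrable_dx hf.locInt ht).norm]
    simp only [norm_eq]

end

end NonlocalTransport

end

theorem mainTheorem10 (μ : ℝ) (hμ : 0 < μ) :
    (∀ a : ℝ, 0 < a →
      MemLp (besselKernel μ) 2 (weightedMeasure a) ∧
      ∃ c : ℝ, 0 < c ∧
        ∀ (f : ℝ → H1a a) (uin : H1a a) (ub ub' : ℝ → ℝ),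
          MemY1 f →
          ContinuousOn ub (Ici 0) →
          IsW11Loc ub ub' →
          HasBoundaryValue (toL2 uin) (ub 0) →
          (∀ᵐ t ∂(volume.restrict (Ioi (0 : ℝ))),
            HasBoundaryValue (toL2 (f t)) (ub' t)) →
          ∃ u : ℝ → H1a a,
            IsSolution μ (fun t => toL2 (f t)) (toL2 uin) ub u ∧
            (∀ v : ℝ → H1a a,
              IsSolution μ (fun t => toL2 (f t)) (toL2 uin) ub v →
              EqOn v u (Ici 0)) ∧
            ∀ t : ℝ, 0 ≤ t →
              ‖u t‖ ≤ Real.exp (-c * t) * ‖uin‖ +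
                ∫ s in (0 : ℝ)..t, Real.exp (-c * (t - s)) *
                  (‖f s‖ + (eLpNorm (besselKernel μ) 2
                    (weightedMeasure a)).toReal * |ub s|)) ∧
    (∀ (f : ℝ → H1a 0) (uin : H1a 0),
      MemY1 f →
      HasBoundaryValue (toL2 uin) 0 →
      (∀ᵐ t ∂(volume.restrict (Ioi (0 : ℝ))),
        HasBoundaryValue (toL2 (f t)) 0) →
      ∃ u : ℝ → H1a 0,
        IsUnweightedSolution μ (fun t => toL2 (f t)) (toL2 uin) (fun _ => 0) u ∧
        (∀ v : ℝ → H1a 0,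
          IsUnweightedSolution μ (fun t => toL2 (f t)) (toL2 uin)
            (fun _ => 0) v →
          EqOn v u (Ici 0)) ∧
        ∀ t : ℝ, 0 ≤ t → ‖u t‖ ≤ ‖uin‖ + ∫ s in (0 : ℝ)..t, ‖f s‖) := by
  exact ⟨fun _ ha => weighted_theorem hμ ha, unweighted_theorem hμ⟩
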